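/- \textbf{Notation.} Vectors live in $(\mathbb C^2)^{\otimes n}$. $\mathcal P_n$ is the $n$-qubit Pauli group with phases $\pm1,\pm i$, and $\mathcal C_n=\{U\in U(2^n): U\mathcal P_nU^\dagger=\mathcal P_n\}$ is the Clifford group. For a permutation $\pi$ of the $n$ qubits, $U_\pi$ is the unitary that permutes the qubits accordingly; a unitary $C$ is called a \emph{qubit permutation} if $C=\omega U_\pi$ for some $\pi$ and some $\omega\in\mathbb C$ with $|\omega|=1$. A stabilizer state is a vector $U|0^n\rangle$ with $U\in\mathcal C_n$; a vector has stabilizer rank at most $r$ if it is a linear combination of $r$ stabilizer states. Let $|R\rangle=\frac1{\sqrt2}(|0\rangle+e^{i\pi/8}|1\rangle)$, and for $n\ge2$ let $|M\rangle=|M_n\rangle$ be the normalization of $\sum_{1\le i<j\le n}|R_iR_j0\cdots0\rangle$, where the summand has $|R\rangle$ on qubits $i,j$ and $|0\rangle$ on all others. For a graph $G$ on $n$ vertices, $|G\rangle=2^{-n/2}\sum_x\prod_{ij\in E(G)}(-1)^{x_ix_j}|x\rangle$ is its graph state. \textbf{Theorem.} \begin{enumerate} \item For every $n\ge2$, $|M\rangle$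 is a unit vector of stabilizer rank at most $2n(n-1)$, and every $a|M\rangle+b|G\rangle$ ($a,b$ real, $G$ a graph on $n$ vertices) has stabilizer rank at most $2n(n-1)+1$. \item For every $\kappa>0$ there is $n_0$ such that for all $n\ge n_0$ and all $C\in\mathcal C_n$: if $\mathrm{Re}\langle M|C|M\rangle\ge1-\kappa/n^{11}$, then $C$ is a qubit permutation. \item For all $0<k_1\le k_2$ there are $l_1,l_2>0$ and $n_0$ such that for all $n\ge n_0$, all real $a$ with $k_1/n^{22}\le 1-a\le k_2/n^{22}$ and every graph $G$ on $n$ vertices there is exactly one $b>0$ for which $a|M\rangle+b|G\rangle$ is a unit vector, and it satisfies $l_1/n^{11}\le b\le l_2/n^{11}$. \item For all $0<k_1\le k_2$ and $c>0$ there is $n_0$ such that for all $n\ge n_0$, all real $a$ with $k_1/n^{22}\le1-a\le k_2/n^{22}$, all $b_1,b_2>0$ and all graphs $G_1,G_2$ on $n$ vertices such that $|\psi_1\rangle=a|M\rangle+b_1|G_1\rangle$ and $|\psi_2\rangle=a|M\rangle+b_2|G_2\rangle$ are unit vectors: \begin{enumerate} \item every $C\in\mathcal C_n$ with $\mathrm{Re}\langle\psi_1|C|\psi_2\rangle\ge1-c/n^{22}$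 is a qubit permutation; \item if some $C\in\mathcal C_n$ satisfies $\mathrm{Re}\langle\psi_1|C|\psi_2\rangle\ge1-c/n^{23}$, then $C$ is a qubit permutation and $G_1\cong G_2$; \item if $G_1\cong G_2$, then there is a permutation $\pi$ of the qubits with $U_\pi\in\mathcal C_n$ and $|\psi_1\rangle=U_\pi|\psi_2\rangle$. \end{enumerate} \item For every $c>0$, Graph Isomorphism reduces by a polynomial-time many-one reduction (computed by a multi-tape Turing machine) to the following promise problem. An input consists of a number $n\ge1$ of qubits (in unary) and two lists of at most $2n(n-1)+1$ summands each; a summand is a coefficient $r e^{2\pi i\theta}$ with rationals $r,\theta\ge0$, written in binary, and a stabilizer state, given as a circuit of Hadamard, phase and controlled-$Z$ gates applied to $|0^n\rangle$. The two lists describe the states $|\psi_1\rangle,|\psi_2\rangle$ obtained by normalizing the two linear combinations, which are promised to be nonzero. \emph{Yes}: some $C\in\mathcal C_n$ has $\mathrm{Re}\langle\psi_1|C|\psi_2\rangle\ge1$ (so $|\psi_1\rangle=C|\psi_2\rangle$). \emph{No}: $|\langle\psi_1|C|\psi_2\rangle|\le1-c/n^{23}$ for all $C\in\mathcal C_n$.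 \end{enumerate} -/

import Mathlib

open scoped Matrix

noncomputable section

namespace CliffordIso

/-! ### Qubits, states, operators -/

/-- Computational basis labels of `n` qubits. -/
abbrev Bits (n : ℕ) : Type := Fin n → Fin 2

/-- Vectors of `(ℂ²)^{⊗ n}`, by their amplitudes in the computational basis. -/
abbrev Ket (n : ℕ) : Type := Bits n → ℂ

/-- Operators on `(ℂ²)^{⊗ n}`, as matrices in the computational basis. -/
abbrev Op (n : ℕ) : Type := Matrix (Bits n) (Bits n) ℂ

/-- The matrix element `⟨φ|C|ψ⟩`. -/
def braket {n : ℕ} (φ : Ket n) (C : Op n) (ψ : Ket n) : ℂ := star φ ⬝ᵥ (C *ᵥ ψ)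

/-- The squared Hilbert space norm `⟨ψ|ψ⟩`. -/
def normSq {n : ℕ} (ψ : Ket n) : ℝ := ∑ x, ‖ψ x‖ ^ 2

/-- A quantum state: a vector of norm one. -/
def IsState {n : ℕ} (ψ : Ket n) : Prop := normSq ψ = 1

/-- The vector rescaled to norm one (and `0` for the zero vector). -/
def normalize {n : ℕ} (ψ : Ket n) : Ket n := ((1 / Real.sqrt (normSq ψ) : ℝ) : ℂ) • ψ

/-- The product vector `v₁ ⊗ ⋯ ⊗ vₙ`. -/
def productKet {n : ℕ} (v : Fin n → Fin 2 → ℂ) : Ket n := fun x => ∏ k, v k (x k)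

/-- The single-qubit state `|0⟩`. -/
def ket0 : Fin 2 → ℂ := ![1, 0]

/-- The state `|0ⁿ⟩`. -/
def zeroKet (n : ℕ) : Ket n := productKet fun _ => ket0

/-! ### Pauli group, Clifford group, qubit permutations -/

/-- The four matrices `I, X, Y, Z`. -/
def singlePauli : Fin 4 → Matrix (Fin 2) (Fin 2) ℂ :=
  ![!![1, 0; 0, 1], !![0, 1; 1, 0], !![0, -Complex.I; Complex.I, 0], !![1, 0; 0, -1]]

/-- The tensor product `P₁ ⊗ ⋯ ⊗ Pₙ` of single-qubit Pauli matrices. -/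
def pauliString {n : ℕ} (P : Fin n → Fin 4) : Op n :=
  Matrix.of fun x y => ∏ k, singlePauli (P k) (x k) (y k)

/-- The `n`-qubit Pauli group, with phases `±1, ±i`. -/
def pauliGroup (n : ℕ) : Set (Op n) :=
  {A | ∃ ω : ℂ, (ω = 1 ∨ ω = -1 ∨ ω = Complex.I ∨ ω = -Complex.I) ∧
    ∃ P : Fin n → Fin 4, A = ω • pauliString P}

/-- The `n`-qubit Clifford group: the normalizer of the Pauli group in `U(2ⁿ)`. -/
def cliffordGroup (n : ℕ) : Set (Op n) :=
  {U | U ∈ Matrix.unitaryGroup (Bits n) ℂ ∧ (fun P => U * P * Uᴴ) '' pauliGroup n = pauliGroup n}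

/-- The unitary that permutes the qubits by `π`: it sends `|y⟩` to `|y ∘ π⁻¹⟩`. -/
def qubitPerm {n : ℕ} (π : Equiv.Perm (Fin n)) : Op n :=
  Matrix.of fun x y => if x = y ∘ π.symm then 1 else 0

/-- `C` is a permutation on qubits, up to a global phase. -/
def IsQubitPerm {n : ℕ} (C : Op n) : Prop :=
  ∃ (π : Equiv.Perm (Fin n)) (ω : ℂ), ‖ω‖ = 1 ∧ C = ω • qubitPerm π

/-! ### Stabilizer states and stabilizer rank -/

/-- A stabilizer state: the image of `|0ⁿ⟩` under a Clifford unitary. -/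
def IsStabilizerState {n : ℕ} (ψ : Ket n) : Prop :=
  ∃ U ∈ cliffordGroup n, ψ = U *ᵥ zeroKet n

/-- `ψ` is a linear combination of `r` stabilizer states, that is, it has stabilizer rank at
most `r`. -/
def StabilizerRankLE {n : ℕ} (ψ : Ket n) (r : ℕ) : Prop :=
  ∃ (c : Fin r → ℂ) (s : Fin r → Ket n),
    (∀ t, IsStabilizerState (s t)) ∧ ψ = ∑ t, c t • s t

/-! ### The states `|M⟩`, `|G⟩` and `a|M⟩ + b|G⟩` -/

/-- The single-qubit state `|R⟩ = (|0⟩ + e^{iπ/8}|1⟩)/√2`. -/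
def ketR : Fin 2 → ℂ :=
  ![1 / (Real.sqrt 2 : ℂ), Complex.exp (Complex.I * Real.pi / 8) / (Real.sqrt 2 : ℂ)]

/-- The product state with `|R⟩` on the qubits `i` and `j` and `|0⟩` on all others. -/
def pairKet {n : ℕ} (i j : Fin n) : Ket n :=
  productKet fun k => if k = i ∨ k = j then ketR else ket0

/-- The state `|M⟩`: the normalized sum of the states `|R_i R_j 0 ⋯ 0⟩` over all `i < j`. -/
def ketM (n : ℕ) : Ket n :=
  normalize (∑ p ∈ Finset.univ.filter (fun p : Fin n × Fin n => p.1 < p.2), pairKet p.1 p.2)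

open Classical in
/-- The graph state `|G⟩ = 2^{-n/2} ∑ₓ ∏_{ij ∈ E(G)} (-1)^{x_i x_j} |x⟩`. -/
def graphState {n : ℕ} (G : SimpleGraph (Fin n)) : Ket n := fun x =>
  (1 / (Real.sqrt (2 ^ n) : ℂ)) *
    ∏ p ∈ Finset.univ.filter (fun p : Fin n × Fin n => p.1 < p.2 ∧ G.Adj p.1 p.2),
      (-1 : ℂ) ^ ((x p.1 : ℕ) * (x p.2 : ℕ))

/-- The vector `a|M⟩ + b|G⟩`. -/
def psi {n : ℕ} (a b : ℝ) (G : SimpleGraph (Fin n)) : Ket n :=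
  (a : ℂ) • ketM n + (b : ℂ) • graphState G

/-! ### Classical descriptions of linear combinations of stabilizer states -/

/-- The Clifford gates Hadamard, phase gate and controlled-`Z` on `n` qubits. -/
inductive Gate (n : ℕ) : Type
  | h (i : Fin n) : Gate n
  | s (i : Fin n) : Gate n
  | cz (i j : Fin n) (hij : i ≠ j) : Gate n

/-- The action of a gate on a vector. -/
def Gate.apply {n : ℕ} : Gate n → Ket n → Ket n
  | .h i, ψ => fun x =>
      (ψ (Function.update x i 0) + (-1) ^ (x i : ℕ) * ψ (Function.update x i 1)) /
        (Real.sqrt 2 : ℂ)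
  | .s i, ψ => fun x => Complex.I ^ (x i : ℕ) * ψ x
  | .cz i j _, ψ => fun x => (-1) ^ ((x i : ℕ) * (x j : ℕ)) * ψ x

/-- The stabilizer state prepared from `|0ⁿ⟩` by a Clifford circuit (first gate first). -/
def circuitState {n : ℕ} (gates : List (Gate n)) : Ket n :=
  gates.foldl (fun ψ g => g.apply ψ) (zeroKet n)

/-- One summand of a linear combination: the coefficient
`(modNum / modDen) · exp(2πi · argNum / argDen)` in polar form, with rational modulus and a
rational number of turns, and a Clifford circuit that prepares the stabilizer state. -/
structure Term (n : ℕ) : Type where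
  modNum : ℕ
  modDen : ℕ+
  argNum : ℕ
  argDen : ℕ+
  gates : List (Gate n)

/-- The complex coefficient of a summand. -/
def Term.coeff {n : ℕ} (t : Term n) : ℂ :=
  ((t.modNum : ℂ) / ((t.modDen : ℕ) : ℂ)) *
    Complex.exp (2 * Real.pi * Complex.I * ((t.argNum : ℂ) / ((t.argDen : ℕ) : ℂ)))

/-- The vector described by a list of summands. -/
def combination {n : ℕ} (l : List (Term n)) : Ket n :=
  (l.map fun t => t.coeff • circuitState t.gates).sum

/-- An input of the isomorphism problem: a number of qubits and two linear combinations of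
stabilizer states, which describe the states obtained from them by normalization. -/
structure Input : Type where
  n : ℕ
  left : List (Term n)
  right : List (Term n)

/-- The first state of an input. -/
def Input.ψ₁ (I : Input) : Ket I.n := normalize (combination I.left)

/-- The second state of an input. -/
def Input.ψ₂ (I : Input) : Ket I.n := normalize (combination I.right)

/-! ### Promise problems and polynomial-time reductions -/

/-- A promise problem on the objects of type `A`. -/
structure PromiseProblem (A : Type) : Type where
  yes : A → Prop
  no : A → Prop

/-- A polynomial-time many-one reduction between promise problems, for given encodings of the
inputs as strings; the map is computed by a multi-stack Turing machine in polynomial time. -/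
def PolyTimeReduces {A B Γ Δ : Type} (encA : A → List Γ) (encB : B → List Δ)
    (P : PromiseProblem A) (Q : PromiseProblem B) : Prop :=
  ∃ f : A → B, Nonempty (Turing.TM2ComputableInPolyTime encA encB f) ∧
    (∀ x, P.yes x → Q.yes (f x)) ∧ (∀ x, P.no x → Q.no (f x))

/-- An input of Graph Isomorphism: two graphs with the same number of vertices. -/
structure GraphPair : Type where
  n : ℕ
  G₁ : SimpleGraph (Fin n)
  G₂ : SimpleGraph (Fin n)

/-- Graph Isomorphism. -/
def graphIsomorphism : PromiseProblem GraphPair where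
  yes P := Nonempty (P.G₁ ≃g P.G₂)
  no P := ¬ Nonempty (P.G₁ ≃g P.G₂)

/-- The promise common to all inputs: there is at least one qubit, each of the two lists has at
most `r n` summands, and the linear combinations do not vanish, so that they describe states. -/
def Input.IsValid (r : ℕ → ℕ) (I : Input) : Prop :=
  1 ≤ I.n ∧ I.left.length ≤ r I.n ∧ I.right.length ≤ r I.n ∧
    combination I.left ≠ 0 ∧ combination I.right ≠ 0

/-- The `(α, β)`-Pure State Clifford Isomorphism problem for states given as linear combinations
of at most `r n` stabilizer states of `n` qubits, where `α` and `β` may depend on `n`. -/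
def cliffordIsomorphism (r : ℕ → ℕ) (α β : ℕ → ℝ) : PromiseProblem Input where
  yes I := I.IsValid r ∧ ∃ C ∈ cliffordGroup I.n, β I.n ≤ (braket I.ψ₁ C I.ψ₂).re
  no I := I.IsValid r ∧ ∀ C ∈ cliffordGroup I.n, ‖braket I.ψ₁ C I.ψ₂‖ ≤ α I.n

/-! ### Encodings of the inputs as strings -/

open Classical in
/-- The adjacency matrix, row by row. -/
def encodeGraph {n : ℕ} (G : SimpleGraph (Fin n)) : List Bool :=
  (List.finRange n).flatMap fun i => (List.finRange n).map fun j => decide (G.Adj i j)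

/-- A pair of graphs: the number of vertices in unary, then both adjacency matrices. -/
def encodeGraphPair (P : GraphPair) : List Bool :=
  List.replicate P.n true ++ false :: (encodeGraph P.G₁ ++ encodeGraph P.G₂)

/-- The alphabet for inputs of the Clifford isomorphism problem. -/
inductive Sym : Type
  | tick : Sym
  | sep : Sym
  | bit (b : Bool) : Sym
  | h : Sym
  | s : Sym
  | cz : Sym

/-- A number in unary. -/
def encodeUnary (k : ℕ) : List Sym := List.replicate k Sym.tick ++ [Sym.sep]

/-- A number in binary. -/
def encodeBinary (k : ℕ) : List Sym := (Computability.encodeNat k).map Sym.bit ++ [Sym.sep]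

/-- A list, for a given encoding of its members. -/
def encodeList {A : Type} (f : A → List Sym) : List A → List Sym
  | [] => [Sym.sep]
  | x :: l => Sym.tick :: (f x ++ encodeList f l)

/-- A gate. -/
def encodeGate {n : ℕ} : Gate n → List Sym
  | .h i => Sym.h :: encodeUnary i
  | .s i => Sym.s :: encodeUnary i
  | .cz i j _ => Sym.cz :: (encodeUnary i ++ encodeUnary j)

/-- A summand. -/
def encodeTerm {n : ℕ} (t : Term n) : List Sym :=
  encodeBinary t.modNum ++ (encodeBinary t.modDen ++ (encodeBinary t.argNum ++
    (encodeBinary t.argDen ++ encodeList encodeGate t.gates)))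

/-- An input of the Clifford isomorphism problem. -/
def encodeInput (I : Input) : List Sym :=
  encodeUnary I.n ++ (encodeList encodeTerm I.left ++ encodeList encodeTerm I.right)

/-! The encodings are faithful: different inputs are encoded by different strings. -/

theorem encodeUnary_prefix {k l : ℕ} {s t : List Sym}
    (e : encodeUnary k ++ s = encodeUnary l ++ t) : k = l ∧ s = t := by
  induction k generalizing l with
  | zero => cases l with
    | zero => simpa [encodeUnary] using e
    | succ l => simp [encodeUnary, List.replicate_succ] at e
  | succ k ih => cases l with
    | zero => simp [encodeUnary, List.replicate_succ] at e
    | succ l =>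
      have := ih (l := l) (by simpa [encodeUnary, List.replicate_succ] using e)
      exact ⟨by omega, this.2⟩

theorem encodeBinary_prefix {k l : ℕ} {s t : List Sym}
    (e : encodeBinary k ++ s = encodeBinary l ++ t) : k = l ∧ s = t := by
  have key : ∀ (u v : List Bool) (s t : List Sym),
      u.map Sym.bit ++ [Sym.sep] ++ s = v.map Sym.bit ++ [Sym.sep] ++ t → u = v ∧ s = t := by
    intro u
    induction u with
    | nil => intro v s t h; cases v <;> simp_all
    | cons a u ih => intro v s t h; cases v with
      | nil => simp at h
      | cons b v =>
        simp only [List.map_cons, List.cons_append, List.cons.injEq, Sym.bit.injEq] at h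
        obtain ⟨h1, h2⟩ := ih v s t h.2
        exact ⟨by rw [h.1, h1], h2⟩
  obtain ⟨h1, h2⟩ := key _ _ s t e
  exact ⟨Computability.encodingNatBool.encode_injective h1, h2⟩

theorem encodeList_prefix {A : Type} {f : A → List Sym}
    (hf : ∀ x y s t, f x ++ s = f y ++ t → x = y ∧ s = t) {k l : List A} {s t : List Sym}
    (e : encodeList f k ++ s = encodeList f l ++ t) : k = l ∧ s = t := by
  induction k generalizing l with
  | nil => cases l with
    | nil => simpa [encodeList] using e
    | cons y l => simp [encodeList] at e
  | cons x k ih => cases l with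
    | nil => simp [encodeList] at e
    | cons y l =>
      simp only [encodeList, List.cons_append, List.append_assoc, List.cons.injEq,
        true_and] at e
      obtain ⟨h1, e1⟩ := hf _ _ _ _ e
      obtain ⟨h2, e2⟩ := ih e1
      exact ⟨by rw [h1, h2], e2⟩

theorem encodeGate_prefix {n : ℕ} (x y : Gate n) (s t : List Sym)
    (e : encodeGate x ++ s = encodeGate y ++ t) : x = y ∧ s = t := by
  cases x <;> cases y <;>
    simp only [encodeGate, List.cons_append, List.append_assoc, List.cons.injEq, true_and,
      reduceCtorEq, false_and] at e
  · obtain ⟨h, e⟩ := encodeUnary_prefix e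
    exact ⟨by rw [Fin.ext h], e⟩
  · obtain ⟨h, e⟩ := encodeUnary_prefix e
    exact ⟨by rw [Fin.ext h], e⟩
  · obtain ⟨h1, e1⟩ := encodeUnary_prefix e
    obtain ⟨h2, e2⟩ := encodeUnary_prefix e1
    refine ⟨?_, e2⟩
    have h1 := Fin.ext h1
    have h2 := Fin.ext h2
    subst h1 h2
    rfl

theorem encodeTerm_prefix {n : ℕ} (x y : Term n) (s t : List Sym)
    (e : encodeTerm x ++ s = encodeTerm y ++ t) : x = y ∧ s = t := by
  cases x
  cases y
  simp only [encodeTerm, List.append_assoc] at e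
  obtain ⟨h1, e⟩ := encodeBinary_prefix e
  obtain ⟨h2, e⟩ := encodeBinary_prefix e
  obtain ⟨h3, e⟩ := encodeBinary_prefix e
  obtain ⟨h4, e⟩ := encodeBinary_prefix e
  obtain ⟨h5, e⟩ := encodeList_prefix encodeGate_prefix e
  exact ⟨by rw [h1, PNat.coe_injective h2, h3, PNat.coe_injective h4, h5], e⟩

theorem encodeInput_injective : Function.Injective encodeInput := by
  rintro ⟨n, l, r⟩ ⟨n', l', r'⟩ e
  simp only [encodeInput] at e
  obtain ⟨h, e⟩ := encodeUnary_prefix e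
  subst h
  obtain ⟨rfl, e⟩ := encodeList_prefix encodeTerm_prefix e
  have e' : encodeList encodeTerm r ++ [] = encodeList encodeTerm r' ++ [] := by simpa using e
  obtain ⟨rfl, -⟩ := encodeList_prefix encodeTerm_prefix e'
  rfl

theorem encodeGraph_injective {n : ℕ} : Function.Injective (encodeGraph (n := n)) := by
  intro G H e
  have key : ∀ (l : List (Fin n)), (l.flatMap fun i => (List.finRange n).map fun j =>
      @decide (G.Adj i j) (Classical.propDecidable _)) =
      (l.flatMap fun i => (List.finRange n).map fun j =>
      @decide (H.Adj i j) (Classical.propDecidable _)) → ∀ i ∈ l, ∀ j, G.Adj i j ↔ H.Adj i j := by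
    intro l
    induction l with
    | nil => simp
    | cons a l ih =>
      intro h
      simp only [List.flatMap_cons] at h
      obtain ⟨h1, h2⟩ := List.append_inj h (by simp)
      intro i hi j
      rcases List.mem_cons.1 hi with rfl | hi
      · have := List.map_inj_left.1 h1 j (List.mem_finRange j)
        simpa using this
      · exact ih h2 i hi j
  ext i j
  exact key _ e i (List.mem_finRange i) j

theorem encodeGraphPair_injective : Function.Injective encodeGraphPair := by
  have hlen : ∀ {n : ℕ} (G : SimpleGraph (Fin n)), (encodeGraph G).length = n * n := by
    intro n G
    simp [encodeGraph, List.length_flatMap]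
  have key : ∀ (k l : ℕ) (s t : List Bool), List.replicate k true ++ false :: s =
      List.replicate l true ++ false :: t → k = l ∧ s = t := by
    intro k
    induction k with
    | zero => intro l s t e; cases l <;> simp_all [List.replicate_succ]
    | succ k ih => intro l s t e; cases l with
      | zero => simp [List.replicate_succ] at e
      | succ l =>
        have := ih l s t (by simpa [List.replicate_succ] using e)
        exact ⟨by omega, this.2⟩
  rintro ⟨n, G, H⟩ ⟨n', G', H'⟩ e
  obtain ⟨h, e⟩ := key _ _ _ _ e
  subst h
  obtain ⟨h1, h2⟩ := List.append_inj e (by rw [hlen, hlen])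
  have h1 : G = G' := encodeGraph_injective h1
  have h2 : H = H' := encodeGraph_injective h2
  exact congrArg₂ (GraphPair.mk n) h1 h2

end CliffordIso

end

noncomputable section

namespace CliffordIso

/-! ### Inner products and norms -/

theorem star_dotProduct_self {n : ℕ} (ψ : Ket n) : star ψ ⬝ᵥ ψ = (normSq ψ : ℂ) := by
  simp only [dotProduct, normSq, Pi.star_apply, Complex.ofReal_sum, Complex.ofReal_pow]
  exact Finset.sum_congr rfl fun x _ => Complex.conj_mul' (ψ x)

theorem norm_star_dotProduct_le {n : ℕ} (φ ψ : Ket n) :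
    ‖star φ ⬝ᵥ ψ‖ ≤ √(normSq φ) * √(normSq ψ) := by
  have h := norm_inner_le_norm (𝕜 := ℂ) (WithLp.toLp 2 φ) (WithLp.toLp 2 ψ)
  rwa [EuclideanSpace.inner_eq_star_dotProduct, EuclideanSpace.norm_eq, EuclideanSpace.norm_eq,
    dotProduct_comm] at h

theorem normSq_smul {n : ℕ} (c : ℂ) (ψ : Ket n) : normSq (c • ψ) = ‖c‖ ^ 2 * normSq ψ := by
  simp [normSq, mul_pow, Finset.mul_sum]

theorem normSq_add {n : ℕ} (φ ψ : Ket n) :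
    normSq (φ + ψ) = normSq φ + normSq ψ + 2 * (star φ ⬝ᵥ ψ).re := by
  simp only [normSq, dotProduct, Complex.re_sum, Finset.mul_sum, ← Finset.sum_add_distrib]
  refine Finset.sum_congr rfl fun x _ => ?_
  simp only [Pi.add_apply, Pi.star_apply, ← Complex.normSq_eq_norm_sq, Complex.normSq_add,
    RCLike.star_def, Complex.mul_re, Complex.conj_re, Complex.conj_im]
  ring

theorem normSq_mulVec {n : ℕ} {C : Op n} (hC : C ∈ Matrix.unitaryGroup (Bits n) ℂ) (ψ : Ket n) :
    normSq (C *ᵥ ψ) = normSq ψ := by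
  have h : star (C *ᵥ ψ) ⬝ᵥ (C *ᵥ ψ) = star ψ ⬝ᵥ ψ := by
    rw [Matrix.star_mulVec, Matrix.dotProduct_mulVec, Matrix.vecMul_vecMul,
      ← Matrix.star_eq_conjTranspose, Matrix.mem_unitaryGroup_iff'.1 hC, Matrix.vecMul_one]
  rw [star_dotProduct_self, star_dotProduct_self] at h
  exact_mod_cast h

theorem norm_braket_le {n : ℕ} {C : Op n} (hC : C ∈ Matrix.unitaryGroup (Bits n) ℂ)
    (φ ψ : Ket n) : ‖braket φ C ψ‖ ≤ √(normSq φ) * √(normSq ψ) := by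
  have := norm_star_dotProduct_le φ (C *ᵥ ψ)
  rwa [normSq_mulVec hC] at this

theorem norm_braket_le_one {n : ℕ} {C : Op n} (hC : C ∈ Matrix.unitaryGroup (Bits n) ℂ)
    {φ ψ : Ket n} (hφ : IsState φ) (hψ : IsState ψ) : ‖braket φ C ψ‖ ≤ 1 := by
  have := norm_braket_le hC φ ψ
  rwa [hφ, hψ, Real.sqrt_one, one_mul] at this

theorem braket_add_right {n : ℕ} (φ : Ket n) (C : Op n) (ψ χ : Ket n) :
    braket φ C (ψ + χ) = braket φ C ψ + braket φ C χ := by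
  simp [braket, Matrix.mulVec_add]

theorem braket_add_left {n : ℕ} (φ : Ket n) (C : Op n) (ψ χ : Ket n) :
    braket (φ + χ) C ψ = braket φ C ψ + braket χ C ψ := by
  simp [braket, add_dotProduct]

theorem braket_smul_right {n : ℕ} (φ : Ket n) (C : Op n) (ψ : Ket n) (a : ℂ) :
    braket φ C (a • ψ) = a * braket φ C ψ := by
  simp [braket, Matrix.mulVec_smul]

theorem braket_smul_left {n : ℕ} (φ : Ket n) (C : Op n) (ψ : Ket n) (a : ℂ) :
    braket (a • φ) C ψ = star a * braket φ C ψ := by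
  simp [braket, star_smul]

theorem braket_smul_op {n : ℕ} (φ : Ket n) (C : Op n) (ψ : Ket n) (a : ℂ) :
    braket φ (a • C) ψ = a * braket φ C ψ := by
  simp [braket, Matrix.smul_mulVec]

/-! ### Basis labels as sets of qubits -/

/-- The set of qubits on which a basis label is `1`. -/
def supp {n : ℕ} (x : Bits n) : Finset (Fin n) := Finset.univ.filter fun k => x k = 1

@[simp] theorem mem_supp {n : ℕ} {x : Bits n} {k : Fin n} : k ∈ supp x ↔ x k = 1 := by simp [supp]

/-- The basis label that is `1` exactly on `s`. -/
def ind {n : ℕ} (s : Finset (Fin n)) : Bits n := fun k => if k ∈ s then 1 else 0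

@[simp] theorem supp_ind {n : ℕ} (s : Finset (Fin n)) : supp (ind s) = s := by
  ext k; by_cases h : k ∈ s <;> simp [ind, h]

theorem fin_two_ne_one {a : Fin 2} : a ≠ 1 ↔ a = 0 := by omega

@[simp] theorem ind_supp {n : ℕ} (x : Bits n) : ind (supp x) = x := by
  funext k
  by_cases h : x k = 1
  · simp [ind, h]
  · simp [ind, fin_two_ne_one.1 h]

/-- Basis labels correspond to sets of qubits. -/
def suppEquiv (n : ℕ) : Bits n ≃ Finset (Fin n) where
  toFun := supp
  invFun := ind
  left_inv := ind_supp
  right_inv := supp_ind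

theorem sum_bits {n : ℕ} {β : Type*} [AddCommMonoid β] (f : Finset (Fin n) → β) :
    ∑ x : Bits n, f (supp x) = ∑ s : Finset (Fin n), f s :=
  (suppEquiv n).sum_comp f

theorem sum_bits_card {n : ℕ} {β : Type*} [AddCommMonoid β] (f : ℕ → β) :
    ∑ x : Bits n, f (supp x).card = ∑ m ∈ Finset.range (n + 1), n.choose m • f m := by
  rw [sum_bits fun s => f s.card, ← Finset.powerset_univ, Finset.sum_powerset_apply_card]
  simp

theorem sum_bits_card_of_mem {n : ℕ} {β : Type*} [AddCommMonoid β] (f : ℕ → β) (i : Fin n) :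
    ∑ x : Bits n with x i = 1, f (supp x).card =
      ∑ m ∈ Finset.range n, (n - 1).choose m • f (m + 1) := by
  have hn : n - 1 + 1 = n := Nat.succ_pred_eq_of_pos (Fin.pos i)
  have h := Finset.sum_powerset_apply_card (fun m => f (m + 1)) (x := Finset.univ.erase i)
  rw [Finset.card_erase_of_mem (Finset.mem_univ i), Finset.card_univ, Fintype.card_fin, hn] at h
  rw [← h]
  refine Finset.sum_bij' (fun x _ => (supp x).erase i) (fun s _ => ind (insert i s)) ?_ ?_ ?_ ?_ ?_
  · intro x _
    simp only [Finset.mem_powerset]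
    exact Finset.erase_subset_erase _ (Finset.subset_univ _)
  · intro s _
    simp [ind]
  · intro x hx
    rw [Finset.insert_erase, ind_supp]
    simpa using hx
  · intro s hs
    rw [supp_ind, Finset.erase_insert]
    intro hi
    simpa using Finset.mem_powerset.1 hs hi
  · intro x hx
    rw [Finset.card_erase_add_one]
    simpa using hx

/-! ### Amplitudes of the state `|M⟩` -/

/-- The phase `e^{iπ/8}`. -/
def omega : ℂ := Complex.exp (Complex.I * Real.pi / 8)

theorem norm_omega : ‖omega‖ = 1 := by
  have : omega = Complex.exp ((Real.pi / 8 : ℝ) * Complex.I) := by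
    rw [omega]; congr 1; push_cast; ring
  rw [this, Complex.norm_exp_ofReal_mul_I]

theorem sqrt_two_sq : ((√2 : ℝ) : ℂ) ^ 2 = 2 := by
  rw [← Complex.ofReal_pow, Real.sq_sqrt (by norm_num)]; norm_num

theorem ketR_apply (b : Fin 2) : ketR b = omega ^ (b : ℕ) / (√2 : ℝ) := by
  fin_cases b <;> simp [ketR, omega]

theorem pairKet_apply {n : ℕ} {i j : Fin n} (hij : i ≠ j) (x : Bits n) :
    pairKet i j x = if supp x ⊆ {i, j} then omega ^ (supp x).card / 2 else 0 := by
  have e : pairKet i j x = ∏ k, if k = i ∨ k = j then ketR (x k) else ket0 (x k) := by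
    rw [pairKet, productKet]
    refine Finset.prod_congr rfl fun k _ => ?_
    split_ifs <;> rfl
  split_ifs with h
  · have h2 : ∀ k, k ∉ ({i, j} : Finset (Fin n)) → x k = 0 := fun k hk =>
      fin_two_ne_one.1 fun h1 => hk (h (mem_supp.2 h1))
    have hc : (supp x).card = ∑ k ∈ ({i, j} : Finset (Fin n)), (x k : ℕ) := by
      rw [Finset.card_eq_sum_ones, ← Finset.sum_subset h (f := fun k => (x k : ℕ))]
      · exact Finset.sum_congr rfl fun k hk => by simp [mem_supp.1 hk]
      · intro k _ hk
        simp [fin_two_ne_one.1 (mt mem_supp.2 hk)]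
    rw [e, hc, Finset.sum_pair hij, ← Finset.prod_subset (Finset.subset_univ {i, j})]
    · rw [Finset.prod_pair hij, if_pos (Or.inl rfl), if_pos (Or.inr rfl), ketR_apply, ketR_apply,
        pow_add, ← sqrt_two_sq]
      ring
    · intro k _ hk
      have := h2 k hk
      simp only [Finset.mem_insert, Finset.mem_singleton] at hk
      simp [if_neg hk, this, ket0]
  · obtain ⟨k, hk, hk'⟩ := Finset.not_subset.1 h
    rw [e]
    refine Finset.prod_eq_zero (Finset.mem_univ k) ?_
    simp only [Finset.mem_insert, Finset.mem_singleton] at hk'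
    rw [if_neg hk', mem_supp.1 hk]
    simp [ket0]

/-- The number of pairs of qubits that contain a given set of size `w`. -/
def pairCount (n w : ℕ) : ℝ :=
  if w = 0 then n * (n - 1) / 2 else if w = 1 then n - 1 else if w = 2 then 1 else 0

theorem card_pairs_superset {n : ℕ} (s : Finset (Fin n)) :
    (((Finset.univ.filter fun p : Fin n × Fin n => p.1 < p.2).filter
      fun p => s ⊆ {p.1, p.2}).card : ℝ) = pairCount n s.card := by
  have key : (((Finset.univ : Finset (Fin n)).offDiag.filter fun p => s ⊆ {p.1, p.2}).card : ℝ) =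
      2 * pairCount n s.card := by
    obtain h0 | h1 | h2 | h3 : s.card = 0 ∨ s.card = 1 ∨ s.card = 2 ∨ 3 ≤ s.card := by omega
    · rw [Finset.card_eq_zero.1 h0]
      simp only [Finset.empty_subset, Finset.filter_true, Finset.offDiag_card, pairCount,
        Finset.card_empty, if_true, Finset.card_univ, Fintype.card_fin]
      rw [Nat.cast_sub (Nat.le_mul_self n)]
      push_cast; ring
    · obtain ⟨a, rfl⟩ := Finset.card_eq_one.1 h1
      have : ((Finset.univ : Finset (Fin n)).offDiag.filter fun p => {a} ⊆ ({p.1, p.2} : Finset _))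
          = (Finset.univ.erase a).image (fun j => (a, j)) ∪
            (Finset.univ.erase a).image (fun j => (j, a)) := by
        ext ⟨p, q⟩
        simp only [Finset.mem_filter, Finset.mem_offDiag, Finset.mem_univ, true_and,
          Finset.singleton_subset_iff, Finset.mem_insert, Finset.mem_singleton, Finset.mem_union,
          Finset.mem_image, Finset.mem_erase, and_true, Prod.mk.injEq]
        constructor
        · rintro ⟨h, rfl | rfl⟩
          · exact Or.inl ⟨q, Ne.symm h, rfl, rfl⟩
          · exact Or.inr ⟨p, h, rfl, rfl⟩
        · rintro (⟨j, hj, rfl, rfl⟩ | ⟨j, hj, rfl, rfl⟩)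
          · exact ⟨Ne.symm hj, Or.inl rfl⟩
          · exact ⟨hj, Or.inr rfl⟩
      rw [this, Finset.card_union_of_disjoint, Finset.card_image_of_injective,
        Finset.card_image_of_injective, Finset.card_erase_of_mem (Finset.mem_univ a)]
      · simp only [Finset.card_univ, Fintype.card_fin, pairCount, h1]
        push_cast [Nat.cast_sub (Fin.pos a)]
        ring
      · exact fun _ _ h => (Prod.mk.inj h).1
      · exact fun _ _ h => (Prod.mk.inj h).2
      · rw [Finset.disjoint_left]
        simp only [Finset.mem_image, Finset.mem_erase]
        grind
    · obtain ⟨a, b, hab, rfl⟩ := Finset.card_eq_two.1 h2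
      have : ((Finset.univ : Finset (Fin n)).offDiag.filter
          fun p => {a, b} ⊆ ({p.1, p.2} : Finset _)) = {(a, b), (b, a)} := by
        ext ⟨p, q⟩
        simp only [Finset.mem_filter, Finset.mem_offDiag, Finset.mem_univ, true_and,
          Finset.insert_subset_iff, Finset.singleton_subset_iff, Finset.mem_insert,
          Finset.mem_singleton, Prod.mk.injEq]
        grind
      rw [this, Finset.card_pair (by simp [hab]), h2]
      norm_num [pairCount]
    · have : ((Finset.univ : Finset (Fin n)).offDiag.filter fun p => s ⊆ {p.1, p.2}) = ∅ := by
        refine Finset.filter_eq_empty_iff.2 fun p _ h => ?_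
        have := (Finset.card_le_card h).trans Finset.card_le_two
        omega
      rw [this, pairCount, if_neg (by omega), if_neg (by omega), if_neg (by omega)]
      simp
  have hsplit : (Finset.univ : Finset (Fin n)).offDiag.filter (fun p => s ⊆ {p.1, p.2}) =
      ((Finset.univ.filter fun p : Fin n × Fin n => p.1 < p.2).filter
        fun p => s ⊆ {p.1, p.2}) ∪
      ((Finset.univ.filter fun p : Fin n × Fin n => p.1 < p.2).filter
        fun p => s ⊆ {p.1, p.2}).map (Equiv.prodComm _ _).toEmbedding := by
    ext ⟨p, q⟩
    simp only [Finset.mem_filter, Finset.mem_offDiag, Finset.mem_univ, true_and, Finset.mem_union,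
      Finset.mem_map_equiv, Equiv.prodComm_symm, Equiv.prodComm_apply, Prod.swap,
      Finset.pair_comm q p, ← or_and_right, ← ne_iff_lt_or_gt]
  rw [hsplit, Finset.card_union_of_disjoint, Finset.card_map] at key
  · push_cast at key
    linarith
  · rw [Finset.disjoint_left]
    simp only [Finset.mem_filter, Finset.mem_map_equiv, Equiv.prodComm_symm, Equiv.prodComm_apply,
      Prod.swap]
    rintro p ⟨⟨-, h⟩, -⟩ ⟨⟨-, h'⟩, -⟩
    exact lt_asymm h h'

/-- The unnormalized vector `∑_{i < j} |R_i R_j 0 ⋯ 0⟩`. -/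
def pairSum (n : ℕ) : Ket n :=
  ∑ p ∈ Finset.univ.filter (fun p : Fin n × Fin n => p.1 < p.2), pairKet p.1 p.2

theorem pairSum_apply {n : ℕ} (x : Bits n) :
    pairSum n x = (pairCount n (supp x).card / 2 : ℝ) * omega ^ (supp x).card := by
  rw [pairSum, Finset.sum_apply, Finset.sum_congr rfl fun p hp =>
    pairKet_apply (ne_of_lt (Finset.mem_filter.1 hp).2) x, ← Finset.sum_filter,
    Finset.sum_const, nsmul_eq_mul]
  have := card_pairs_superset (supp x)
  rw [← Complex.ofReal_inj] at this
  rw [Complex.ofReal_natCast] at this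
  rw [this]
  push_cast; ring

theorem sum_range_choose_of_le_two {n : ℕ} (hn : 2 ≤ n) {f : ℕ → ℝ} (hf : ∀ m, 3 ≤ m → f m = 0) :
    ∑ m ∈ Finset.range (n + 1), n.choose m • f m = f 0 + n * f 1 + n * (n - 1) / 2 * f 2 := by
  rw [← Finset.sum_subset (s₁ := Finset.range 3)
    (fun m hm => Finset.mem_range.2 (by have := Finset.mem_range.1 hm; omega))
    fun m _ hm => by rw [hf m (by simpa using hm), smul_zero]]
  simp [Finset.sum_range_succ, Nat.cast_choose_two]

/-- The amplitude of `|M⟩` at labels of weight `w`, relative to the one at `0ⁿ` and up to a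
phase. -/
def relAmp (n w : ℕ) : ℝ :=
  if w = 0 then 1 else if w = 1 then 2 / n else if w = 2 then 2 / (n * (n - 1)) else 0

theorem relAmp_of_three_le {n w : ℕ} (hw : 3 ≤ w) : relAmp n w = 0 := by
  rw [relAmp, if_neg (by omega), if_neg (by omega), if_neg (by omega)]

theorem pairCount_eq {n : ℕ} (hn : 2 ≤ n) (w : ℕ) :
    pairCount n w = n * (n - 1) / 2 * relAmp n w := by
  have h1 : (n : ℝ) ≠ 0 := by positivity
  have h2 : (n : ℝ) - 1 ≠ 0 := by
    have : (2 : ℝ) ≤ n := by exact_mod_cast hn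
    linarith
  rw [pairCount, relAmp]
  split_ifs <;> field_simp
  simp

theorem pairSum_apply' {n : ℕ} (hn : 2 ≤ n) (x : Bits n) : pairSum n x =
    (n * (n - 1) / 4 : ℝ) * ((relAmp n (supp x).card : ℝ) * omega ^ (supp x).card) := by
  rw [pairSum_apply, pairCount_eq hn]
  push_cast; ring

/-- The sum of the squares of the relative amplitudes of `|M⟩`. -/
def relNormSq (n : ℕ) : ℝ := 1 + 4 / n + 2 / (n * (n - 1))

theorem sub_one_pos_of_two_le {n : ℕ} (hn : 2 ≤ n) : (0 : ℝ) < n - 1 := by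
  have : (2 : ℝ) ≤ n := by exact_mod_cast hn
  linarith

theorem one_le_relNormSq {n : ℕ} (hn : 2 ≤ n) : 1 ≤ relNormSq n := by
  have h2 := sub_one_pos_of_two_le hn
  rw [relNormSq]
  have : (0 : ℝ) ≤ 4 / n := by positivity
  have : (0 : ℝ) ≤ 2 / (n * (n - 1)) := by positivity
  linarith

theorem sum_relAmp_sq {n : ℕ} (hn : 2 ≤ n) :
    ∑ x : Bits n, relAmp n (supp x).card ^ 2 = relNormSq n := by
  have h1 : (n : ℝ) ≠ 0 := by positivity
  have h2 := (sub_one_pos_of_two_le hn).ne'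
  rw [sum_bits_card fun w => relAmp n w ^ 2, sum_range_choose_of_le_two hn fun m hm => by
    rw [relAmp_of_three_le hm]; norm_num]
  simp only [relAmp, relNormSq]
  norm_num
  field_simp
  ring

theorem sum_relAmp {n : ℕ} (hn : 2 ≤ n) :
    ∑ x : Bits n, relAmp n (supp x).card = 4 := by
  have h1 : (n : ℝ) ≠ 0 := by positivity
  have h2 := (sub_one_pos_of_two_le hn).ne'
  rw [sum_bits_card fun w => relAmp n w, sum_range_choose_of_le_two hn fun m hm =>
    relAmp_of_three_le hm]
  simp only [relAmp]
  norm_num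
  field_simp
  ring

theorem sum_relAmp_sq_of_mem {n : ℕ} (hn : 2 ≤ n) (i : Fin n) :
    ∑ x : Bits n with x i = 1, relAmp n (supp x).card ^ 2 = 4 / (n * (n - 1)) := by
  have h1 : (n : ℝ) ≠ 0 := by positivity
  have h2 := (sub_one_pos_of_two_le hn).ne'
  rw [sum_bits_card_of_mem (fun w => relAmp n w ^ 2), ← Finset.sum_subset (s₁ := Finset.range 2)
    (fun m hm => Finset.mem_range.2 (by have := Finset.mem_range.1 hm; omega))
    fun m _ hm => by
      rw [relAmp_of_three_le (by simp at hm; omega), zero_pow two_ne_zero, smul_zero]]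
  simp only [Finset.sum_range_succ, Finset.sum_range_zero, relAmp, nsmul_eq_mul,
    Nat.choose_zero_right, Nat.choose_one_right, Nat.cast_sub (show 1 ≤ n by omega)]
  norm_num
  field_simp
  ring

theorem relAmp_nonneg {n : ℕ} (hn : 2 ≤ n) (w : ℕ) : 0 ≤ relAmp n w := by
  have h2 := sub_one_pos_of_two_le hn
  rw [relAmp]
  split_ifs <;> positivity

theorem normSq_pairSum {n : ℕ} (hn : 2 ≤ n) : normSq (pairSum n) =
    (n * (n - 1) / 4) ^ 2 * relNormSq n := by
  rw [normSq, ← sum_relAmp_sq hn, Finset.mul_sum]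
  refine Finset.sum_congr rfl fun x _ => ?_
  rw [pairSum_apply' hn, norm_mul, norm_mul, norm_pow, norm_omega, one_pow, mul_one,
    Complex.norm_real, Complex.norm_real, Real.norm_eq_abs, Real.norm_eq_abs, mul_pow, sq_abs,
    sq_abs]

/-- The amplitude of `|M⟩` at `0ⁿ`. -/
def mu (n : ℕ) : ℝ := 1 / √(relNormSq n)

theorem mu_pos {n : ℕ} (hn : 2 ≤ n) : 0 < mu n :=
  one_div_pos.2 (Real.sqrt_pos.2 (by linarith [one_le_relNormSq hn]))

theorem mu_sq_mul {n : ℕ} (hn : 2 ≤ n) : mu n ^ 2 * relNormSq n = 1 := by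
  have := one_le_relNormSq hn
  rw [mu, div_pow, Real.sq_sqrt (by linarith)]
  field_simp

theorem mu_le_one {n : ℕ} (hn : 2 ≤ n) : mu n ≤ 1 := by
  have := one_le_relNormSq hn
  have := mu_sq_mul hn
  have := mu_pos hn
  nlinarith

theorem sqrt_normSq_pairSum {n : ℕ} (hn : 2 ≤ n) :
    √(normSq (pairSum n)) = n * (n - 1) / 4 * √(relNormSq n) := by
  have h2 := sub_one_pos_of_two_le hn
  rw [normSq_pairSum hn, Real.sqrt_mul (by positivity), Real.sqrt_sq (by positivity)]

theorem ketM_eq {n : ℕ} : ketM n = ((1 / √(normSq (pairSum n)) : ℝ) : ℂ) • pairSum n := rfl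

theorem ketM_apply {n : ℕ} (hn : 2 ≤ n) (x : Bits n) :
    ketM n x = (mu n * relAmp n (supp x).card : ℝ) * omega ^ (supp x).card := by
  have h1 : (n : ℂ) ≠ 0 := by exact_mod_cast (show n ≠ 0 by omega)
  have h2 : (n : ℂ) - 1 ≠ 0 := by exact_mod_cast (sub_one_pos_of_two_le hn).ne'
  rw [ketM_eq, Pi.smul_apply, smul_eq_mul, pairSum_apply' hn, sqrt_normSq_pairSum hn, mu]
  push_cast
  field_simp

theorem norm_ketM_apply {n : ℕ} (hn : 2 ≤ n) (x : Bits n) :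
    ‖ketM n x‖ = mu n * relAmp n (supp x).card := by
  rw [ketM_apply hn, norm_mul, norm_pow, norm_omega, one_pow, mul_one, Complex.norm_real,
    Real.norm_eq_abs, abs_of_nonneg (mul_nonneg (mu_pos hn).le (relAmp_nonneg hn _))]

theorem isState_ketM {n : ℕ} (hn : 2 ≤ n) : IsState (ketM n) := by
  rw [IsState, normSq, Finset.sum_congr rfl fun x _ => by rw [norm_ketM_apply hn, mul_pow],
    ← Finset.mul_sum, sum_relAmp_sq hn, mu_sq_mul hn]

theorem sum_norm_ketM_le {n : ℕ} (hn : 2 ≤ n) : ∑ x, ‖ketM n x‖ ≤ 4 := by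
  rw [Finset.sum_congr rfl fun x _ => norm_ketM_apply hn x, ← Finset.mul_sum, sum_relAmp hn]
  linarith [mu_le_one hn]

theorem sum_norm_sq_ketM_of_mem {n : ℕ} (hn : 2 ≤ n) (i : Fin n) :
    ∑ x : Bits n with x i = 1, ‖ketM n x‖ ^ 2 = 4 * mu n ^ 2 / (n * (n - 1)) := by
  rw [Finset.sum_congr rfl fun x _ => by rw [norm_ketM_apply hn, mul_pow], ← Finset.mul_sum,
    sum_relAmp_sq_of_mem hn]
  ring

theorem ketM_comp_perm {n : ℕ} (hn : 2 ≤ n) (x : Bits n) (σ : Equiv.Perm (Fin n)) :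
    ketM n (x ∘ σ) = ketM n x := by
  have : (supp (x ∘ σ)).card = (supp x).card := by
    refine Finset.card_bij (fun k _ => σ k) ?_ ?_ ?_
    · intro k hk; simpa using hk
    · intro k _ l _ h; exact σ.injective h
    · intro k hk; exact ⟨σ.symm k, by simpa using hk, by simp⟩
  rw [ketM_apply hn, ketM_apply hn, this]

/-! ### Entries of Pauli operators -/

/-- The bit flipBit that is part of `I, X, Y, Z`. -/
def xbit : Fin 4 → Fin 2 := ![0, 1, 1, 0]

theorem singlePauli_ne_zero (p : Fin 4) (a b : Fin 2) : singlePauli p a b ≠ 0 ↔ a = b + xbit p := by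
  fin_cases p <;> fin_cases a <;> fin_cases b <;> simp [singlePauli, xbit]

theorem singlePauli_pow_four (p : Fin 4) (b : Fin 2) : singlePauli p (b + xbit p) b ^ 4 = 1 := by
  fin_cases p <;> fin_cases b <;> simp [singlePauli, xbit]
  all_goals norm_num

theorem pauliString_apply {n : ℕ} (Q : Fin n → Fin 4) (x y : Bits n) :
    pauliString Q x y = ∏ k, singlePauli (Q k) (x k) (y k) := rfl

theorem pauliString_ne_zero {n : ℕ} (Q : Fin n → Fin 4) (x y : Bits n) :
    pauliString Q x y ≠ 0 ↔ ∀ k, x k = y k + xbit (Q k) := by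
  simp only [pauliString_apply, Finset.prod_ne_zero_iff, Finset.mem_univ, true_imp_iff,
    singlePauli_ne_zero]

theorem pow_four_eq_one {ω : ℂ} :
    ω ^ 4 = 1 ↔ ω = 1 ∨ ω = -1 ∨ ω = Complex.I ∨ ω = -Complex.I := by
  constructor
  · intro h
    have : (ω - 1) * ((ω + 1) * ((ω - Complex.I) * (ω + Complex.I))) = 0 := by
      linear_combination h + (1 - ω ^ 2) * Complex.I_sq
    simp only [mul_eq_zero, sub_eq_zero, add_eq_zero_iff_eq_neg] at this
    exact this
  · rintro (rfl | rfl | rfl | rfl)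
    · simp
    · norm_num
    · exact Complex.I_pow_four
    · rw [neg_pow, Complex.I_pow_four]; norm_num

theorem mem_pauliGroup {n : ℕ} {A : Op n} :
    A ∈ pauliGroup n ↔ ∃ ω : ℂ, ω ^ 4 = 1 ∧ ∃ P : Fin n → Fin 4, A = ω • pauliString P := by
  simp only [pauliGroup, Set.mem_ofPred_eq, pow_four_eq_one]

/-- The operator that acts as `Z` on the qubit `i`. -/
def zOp {n : ℕ} (i : Fin n) : Op n := pauliString fun k => if k = i then 3 else 0

/-- The operator that acts as `X` on the qubit `i`. -/
def xOp {n : ℕ} (i : Fin n) : Op n := pauliString fun k => if k = i then 1 else 0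

theorem pauliString_mem {n : ℕ} (Q : Fin n → Fin 4) : pauliString Q ∈ pauliGroup n :=
  mem_pauliGroup.2 ⟨1, one_pow _, Q, (one_smul _ _).symm⟩

theorem zOp_mem {n : ℕ} (i : Fin n) : zOp i ∈ pauliGroup n := pauliString_mem _

theorem xOp_mem {n : ℕ} (i : Fin n) : xOp i ∈ pauliGroup n := pauliString_mem _

theorem pauliString_diag {n : ℕ} {Q : Fin n → Fin 4} (hQ : ∀ k, xbit (Q k) = 0) (x y : Bits n) :
    pauliString Q x y =
      if x = y then ∏ k, (if Q k = 3 then (-1 : ℂ) ^ (x k : ℕ) else 1) else 0 := by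
  split_ifs with h
  · subst h
    rw [pauliString_apply]
    refine Finset.prod_congr rfl fun k _ => ?_
    have := hQ k
    generalize Q k = p at *
    generalize x k = b
    fin_cases p <;> fin_cases b <;> simp_all [singlePauli, xbit]
  · by_contra h'
    refine h (funext fun k => ?_)
    rw [(pauliString_ne_zero Q x y).1 h' k, hQ k, add_zero]

theorem zOp_apply {n : ℕ} (i : Fin n) (x y : Bits n) :
    zOp i x y = if x = y then (-1 : ℂ) ^ (x i : ℕ) else 0 := by
  rw [zOp, pauliString_diag fun k => by split_ifs <;> rfl]
  congr 1
  rw [Finset.prod_eq_single i]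
  · simp
  · intro k _ hk; simp [hk]
  · simp

theorem zOp_mul_apply {n : ℕ} (i : Fin n) (A : Op n) (x y : Bits n) :
    (zOp i * A) x y = (-1) ^ (x i : ℕ) * A x y := by
  simp [Matrix.mul_apply, zOp_apply]

theorem mul_zOp_apply {n : ℕ} (i : Fin n) (A : Op n) (x y : Bits n) :
    (A * zOp i) x y = A x y * (-1) ^ (y i : ℕ) := by
  simp [Matrix.mul_apply, zOp_apply]

theorem zOp_mulVec_apply {n : ℕ} (i : Fin n) (ψ : Ket n) (x : Bits n) :
    (zOp i *ᵥ ψ) x = (-1) ^ (x i : ℕ) * ψ x := by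
  simp [Matrix.mulVec, dotProduct, zOp_apply]

/-- Flipping the bit `j`. -/
def flipBit {n : ℕ} (j : Fin n) (y : Bits n) : Bits n := Function.update y j (y j + 1)

theorem xOp_apply {n : ℕ} (j : Fin n) (x y : Bits n) :
    xOp j x y = if x = flipBit j y then 1 else 0 := by
  have h0 : ∀ k, (x k = y k + xbit (if k = j then 1 else 0)) ↔ x k = flipBit j y k := by
    intro k
    by_cases h : k = j
    · subst h; simp [xbit, flipBit]
    · simp [xbit, flipBit, h]
  split_ifs with h
  · rw [xOp, pauliString_apply]
    refine Finset.prod_eq_one fun k _ => ?_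
    have hk := (h0 k).2 (congrFun h k)
    rw [hk]
    by_cases h : k = j
    · simp only [h, if_true]
      generalize y j = b
      fin_cases b <;> simp [singlePauli, xbit]
    · simp only [h, if_false]
      generalize y k = b
      fin_cases b <;> simp [singlePauli, xbit]
  · by_contra h'
    exact h (funext fun k => (h0 k).1 ((pauliString_ne_zero _ _ _).1 h' k))

theorem mul_xOp_apply {n : ℕ} (j : Fin n) (A : Op n) (x y : Bits n) :
    (A * xOp j) x y = A x (flipBit j y) := by
  simp [Matrix.mul_apply, xOp_apply]

theorem normSq_zOp_mulVec {n : ℕ} (i : Fin n) (ψ : Ket n) : normSq (zOp i *ᵥ ψ) = normSq ψ := by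
  simp [normSq, zOp_mulVec_apply]

theorem exists_mul_eq_of_mem_cliffordGroup {n : ℕ} {C P : Op n} (hC : C ∈ cliffordGroup n)
    (hP : P ∈ pauliGroup n) : ∃ Q ∈ pauliGroup n, P * C = C * Q := by
  rw [← hC.2] at hP
  obtain ⟨Q, hQ, rfl⟩ := hP
  refine ⟨Q, hQ, ?_⟩
  have := Matrix.mem_unitaryGroup_iff'.1 hC.1
  rw [Matrix.star_eq_conjTranspose] at this
  simp only [mul_assoc, this, mul_one]

theorem exists_eq_mul_of_mem_cliffordGroup {n : ℕ} {C P : Op n} (hC : C ∈ cliffordGroup n)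
    (hP : P ∈ pauliGroup n) : ∃ Q ∈ pauliGroup n, C * P = Q * C := by
  refine ⟨C * P * Cᴴ, ?_, ?_⟩
  · rw [← hC.2]; exact ⟨P, hP, rfl⟩
  · have := Matrix.mem_unitaryGroup_iff'.1 hC.1
    rw [Matrix.star_eq_conjTranspose] at this
    simp only [mul_assoc, this, mul_one]

/-! ### Pauli expectations of states close to `|M⟩` -/

theorem sum_norm_sq_le {n : ℕ} (s : Finset (Bits n)) (φ ψ : Ket n) :
    ∑ x ∈ s, ‖φ x‖ ^ 2 ≤ 11 / 10 * ∑ x ∈ s, ‖ψ x‖ ^ 2 + 11 * normSq (φ - ψ) := by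
  have h1 : 11 * ∑ x ∈ s, ‖(φ - ψ) x‖ ^ 2 ≤ 11 * normSq (φ - ψ) :=
    mul_le_mul_of_nonneg_left (Finset.sum_le_sum_of_subset_of_nonneg (Finset.subset_univ s)
      fun _ _ _ => by positivity) (by norm_num)
  refine le_trans ?_ (add_le_add_right h1 _)
  rw [Finset.mul_sum, Finset.mul_sum, ← Finset.sum_add_distrib]
  refine Finset.sum_le_sum fun x _ => ?_
  have h2 : ‖φ x‖ ≤ ‖ψ x‖ + ‖(φ - ψ) x‖ := by
    have := norm_add_le (ψ x) ((φ - ψ) x)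
    rwa [Pi.sub_apply, add_sub_cancel] at this
  have h3 := norm_nonneg (φ x)
  nlinarith [sq_nonneg (‖ψ x‖ - 10 * ‖(φ - ψ) x‖)]

theorem normSq_sub_of_isState {n : ℕ} {φ ψ : Ket n} (hφ : IsState φ) (hψ : IsState ψ) :
    normSq (φ - ψ) = 2 - 2 * (star ψ ⬝ᵥ φ).re := by
  have h : star ((-1 : ℂ) • ψ) ⬝ᵥ φ = -(star ψ ⬝ᵥ φ) := by simp
  rw [sub_eq_add_neg, ← neg_one_smul ℂ ψ, add_comm, normSq_add, normSq_smul, h, hφ, hψ,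
    Complex.neg_re]
  norm_num
  ring

theorem braket_zOp_re {n : ℕ} (i : Fin n) (φ : Ket n) : (braket φ (zOp i) φ).re =
    normSq φ - 2 * ∑ x : Bits n with x i = 1, ‖φ x‖ ^ 2 := by
  rw [braket, dotProduct, Complex.re_sum, normSq, Finset.sum_filter, Finset.mul_sum,
    ← Finset.sum_sub_distrib]
  refine Finset.sum_congr rfl fun x _ => ?_
  have h : star (φ x) * φ x = ((‖φ x‖ ^ 2 : ℝ) : ℂ) := by
    rw [Complex.ofReal_pow]; exact Complex.conj_mul' _
  rw [zOp_mulVec_apply, Pi.star_apply, mul_left_comm, h]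
  by_cases hx : x i = 1
  · simp only [hx, if_true]
    norm_num [-Complex.ofReal_pow]
    ring
  · simp only [fin_two_ne_one.1 hx]
    simp [-Complex.ofReal_pow]

theorem mu_sq_ge {n : ℕ} (hn : 100 ≤ n) : 19 / 20 ≤ mu n ^ 2 := by
  have h1 := mu_sq_mul (show 2 ≤ n by omega)
  have hn' : (100 : ℝ) ≤ n := by exact_mod_cast hn
  have h2 : relNormSq n ≤ 20 / 19 := by
    have h3 : (4 : ℝ) / n ≤ 4 / 100 := by gcongr
    have h4 : (2 : ℝ) / (n * (n - 1)) ≤ 2 / (100 * 99) := by gcongr; linarith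
    rw [relNormSq]
    norm_num at h3 h4 ⊢
    linarith
  nlinarith [sq_nonneg (mu n)]

theorem ketM_zero {n : ℕ} (hn : 2 ≤ n) : ketM n 0 = mu n := by
  have : supp (0 : Bits n) = ∅ := by ext; simp
  simp [ketM_apply hn, this, relAmp]

theorem norm_braket_ketM_le {n : ℕ} (hn : 100 ≤ n) {P : Op n}
    (hP : ∀ ψ, normSq (P *ᵥ ψ) = normSq ψ) (h0 : P 0 0 = 0) :
    ‖braket (ketM n) P (ketM n)‖ ≤ 1 / 2 := by
  have hn2 : 2 ≤ n := by omega
  set e : Ket n := (mu n : ℂ) • Pi.single 0 1 with he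
  set w : Ket n := ketM n - e with hw
  have hM : ketM n = e + w := by rw [hw]; abel
  have he' : normSq e ≤ 1 := by
    have : normSq (Pi.single 0 1 : Ket n) = 1 := by
      rw [normSq, Finset.sum_eq_single 0] <;> simp +contextual
    rw [he, normSq_smul, this, mul_one, Complex.norm_real, Real.norm_eq_abs, sq_abs]
    have := mu_le_one hn2
    have := mu_pos hn2
    nlinarith
  have hwn : normSq w = 1 - mu n ^ 2 := by
    have h1 := isState_ketM hn2
    rw [IsState, normSq, ← Finset.add_sum_erase _ _ (Finset.mem_univ 0)] at h1
    rw [normSq, ← Finset.add_sum_erase _ _ (Finset.mem_univ 0), hw, he]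
    have h2 : ∀ x ∈ Finset.univ.erase (0 : Bits n),
        ‖(ketM n - (mu n : ℂ) • Pi.single 0 1 : Ket n) x‖ ^ 2 = ‖ketM n x‖ ^ 2 := by
      intro x hx
      simp [Finset.ne_of_mem_erase hx]
    rw [Finset.sum_congr rfl h2]
    simp only [Pi.sub_apply, Pi.smul_apply, Pi.single_eq_same, ketM_zero hn2, smul_eq_mul,
      mul_one, sub_self, norm_zero] at h1 ⊢
    rw [Complex.norm_real, Real.norm_eq_abs, sq_abs] at h1
    linarith
  have hw1 : √(normSq w) ≤ 56 / 250 := by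
    rw [hwn]
    refine Real.sqrt_le_iff.2 ⟨by norm_num, ?_⟩
    have := mu_sq_ge hn
    norm_num
    linarith
  have he1 : √(normSq e) ≤ 1 := Real.sqrt_le_one.2 he'
  have hb : ∀ φ ψ : Ket n, ‖braket φ P ψ‖ ≤ √(normSq φ) * √(normSq ψ) := by
    intro φ ψ
    have := norm_star_dotProduct_le φ (P *ᵥ ψ)
    rwa [hP] at this
  have hee : braket e P e = 0 := by
    rw [he, braket_smul_left, braket_smul_right, braket, ← Pi.single_star, single_dotProduct]
    simp [Matrix.mulVec_single, h0]
  have h1 := (hb e w).trans (mul_le_mul he1 hw1 (Real.sqrt_nonneg _) zero_le_one)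
  have h2 := (hb w e).trans (mul_le_mul hw1 he1 (Real.sqrt_nonneg _) (by norm_num))
  have h3 := (hb w w).trans (mul_le_mul hw1 hw1 (Real.sqrt_nonneg _) (by norm_num))
  have e4 : braket (ketM n) P (ketM n) = braket e P w + braket w P e + braket w P w := by
    rw [hM, braket_add_left, braket_add_right, braket_add_right, hee]; ring
  rw [e4]
  refine (norm_add₃_le).trans ?_
  linarith

/-! ### Clifford operators that almost fix `|M⟩` -/

theorem norm_ketM_zero {n : ℕ} (hn : 2 ≤ n) : ‖ketM n 0‖ = mu n := by
  rw [ketM_zero hn, Complex.norm_real, Real.norm_eq_abs, abs_of_nonneg (mu_pos hn).le]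

theorem norm_ketM_ind_singleton {n : ℕ} (hn : 2 ≤ n) (i : Fin n) :
    ‖ketM n (ind {i})‖ = mu n * (2 / n) := by
  rw [norm_ketM_apply hn, supp_ind, Finset.card_singleton]
  simp [relAmp]

theorem sum_sign_eq {n : ℕ} {ψ : Ket n} (hψ : IsState ψ) (σ : Bits n → ℝ) :
    ∑ x, σ x * ‖ψ x‖ ^ 2 = 1 - ∑ x, (1 - σ x) * ‖ψ x‖ ^ 2 := by
  have h : ∑ x, ‖ψ x‖ ^ 2 = 1 := hψ
  simp only [one_sub_mul, Finset.sum_sub_distrib, h, sub_sub_cancel]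

theorem le_sum_one_sub {n : ℕ} {ψ : Ket n} {σ : Bits n → ℝ} (hσ : ∀ x, σ x ≤ 1)
    (s : Finset (Bits n)) : ∑ x ∈ s, (1 - σ x) * ‖ψ x‖ ^ 2 ≤ ∑ x, (1 - σ x) * ‖ψ x‖ ^ 2 :=
  Finset.sum_le_sum_of_subset_of_nonneg (Finset.subset_univ _) fun x _ _ =>
    mul_nonneg (sub_nonneg.2 (hσ x)) (by positivity)

/-- The sign with which the product of the `Z` on the qubits with `Q k = 3` acts on a label. -/
def zSign {n : ℕ} (Q : Fin n → Fin 4) (x : Bits n) : ℝ :=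
  ∏ k, (if Q k = 3 then (-1 : ℝ) ^ (x k : ℕ) else 1)

theorem zSign_eq {n : ℕ} (Q : Fin n → Fin 4) (x : Bits n) : zSign Q x = 1 ∨ zSign Q x = -1 := by
  refine Finset.prod_induction _ (fun r : ℝ => r = 1 ∨ r = -1) ?_ (Or.inl rfl) ?_
  · rintro a b (rfl | rfl) (rfl | rfl) <;> norm_num
  · intro k _
    split_ifs
    · exact neg_one_pow_eq_or ℝ _
    · exact Or.inl rfl

theorem zSign_zero {n : ℕ} (Q : Fin n → Fin 4) : zSign Q 0 = 1 := by simp [zSign]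

theorem zSign_ind_singleton {n : ℕ} {Q : Fin n → Fin 4} {i : Fin n} (h : Q i = 3) :
    zSign Q (ind {i}) = -1 := by
  rw [zSign, Finset.prod_eq_single i]
  · simp [h, ind]
  · intro k _ hk; simp [ind, hk]
  · simp

theorem braket_smul_pauliString_diag {n : ℕ} {Q : Fin n → Fin 4} (hQ : ∀ k, xbit (Q k) = 0)
    (ω : ℂ) (ψ : Ket n) : braket ψ (ω • pauliString Q) ψ =
      ω * ((∑ x, zSign Q x * ‖ψ x‖ ^ 2 : ℝ) : ℂ) := by
  rw [braket_smul_op, braket, dotProduct, Complex.ofReal_sum]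
  congr 1
  refine Finset.sum_congr rfl fun x _ => ?_
  have h : star (ψ x) * ψ x = ((‖ψ x‖ ^ 2 : ℝ) : ℂ) := by
    rw [Complex.ofReal_pow]; exact Complex.conj_mul' _
  have h1 : (pauliString Q *ᵥ ψ) x = (zSign Q x : ℂ) * ψ x := by
    rw [Matrix.mulVec, dotProduct, Finset.sum_eq_single x]
    · rw [pauliString_diag hQ, if_pos rfl, zSign]
      congr 1
      push_cast
      refine Finset.prod_congr rfl fun k _ => ?_
      split_ifs <;> simp
    · intro y _ hy
      rw [pauliString_diag hQ, if_neg hy.symm, zero_mul]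
    · simp
  rw [h1, Pi.star_apply, mul_left_comm, h, Complex.ofReal_mul]

theorem exists_zOp_mul_eq {n : ℕ} (hn : 100 ≤ n) {C : Op n} (hC : C ∈ cliffordGroup n)
    (h : 1 - 1 / (n : ℝ) ^ 5 ≤ (braket (ketM n) C (ketM n)).re) (i : Fin n) :
    ∃ j, zOp i * C = C * zOp j := by
  have hn2 : 2 ≤ n := by omega
  have hn' : (100 : ℝ) ≤ n := by exact_mod_cast hn
  have hM := isState_ketM hn2
  have hmu := mu_sq_ge hn
  obtain ⟨P, hP, hZ⟩ := exists_mul_eq_of_mem_cliffordGroup hC (zOp_mem i)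
  have hPn : ∀ ψ, normSq (P *ᵥ ψ) = normSq ψ := fun ψ => by
    rw [← normSq_mulVec hC.1, Matrix.mulVec_mulVec, ← hZ, ← Matrix.mulVec_mulVec,
      normSq_zOp_mulVec, normSq_mulVec hC.1]
  have hbr : braket (ketM n) P (ketM n) = braket (C *ᵥ ketM n) (zOp i) (C *ᵥ ketM n) := by
    rw [braket, braket, Matrix.mulVec_mulVec, hZ, ← Matrix.mulVec_mulVec, Matrix.star_mulVec,
      Matrix.dotProduct_mulVec (Matrix.vecMul _ _), Matrix.vecMul_vecMul,
      ← Matrix.star_eq_conjTranspose, Matrix.mem_unitaryGroup_iff'.1 hC.1, Matrix.vecMul_one]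
  have hCM : IsState (C *ᵥ ketM n) := (normSq_mulVec hC.1 _).trans hM
  have heps : (1 : ℝ) / n ^ 5 ≤ 1 / 1000000 * (1 / n ^ 2) := by
    rw [one_div_mul_one_div]
    apply one_div_le_one_div_of_le (by positivity)
    nlinarith [pow_le_pow_left₀ (by norm_num) hn' 3, show (0 : ℝ) < n ^ 2 by positivity]
  have hq : 4 * mu n ^ 2 / (n * (n - 1)) ≤ 45 / 10 * mu n ^ 2 * (1 / n ^ 2) := by
    rw [mul_one_div, div_le_div_iff₀ (by nlinarith) (by positivity)]
    have : (0 : ℝ) < n * mu n ^ 2 := by nlinarith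
    nlinarith
  have hinv : (1 : ℝ) / n ^ 2 ≤ 1 / 100 ^ 2 := by gcongr
  have hge : 1 - 11 * mu n ^ 2 * (1 / n ^ 2) ≤ (braket (ketM n) P (ketM n)).re := by
    rw [hbr, braket_zOp_re, hCM]
    have h1 := sum_norm_sq_le (Finset.univ.filter fun x : Bits n => x i = 1) (C *ᵥ ketM n) (ketM n)
    rw [normSq_sub_of_isState hCM hM, sum_norm_sq_ketM_of_mem hn2] at h1
    rw [braket] at h
    have : (0 : ℝ) < 1 / n ^ 2 := by positivity
    nlinarith
  have hge' : 9 / 10 ≤ (braket (ketM n) P (ketM n)).re := by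
    have := mu_le_one hn2
    have := mu_pos hn2
    have : mu n ^ 2 * (1 / n ^ 2) ≤ 1 * (1 / 100 ^ 2) := by gcongr; nlinarith
    linarith
  obtain ⟨ω, hω, Q, hPQ⟩ := mem_pauliGroup.1 hP
  have hQ : ∀ k, xbit (Q k) = 0 := by
    by_contra hne
    push Not at hne
    obtain ⟨k, hk⟩ := hne
    have h0 : P 0 0 = 0 := by
      rw [hPQ, Matrix.smul_apply]
      by_contra h'
      have h'' : pauliString Q 0 0 ≠ 0 := fun h0 => h' (by rw [h0, smul_zero])
      rw [pauliString_ne_zero] at h''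
      exact hk (by simpa using (h'' k).symm)
    have := norm_braket_ketM_le hn hPn h0
    linarith [Complex.re_le_norm (braket (ketM n) P (ketM n))]
  set E : ℝ := ∑ x, zSign Q x * ‖ketM n x‖ ^ 2 with hE
  have hσ : ∀ x, zSign Q x ≤ 1 := fun x => by rcases zSign_eq Q x with h | h <;> norm_num [h]
  have hEre : (braket (ketM n) P (ketM n)).re = ω.re * E := by
    rw [hPQ, braket_smul_pauliString_diag hQ, ← hE, mul_comm, Complex.re_ofReal_mul, mul_comm]
  have hE0 : 0 < E := by
    have h1 : 2 * mu n ^ 2 - 1 ≤ E := by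
      have h2 : ∑ x, (1 + zSign Q x) * ‖ketM n x‖ ^ 2 = 1 + E := by
        have h : ∑ x, ‖ketM n x‖ ^ 2 = 1 := hM
        simp only [one_add_mul, Finset.sum_add_distrib, h, hE]
      have h3 := Finset.single_le_sum (f := fun x => (1 + zSign Q x) * ‖ketM n x‖ ^ 2)
        (fun x _ => mul_nonneg (by rcases zSign_eq Q x with h | h <;> norm_num [h])
          (by positivity)) (Finset.mem_univ 0)
      rw [h2] at h3
      simp only [zSign_zero, norm_ketM_zero hn2] at h3
      linarith
    linarith
  have hω1 : ω = 1 := by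
    rcases pow_four_eq_one.1 hω with h | h | h | h
    · exact h
    all_goals
      rw [hEre, h] at hge'
      norm_num at hge'
    linarith
  have hEle : 1 - 11 * mu n ^ 2 * (1 / n ^ 2) ≤ E := by
    rwa [hEre, hω1, Complex.one_re, one_mul] at hge
  rw [sum_sign_eq hM] at hE
  have huniq : ∀ j k, Q j = 3 → Q k = 3 → j = k := by
    intro j k hj hk
    by_contra hjk
    have h1 := le_sum_one_sub (ψ := ketM n) hσ {ind {j}, ind {k}}
    have hne : (ind {j} : Bits n) ≠ ind {k} := fun h => hjk (by
      have := congrArg supp h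
      simpa using this)
    rw [Finset.sum_pair hne, zSign_ind_singleton hj, zSign_ind_singleton hk,
      norm_ketM_ind_singleton hn2, norm_ketM_ind_singleton hn2] at h1
    have h2 : (mu n * (2 / n)) ^ 2 = 4 * mu n ^ 2 * (1 / n ^ 2) := by ring
    rw [h2] at h1
    have : 0 < mu n ^ 2 * (1 / n ^ 2) := by
      have := mu_pos hn2
      positivity
    linarith
  have hQ3 : ∀ k, Q k ≠ 3 → Q k = 0 := by
    intro k
    have := hQ k
    generalize Q k = p at *
    revert this
    fin_cases p <;> simp [xbit]
  by_cases hS : ∃ j, Q j = 3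
  · obtain ⟨j, hj⟩ := hS
    refine ⟨j, ?_⟩
    have : Q = fun k => if k = j then 3 else 0 := by
      funext k
      split_ifs with hk
      · rw [hk, hj]
      · exact hQ3 k fun h => hk (huniq k j h hj)
    rw [hZ, hPQ, hω1, one_smul, this]
    rfl
  · exfalso
    have hP1 : P = 1 := by
      ext x y
      rw [hPQ, hω1, one_smul, pauliString_diag hQ, Matrix.one_apply]
      push Not at hS
      simp [hS]
    have hZ1 : zOp i = 1 := by
      have := congrArg (· * star C) hZ
      simpa [hP1, mul_assoc, Matrix.mem_unitaryGroup_iff.1 hC.1] using this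
    have h1 := congrFun (congrFun hZ1 (ind {i})) (ind {i})
    rw [zOp_apply, if_pos rfl, Matrix.one_apply_eq] at h1
    norm_num [ind] at h1

theorem zOp_injective {n : ℕ} : Function.Injective (zOp (n := n)) := by
  intro i j h
  by_contra hij
  have h1 := congrFun (congrFun h (ind {i})) (ind {i})
  rw [zOp_apply, zOp_apply, if_pos rfl, if_pos rfl] at h1
  norm_num [ind, Ne.symm hij] at h1

theorem exists_perm_of_zOp {n : ℕ} {C : Op n} (hC : C ∈ Matrix.unitaryGroup (Bits n) ℂ)
    (h : ∀ i, ∃ j, zOp i * C = C * zOp j) :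
    ∃ (τ : Equiv.Perm (Fin n)) (d : Bits n → ℂ), (∀ y, ‖d y‖ = 1) ∧
      C = Matrix.of fun x y => if x = y ∘ τ then d y else 0 := by
  choose τ hτ using h
  have hinj : Function.Injective τ := by
    intro i j hij
    have h1 : zOp i * C = zOp j * C := by rw [hτ, hτ, hij]
    have h2 := congrArg (· * star C) h1
    simp only [mul_assoc, Matrix.mem_unitaryGroup_iff.1 hC, mul_one] at h2
    exact zOp_injective h2
  have hsupp : ∀ x y, C x y ≠ 0 → x = y ∘ τ := by
    intro x y hxy
    funext i
    have h1 := congrFun (congrFun (hτ i) x) y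
    rw [zOp_mul_apply, mul_zOp_apply, mul_comm] at h1
    have h2 := mul_left_cancel₀ hxy h1
    simp only [Function.comp_apply]
    generalize x i = a at *
    generalize y (τ i) = b at *
    revert h2
    fin_cases a <;> fin_cases b <;> norm_num
  have hCe : C = Matrix.of fun x y => if x = y ∘ τ then C (y ∘ τ) y else 0 := by
    ext x y
    rw [Matrix.of_apply]
    split_ifs with h
    · rw [h]
    · by_contra h'
      exact h (hsupp x y h')
  refine ⟨Equiv.ofBijective τ (Finite.injective_iff_bijective.1 hinj),
    fun y => C (y ∘ τ) y, fun y => ?_, hCe⟩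
  have h1 := congrFun (congrFun (Matrix.mem_unitaryGroup_iff'.1 hC) y) y
  rw [Matrix.mul_apply, Finset.sum_eq_single (y ∘ τ), Matrix.one_apply_eq, Matrix.star_apply] at h1
  · have h2 : star (C (y ∘ τ) y) * C (y ∘ τ) y = ((‖C (y ∘ τ) y‖ ^ 2 : ℝ) : ℂ) := by
      rw [Complex.ofReal_pow]; exact Complex.conj_mul' _
    rw [h2] at h1
    have h3 : ‖C (y ∘ τ) y‖ ^ 2 = 1 := by exact_mod_cast h1
    exact (pow_eq_one_iff_of_nonneg (norm_nonneg _) two_ne_zero).1 h3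
  · intro x _ hx
    have : C x y = 0 := by by_contra h'; exact hx (hsupp x y h')
    rw [this, mul_zero]
  · simp

theorem braket_ketM_monomial {n : ℕ} (hn : 2 ≤ n) (τ : Equiv.Perm (Fin n)) (d : Bits n → ℂ) :
    (braket (ketM n) (Matrix.of fun x y => if x = y ∘ τ then d y else 0) (ketM n)).re =
      1 - ∑ y, (1 - (d y).re) * ‖ketM n y‖ ^ 2 := by
  rw [← sum_sign_eq (isState_ketM hn), braket, dotProduct]
  simp only [Matrix.mulVec, dotProduct, Finset.mul_sum]
  rw [Finset.sum_comm, Complex.re_sum]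
  refine Finset.sum_congr rfl fun y _ => ?_
  rw [Finset.sum_eq_single (y ∘ τ)]
  · have h : star (ketM n y) * ketM n y = ((‖ketM n y‖ ^ 2 : ℝ) : ℂ) := by
      rw [Complex.ofReal_pow]; exact Complex.conj_mul' _
    rw [Matrix.of_apply, if_pos rfl, Pi.star_apply, ketM_comp_perm hn, mul_left_comm, h,
      mul_comm, Complex.re_ofReal_mul, mul_comm]
  · intro x _ hx
    simp [hx]
  · simp

/-- A function on labels whose steps `d (flipBit j y) / d y` are entries of Pauli operators is constant
if it is constant on labels of weight at most two. -/
theorem eq_of_flip {n : ℕ} {d : Bits n → ℂ} (h : ∀ j y, d (flipBit j y) = d y) (y : Bits n) :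
    d y = d 0 := by
  rw [← ind_supp y]
  induction supp y using Finset.induction_on with
  | empty => congr 1
  | insert a s ha ih =>
    rw [← ih, ← h a (ind s)]
    congr 1
    funext k
    by_cases hk : k = a
    · subst hk; simp [flipBit, ind, ha]
    · simp [flipBit, ind, hk]

theorem eq_one_of_pow_four {r : ℂ} (hr : r ^ 4 = 1) (h : ‖r - 1‖ ≤ 1) : r = 1 := by
  rcases pow_four_eq_one.1 hr with rfl | rfl | rfl | rfl
  · rfl
  · norm_num at h
  all_goals
    have h2 := Complex.abs_re_le_norm
    exfalso
    rw [← sq_le_one_iff₀ (norm_nonneg _), ← Complex.normSq_eq_norm_sq, Complex.normSq_apply] at h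
    norm_num at h

theorem isQubitPerm_of_braket_ketM {n : ℕ} (hn : 100 ≤ n) {C : Op n} (hC : C ∈ cliffordGroup n)
    (h : 1 - 1 / (n : ℝ) ^ 5 ≤ (braket (ketM n) C (ketM n)).re) : IsQubitPerm C := by
  have hn2 : 2 ≤ n := by omega
  have hn' : (100 : ℝ) ≤ n := by exact_mod_cast hn
  obtain ⟨τ, d, hd, hCd⟩ := exists_perm_of_zOp hC.1 (exists_zOp_mul_eq hn hC h)
  have hmu := mu_sq_ge hn
  have hclose : ∀ y, (supp y).card ≤ 2 → ‖d y - 1‖ ≤ 1 / 2 := by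
    intro y hy
    rw [hCd, braket_ketM_monomial hn2] at h
    have hre : ∀ y, (d y).re ≤ 1 := fun y => (Complex.re_le_norm _).trans (hd y).le
    have h1 := le_sum_one_sub (ψ := ketM n) hre {y}
    rw [Finset.sum_singleton] at h1
    have h2 : 2 / (n : ℝ) ^ 2 ≤ relAmp n (supp y).card := by
      have hp : (0 : ℝ) < n * (n - 1) := by nlinarith
      have h3 : (2 : ℝ) / n ^ 2 ≤ 2 / (n * (n - 1)) := by
        gcongr; nlinarith
      have h4 : (2 : ℝ) / n ^ 2 ≤ 2 / n := by gcongr; nlinarith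
      have h5 : (2 : ℝ) / n ≤ 1 := by rw [div_le_one (by linarith)]; linarith
      interval_cases (supp y).card <;> simp [relAmp] <;> linarith
    have h3 : 3 / (n : ℝ) ^ 4 ≤ ‖ketM n y‖ ^ 2 := by
      rw [norm_ketM_apply hn2, mul_pow]
      calc 3 / (n : ℝ) ^ 4 ≤ 19 / 20 * (2 / (n : ℝ) ^ 2) ^ 2 := by
            rw [div_pow, ← pow_mul, ← mul_div_assoc]; gcongr; norm_num
        _ ≤ _ := by gcongr
    have h4 : (1 - (d y).re) * (3 / (n : ℝ) ^ 4) ≤ 1 / n ^ 5 := by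
      have := mul_le_mul_of_nonneg_left h3 (sub_nonneg.2 (hre y))
      linarith
    have h5 : (1 - (d y).re) ≤ 1 / 300 := by
      rw [mul_div_assoc', div_le_div_iff₀ (by positivity) (by positivity), pow_succ (n : ℝ) 4,
        one_mul, ← mul_assoc, mul_right_comm] at h4
      have h6 : (1 - (d y).re) * 3 * n ≤ 1 := by
        by_contra hcon
        push Not at hcon
        have : (0 : ℝ) < n ^ 4 := by positivity
        nlinarith
      nlinarith [hre y]
    rw [← abs_of_nonneg (norm_nonneg (d y - 1)), ← abs_of_pos (show (0 : ℝ) < 1 / 2 by norm_num),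
      ← sq_le_sq, ← Complex.normSq_eq_norm_sq, Complex.normSq_sub, Complex.normSq_eq_norm_sq, hd]
    norm_num
    linarith
  have hne : ∀ y, d y ≠ 0 := fun y h0 => by simpa [h0] using hd y
  have hflip : ∀ j y, d (flipBit j y) = d y := by
    intro j
    obtain ⟨P, hP, hX⟩ := exists_eq_mul_of_mem_cliffordGroup hC (xOp_mem j)
    obtain ⟨ω, hω, Q, rfl⟩ := mem_pauliGroup.1 hP
    have hstep : ∀ y, d (flipBit j y) = ω * pauliString Q (flipBit j y ∘ τ) (y ∘ τ) * d y := by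
      intro y
      have h1 := congrFun (congrFun hX (flipBit j y ∘ τ)) y
      rw [mul_xOp_apply, Matrix.mul_apply, Finset.sum_eq_single (y ∘ τ)] at h1
      · rw [hCd] at h1
        simpa [mul_assoc] using h1
      · intro x _ hx
        rw [hCd]; simp [hx]
      · simp
    have hω0 : ω ≠ 0 := fun h0 => by simp [h0] at hω
    have hmask : ∀ y k, (flipBit j y ∘ τ) k = (y ∘ τ) k + xbit (Q k) := by
      intro y
      refine (pauliString_ne_zero Q _ _).1 fun h0 => hne (flipBit j y) ?_
      rw [hstep, h0]; simp
    set f : Fin n → Fin 2 → ℂ := fun k b => singlePauli (Q k) (b + xbit (Q k)) b with hf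
    have hfac : ∀ y, pauliString Q (flipBit j y ∘ τ) (y ∘ τ) = ∏ k, f k (y (τ k)) := by
      intro y
      rw [pauliString_apply]
      exact Finset.prod_congr rfl fun k _ => by rw [hmask]; rfl
    have hf0 : ∀ k b, f k b ≠ 0 := fun k b => (singlePauli_ne_zero _ _ _).2 rfl
    set g : Bits n → ℂ := fun y => ω * ∏ k, f k (y (τ k)) with hg
    have hstep' : ∀ y, d (flipBit j y) = g y * d y := fun y => by rw [hstep, hfac]
    have hg4 : ∀ y, g y ^ 4 = 1 := by
      intro y
      rw [hg]
      simp only [mul_pow, hω, one_mul, ← Finset.prod_pow]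
      exact Finset.prod_eq_one fun k _ => singlePauli_pow_four _ _
    have hg1 : ∀ y, (supp y).card ≤ 2 → (supp (flipBit j y)).card ≤ 2 → g y = 1 := by
      intro y h1 h2
      refine eq_one_of_pow_four (hg4 y) ?_
      have h3 : ‖g y - 1‖ = ‖(d (flipBit j y) - 1) - (d y - 1)‖ := by
        rw [hstep', show g y * d y - 1 - (d y - 1) = (g y - 1) * d y by ring, norm_mul, hd, mul_one]
      rw [h3]
      linarith [norm_sub_le (d (flipBit j y) - 1) (d y - 1), hclose _ h1, hclose _ h2]
    have hsub : ∀ y, supp (flipBit j y) ⊆ insert j (supp y) := by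
      intro y k hk
      by_cases hkj : k = j
      · simp [hkj]
      · simpa [flipBit, hkj] using hk
    have hg0 : g 0 = 1 := by
      refine hg1 0 (by simp [supp]) ((Finset.card_le_card (hsub 0)).trans ?_)
      simp [supp]
    have hgk : ∀ k, g (ind {k}) = 1 := by
      intro k
      refine hg1 _ (by simp) ((Finset.card_le_card (hsub _)).trans ?_)
      rw [supp_ind]
      exact Finset.card_le_two
    have hf1 : ∀ k, f k 1 = f k 0 := by
      intro k
      have h1 := (hgk (τ k)).trans hg0.symm
      simp only [hg] at h1
      have h2 := mul_left_cancel₀ hω0 h1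
      rw [← Finset.mul_prod_erase _ _ (Finset.mem_univ k),
        ← Finset.mul_prod_erase _ (fun l => f l ((0 : Bits n) (τ l))) (Finset.mem_univ k)] at h2
      have h3 : ∀ l ∈ Finset.univ.erase k, f l (ind {τ k} (τ l)) = f l ((0 : Bits n) (τ l)) := by
        intro l hl
        simp [ind, Finset.ne_of_mem_erase hl]
      rw [Finset.prod_congr rfl h3] at h2
      have h4 := mul_right_cancel₀ (Finset.prod_ne_zero_iff.2 fun l _ => hf0 l _) h2
      simpa [ind] using h4
    intro y
    have : g y = 1 := by
      rw [← hg0]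
      simp only [hg]
      congr 1
      refine Finset.prod_congr rfl fun k _ => ?_
      rcases (show y (τ k) = 0 ∨ y (τ k) = 1 by omega) with h | h <;> simp [h, hf1]
    rw [hstep', this, one_mul]
  refine ⟨τ.symm, d 0, hd 0, ?_⟩
  rw [hCd]
  ext x y
  simp [qubitPerm, eq_of_flip hflip y]

/-! ### Clifford operators -/

theorem finite_pauliGroup (n : ℕ) : (pauliGroup n).Finite := by
  refine Set.Finite.subset (s := ⋃ ω ∈ ({1, -1, Complex.I, -Complex.I} : Set ℂ),
    Set.range fun P : Fin n → Fin 4 => ω • pauliString P) ?_ ?_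
  · exact Set.Finite.biUnion (by simp) fun ω _ => Set.finite_range _
  · rintro A ⟨ω, hω, P, rfl⟩
    simp only [Set.mem_iUnion]
    exact ⟨ω, by simpa using hω, P, rfl⟩

theorem smul_mem_pauliGroup {n : ℕ} {A : Op n} (hA : A ∈ pauliGroup n) {ω : ℂ} (hω : ω ^ 4 = 1) :
    ω • A ∈ pauliGroup n := by
  obtain ⟨ω', hω', P, rfl⟩ := mem_pauliGroup.1 hA
  exact mem_pauliGroup.2 ⟨ω * ω', by rw [mul_pow, hω, hω', one_mul], P, smul_smul _ _ _⟩

theorem mem_cliffordGroup_of_conj {n : ℕ} {U : Op n} (hU : U ∈ Matrix.unitaryGroup (Bits n) ℂ)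
    (h : ∀ Q : Fin n → Fin 4, U * pauliString Q * Uᴴ ∈ pauliGroup n) : U ∈ cliffordGroup n := by
  refine ⟨hU, ?_⟩
  have hU' : Uᴴ * U = 1 := Matrix.mem_unitaryGroup_iff'.1 hU
  have hinj : Function.Injective fun P => U * P * Uᴴ := by
    intro P Q hPQ
    have := congrArg (fun A => Uᴴ * A * U) hPQ
    simp only [mul_assoc, hU', mul_one] at this
    simpa only [← mul_assoc, hU', one_mul] using this
  have hsub : (fun P => U * P * Uᴴ) '' pauliGroup n ⊆ pauliGroup n := by
    rintro _ ⟨P, hP, rfl⟩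
    obtain ⟨ω, hω, Q, rfl⟩ := mem_pauliGroup.1 hP
    simp only [Matrix.mul_smul, Matrix.smul_mul]
    exact smul_mem_pauliGroup (h Q) hω
  exact Set.eq_of_subset_of_ncard_le hsub (Set.ncard_image_of_injective _ hinj).ge
    (finite_pauliGroup n)

theorem mul_mem_cliffordGroup {n : ℕ} {U V : Op n} (hU : U ∈ cliffordGroup n)
    (hV : V ∈ cliffordGroup n) : U * V ∈ cliffordGroup n := by
  refine ⟨mul_mem hU.1 hV.1, ?_⟩
  have : (fun P => U * V * P * (U * V)ᴴ) = (fun P => U * P * Uᴴ) ∘ fun P => V * P * Vᴴ := by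
    funext P
    simp [Matrix.conjTranspose_mul, mul_assoc]
  rw [this, Set.image_comp, hV.2, hU.2]

theorem smul_mem_cliffordGroup {n : ℕ} {U : Op n} (hU : U ∈ cliffordGroup n) {ω : ℂ}
    (hω : ‖ω‖ = 1) : ω • U ∈ cliffordGroup n := by
  have h1 : ω * star ω = 1 := by
    have := Complex.mul_conj' ω
    rw [hω] at this
    simpa using this
  refine ⟨?_, ?_⟩
  · rw [Matrix.mem_unitaryGroup_iff, star_smul, Matrix.smul_mul, Matrix.mul_smul, smul_smul,
      Matrix.mem_unitaryGroup_iff.1 hU.1, h1, one_smul]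
  · have : (fun P => (ω • U) * P * (ω • U)ᴴ) = fun P => U * P * Uᴴ := by
      funext P
      rw [Matrix.conjTranspose_smul, Matrix.smul_mul, Matrix.smul_mul, Matrix.mul_smul, smul_smul,
        h1, one_smul]
    rw [this, hU.2]

theorem one_mem_cliffordGroup (n : ℕ) : (1 : Op n) ∈ cliffordGroup n :=
  ⟨one_mem _, by simp⟩

/-! ### Tensor products of operators on single qubits -/

/-- The tensor product of operators on single qubits. -/
def tensor {n : ℕ} (A : Fin n → Matrix (Fin 2) (Fin 2) ℂ) : Op n :=
  Matrix.of fun x y => ∏ k, A k (x k) (y k)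

theorem sum_prod_bits {n : ℕ} (f : Fin n → Fin 2 → ℂ) :
    ∑ x : Bits n, ∏ k, f k (x k) = ∏ k, ∑ b, f k b := by
  rw [Finset.prod_univ_sum, Fintype.piFinset_univ]

theorem tensor_mul {n : ℕ} (A B : Fin n → Matrix (Fin 2) (Fin 2) ℂ) :
    tensor A * tensor B = tensor fun k => A k * B k := by
  ext x y
  simp only [tensor, Matrix.mul_apply, Matrix.of_apply, ← Finset.prod_mul_distrib]
  exact sum_prod_bits fun k b => A k (x k) b * B k b (y k)

theorem tensor_mulVec {n : ℕ} (A : Fin n → Matrix (Fin 2) (Fin 2) ℂ) (v : Fin n → Fin 2 → ℂ) :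
    tensor A *ᵥ productKet v = productKet fun k => A k *ᵥ v k := by
  funext x
  simp only [tensor, Matrix.mulVec, dotProduct, Matrix.of_apply, productKet,
    ← Finset.prod_mul_distrib]
  exact sum_prod_bits fun k b => A k (x k) b * v k b

theorem conjTranspose_tensor {n : ℕ} (A : Fin n → Matrix (Fin 2) (Fin 2) ℂ) :
    (tensor A)ᴴ = tensor fun k => (A k)ᴴ := by
  ext x y
  simp [tensor, Matrix.conjTranspose_apply]

theorem tensor_one (n : ℕ) : tensor (fun _ : Fin n => 1) = 1 := by
  ext x y
  simp only [tensor, Matrix.of_apply, Matrix.one_apply]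
  split_ifs with h
  · simp [h]
  · obtain ⟨k, hk⟩ := Function.ne_iff.1 h
    exact Finset.prod_eq_zero (Finset.mem_univ k) (by simp [hk])

theorem tensor_smul {n : ℕ} (c : Fin n → ℂ) (A : Fin n → Matrix (Fin 2) (Fin 2) ℂ) :
    tensor (fun k => c k • A k) = (∏ k, c k) • tensor A := by
  ext x y
  simp [tensor, Finset.prod_mul_distrib]

theorem tensor_mem_cliffordGroup {n : ℕ} {A : Fin n → Matrix (Fin 2) (Fin 2) ℂ}
    (hA : ∀ k, A k * (A k)ᴴ = 1)
    (h : ∀ k p, ∃ ω : ℂ, ω ^ 4 = 1 ∧ ∃ q, A k * singlePauli p * (A k)ᴴ = ω • singlePauli q) :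
    tensor A ∈ cliffordGroup n := by
  refine mem_cliffordGroup_of_conj ?_ fun Q => ?_
  · rw [Matrix.mem_unitaryGroup_iff, Matrix.star_eq_conjTranspose, conjTranspose_tensor,
      tensor_mul]
    simp only [hA, tensor_one]
  · choose ω hω q hq using h
    have hQ : pauliString Q = tensor fun k => singlePauli (Q k) := rfl
    rw [hQ, conjTranspose_tensor, tensor_mul, tensor_mul]
    simp only [hq, tensor_smul]
    refine mem_pauliGroup.2 ⟨_, ?_, fun k => q k (Q k), rfl⟩
    rw [← Finset.prod_pow]
    exact Finset.prod_eq_one fun k _ => hω _ _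

/-- The Hadamard matrix. -/
def hadamard : Matrix (Fin 2) (Fin 2) ℂ := ((√2 : ℝ) : ℂ)⁻¹ • !![1, 1; 1, -1]

theorem inv_sqrt_two_sq : (((√2 : ℝ) : ℂ)⁻¹) * ((√2 : ℝ) : ℂ)⁻¹ = 1 / 2 := by
  rw [← mul_inv, ← sq, sqrt_two_sq]; norm_num

theorem hadamard_conjTranspose : hadamardᴴ = hadamard := by
  ext a b
  fin_cases a <;> fin_cases b <;> simp [hadamard, Matrix.conjTranspose_apply]

theorem hadamard_mul_self : hadamard * hadamard = 1 := by
  rw [hadamard, Matrix.smul_mul, Matrix.mul_smul, smul_smul, inv_sqrt_two_sq]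
  ext a b
  fin_cases a <;> fin_cases b <;> norm_num

theorem hadamard_conj (p : Fin 4) : ∃ ω : ℂ, ω ^ 4 = 1 ∧
    ∃ q, hadamard * singlePauli p * hadamardᴴ = ω • singlePauli q := by
  refine ⟨![1, 1, -1, 1] p, by fin_cases p <;> norm_num, ![0, 3, 2, 1] p, ?_⟩
  rw [hadamard_conjTranspose, hadamard, Matrix.smul_mul, Matrix.smul_mul, Matrix.mul_smul,
    smul_smul, inv_sqrt_two_sq]
  ext a b
  fin_cases p <;> fin_cases a <;> fin_cases b <;> simp [singlePauli] <;> ring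

theorem tensor_hadamard_mem (n : ℕ) : tensor (fun _ : Fin n => hadamard) ∈ cliffordGroup n :=
  tensor_mem_cliffordGroup (fun _ => by rw [hadamard_conjTranspose, hadamard_mul_self])
    fun _ => hadamard_conj

theorem tensor_flips_mem {n : ℕ} (x : Bits n) :
    tensor (fun k => if x k = 1 then singlePauli 1 else 1) ∈ cliffordGroup n := by
  refine tensor_mem_cliffordGroup (fun k => ?_) fun k p => ?_
  · split_ifs
    · ext a b; fin_cases a <;> fin_cases b <;> simp [singlePauli, Matrix.mul_apply]
    · simp
  · split_ifs
    · refine ⟨![1, 1, -1, -1] p, by fin_cases p <;> norm_num, p, ?_⟩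
      ext a b
      fin_cases p <;> fin_cases a <;> fin_cases b <;>
        simp [singlePauli, Matrix.mul_apply]
    · exact ⟨1, one_pow _, p, by simp⟩

theorem isStabilizerState_single {n : ℕ} (x : Bits n) : IsStabilizerState (Pi.single x 1) := by
  refine ⟨_, tensor_flips_mem x, ?_⟩
  rw [zeroKet, tensor_mulVec]
  funext y
  have h1 : ∀ k, ((if x k = 1 then singlePauli 1 else 1) *ᵥ ket0) (y k) =
      if y k = x k then (1 : ℂ) else 0 := by
    intro k
    generalize x k = a
    generalize y k = b
    fin_cases a <;> fin_cases b <;> simp [singlePauli, ket0]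
  simp only [productKet, h1, Pi.single_apply, funext_iff]
  split_ifs with h
  · simp [h]
  · push Not at h
    obtain ⟨k, hk⟩ := h
    exact (Finset.prod_eq_zero (Finset.mem_univ k) (by simp [hk])).symm

/-! ### Permutations of the qubits and controlled `Z` -/

theorem qubitPerm_mulVec_apply {n : ℕ} (π : Equiv.Perm (Fin n)) (ψ : Ket n) (x : Bits n) :
    (qubitPerm π *ᵥ ψ) x = ψ (x ∘ π) := by
  rw [Matrix.mulVec, dotProduct, Finset.sum_eq_single (x ∘ π)]
  · simp [qubitPerm, Function.comp_assoc]
  · intro y _ hy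
    have : x ≠ y ∘ π.symm := by
      rintro rfl
      exact hy (by simp [Function.comp_assoc])
    simp [qubitPerm, this]
  · simp

theorem qubitPerm_mul_apply {n : ℕ} (π : Equiv.Perm (Fin n)) (A : Op n) (x y : Bits n) :
    (qubitPerm π * A) x y = A (x ∘ π) y :=
  qubitPerm_mulVec_apply π (fun z => A z y) x

theorem mul_qubitPerm_conjTranspose_apply {n : ℕ} (π : Equiv.Perm (Fin n)) (A : Op n)
    (x y : Bits n) : (A * (qubitPerm π)ᴴ) x y = A x (y ∘ π) := by
  rw [Matrix.mul_apply, Finset.sum_eq_single (y ∘ π)]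
  · simp [qubitPerm, Function.comp_assoc]
  · intro z _ hz
    have : y ≠ z ∘ π.symm := by
      rintro rfl
      exact hz (by simp [Function.comp_assoc])
    simp [qubitPerm, this]
  · simp

theorem comp_perm_injective {n : ℕ} (π : Equiv.Perm (Fin n)) {x y : Bits n} :
    x ∘ π = y ∘ π ↔ x = y :=
  π.surjective.injective_comp_right.eq_iff

theorem qubitPerm_mem_unitaryGroup {n : ℕ} (π : Equiv.Perm (Fin n)) :
    qubitPerm π ∈ Matrix.unitaryGroup (Bits n) ℂ := by
  rw [Matrix.mem_unitaryGroup_iff, Matrix.star_eq_conjTranspose]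
  ext x y
  rw [qubitPerm_mul_apply, ← one_mul (qubitPerm π)ᴴ, mul_qubitPerm_conjTranspose_apply,
    Matrix.one_apply, Matrix.one_apply]
  simp only [comp_perm_injective]

theorem qubitPerm_mem_cliffordGroup {n : ℕ} (π : Equiv.Perm (Fin n)) :
    qubitPerm π ∈ cliffordGroup n := by
  refine mem_cliffordGroup_of_conj (qubitPerm_mem_unitaryGroup π) fun Q => ?_
  have : qubitPerm π * pauliString Q * (qubitPerm π)ᴴ = pauliString (Q ∘ π.symm) := by
    ext x y
    rw [mul_qubitPerm_conjTranspose_apply, qubitPerm_mul_apply, pauliString_apply,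
      pauliString_apply]
    exact Fintype.prod_equiv π _ _ fun k => by simp
  rw [this]
  exact pauliString_mem _

/-- The controlled `Z` on the qubits `i` and `j`. -/
def czOp {n : ℕ} (i j : Fin n) : Op n :=
  Matrix.diagonal fun x => (-1) ^ ((x i : ℕ) * (x j : ℕ))

theorem czOp_mulVec {n : ℕ} (i j : Fin n) (ψ : Ket n) :
    czOp i j *ᵥ ψ = fun x => (-1) ^ ((x i : ℕ) * (x j : ℕ)) * ψ x := by
  funext x
  rw [czOp, Matrix.mulVec_diagonal]

/-- The index of the Pauli matrix that is `Z ^ f` times the given one, up to a phase. -/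
def zMul (p : Fin 4) (f : Fin 2) : Fin 4 := if f = 0 then p else ![3, 2, 1, 0] p

/-- The phase that belongs to `zMul`. -/
def zPhase (p : Fin 4) (f : Fin 2) : ℂ := if f = 0 then 1 else ![1, -Complex.I, Complex.I, 1] p

theorem zPhase_pow_four (p : Fin 4) (f : Fin 2) : zPhase p f ^ 4 = 1 := by
  fin_cases p <;> fin_cases f <;> simp [zPhase, Even.neg_pow (show Even 4 by decide)]

theorem singlePauli_zMul (p : Fin 4) (f a c : Fin 2) :
    (-1) ^ ((f : ℕ) * (c : ℕ)) * singlePauli p a c = zPhase p f * singlePauli (zMul p f) a c := by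
  fin_cases p <;> fin_cases f <;> fin_cases a <;> fin_cases c <;>
    simp [singlePauli, zMul, zPhase]

theorem cz_singlePauli (p q : Fin 4) (a b c e : Fin 2) :
    (-1) ^ ((a : ℕ) * (b : ℕ)) * (-1) ^ ((c : ℕ) * (e : ℕ)) *
        (singlePauli p a c * singlePauli q b e) =
      (-1) ^ ((xbit p : ℕ) * (xbit q : ℕ)) * zPhase p (xbit q) * zPhase q (xbit p) *
        (singlePauli (zMul p (xbit q)) a c * singlePauli (zMul q (xbit p)) b e) := by
  by_cases h1 : singlePauli p a c = 0
  · have := singlePauli_zMul p (xbit q) a c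
    rw [h1, mul_zero] at this
    rw [h1]
    linear_combination ((-1) ^ ((xbit p : ℕ) * (xbit q : ℕ)) * zPhase q (xbit p) *
      singlePauli (zMul q (xbit p)) b e) * this
  by_cases h2 : singlePauli q b e = 0
  · have := singlePauli_zMul q (xbit p) b e
    rw [h2, mul_zero] at this
    rw [h2]
    linear_combination ((-1) ^ ((xbit p : ℕ) * (xbit q : ℕ)) * zPhase p (xbit q) *
      singlePauli (zMul p (xbit q)) a c) * this
  have e1 := singlePauli_zMul p (xbit q) a c
  have e2 := singlePauli_zMul q (xbit p) b e
  have h3 : (-1 : ℂ) ^ ((a : ℕ) * (b : ℕ)) * (-1) ^ ((c : ℕ) * (e : ℕ)) =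
      (-1) ^ ((xbit p : ℕ) * (xbit q : ℕ)) * (-1) ^ ((xbit q : ℕ) * (c : ℕ)) *
        (-1) ^ ((xbit p : ℕ) * (e : ℕ)) := by
    rw [(singlePauli_ne_zero _ _ _).1 h1, (singlePauli_ne_zero _ _ _).1 h2]
    generalize xbit p = f
    generalize xbit q = g
    fin_cases f <;> fin_cases g <;> fin_cases c <;> fin_cases e <;> simp
  rw [h3]
  linear_combination ((-1) ^ ((xbit p : ℕ) * (xbit q : ℕ)) * (-1) ^ ((xbit p : ℕ) * (e : ℕ)) *
    singlePauli q b e) * e1 + (-1) ^ ((xbit p : ℕ) * (xbit q : ℕ)) * zPhase p (xbit q) *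
    singlePauli (zMul p (xbit q)) a c * e2

theorem czOp_mem_cliffordGroup {n : ℕ} {i j : Fin n} (hij : i ≠ j) : czOp i j ∈ cliffordGroup n := by
  have hstar : (czOp i j)ᴴ = czOp i j := by
    simp [czOp, Matrix.diagonal_conjTranspose, Pi.star_def]
  refine mem_cliffordGroup_of_conj ?_ fun Q => ?_
  · rw [Matrix.mem_unitaryGroup_iff, Matrix.star_eq_conjTranspose, hstar, czOp,
      Matrix.diagonal_mul_diagonal, ← Matrix.diagonal_one]
    congr 1
    funext x
    rw [← mul_pow]; simp
  · refine mem_pauliGroup.2 ⟨(-1) ^ ((xbit (Q i) : ℕ) * (xbit (Q j) : ℕ)) *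
      zPhase (Q i) (xbit (Q j)) * zPhase (Q j) (xbit (Q i)), ?_, fun k =>
        if k = i then zMul (Q i) (xbit (Q j)) else
          if k = j then zMul (Q j) (xbit (Q i)) else Q k, ?_⟩
    · rw [mul_pow, mul_pow, zPhase_pow_four, zPhase_pow_four, ← pow_mul, mul_comm _ 4, pow_mul]
      norm_num
    · ext x y
      have hj : j ∈ (Finset.univ : Finset (Fin n)).erase i := by simp [hij.symm]
      rw [hstar, czOp, Matrix.mul_diagonal, Matrix.diagonal_mul, Matrix.smul_apply,
        pauliString_apply, pauliString_apply, ← Finset.mul_prod_erase _ _ (Finset.mem_univ i),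
        ← Finset.mul_prod_erase _ _ hj,
        ← Finset.mul_prod_erase _ (fun k => singlePauli (if k = i then _ else _) _ _)
          (Finset.mem_univ i),
        ← Finset.mul_prod_erase _ (fun k => singlePauli (if k = i then _ else _) _ _) hj]
      have hr : ∀ k ∈ ((Finset.univ : Finset (Fin n)).erase i).erase j,
          singlePauli (if k = i then zMul (Q i) (xbit (Q j)) else
            if k = j then zMul (Q j) (xbit (Q i)) else Q k) (x k) (y k) =
          singlePauli (Q k) (x k) (y k) := by
        intro k hk
        simp only [Finset.mem_erase] at hk
        rw [if_neg hk.2.1, if_neg hk.1]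
      rw [Finset.prod_congr rfl hr]
      simp only [if_true, if_neg hij.symm, smul_eq_mul]
      have := cz_singlePauli (Q i) (Q j) (x i) (x j) (y i) (y j)
      linear_combination (∏ k ∈ ((Finset.univ : Finset (Fin n)).erase i).erase j,
        singlePauli (Q k) (x k) (y k)) * this

/-! ### Graph states -/

theorem exists_clifford_cz {n : ℕ} (s : Finset (Fin n × Fin n)) (hs : ∀ p ∈ s, p.1 ≠ p.2) :
    ∃ U ∈ cliffordGroup n, ∀ ψ : Ket n, U *ᵥ ψ =
      fun x => (∏ p ∈ s, (-1 : ℂ) ^ ((x p.1 : ℕ) * (x p.2 : ℕ))) * ψ x := by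
  induction s using Finset.induction_on with
  | empty => exact ⟨1, one_mem_cliffordGroup n, by simp⟩
  | insert p s hp ih =>
    obtain ⟨U, hU, h⟩ := ih fun q hq => hs q (Finset.mem_insert_of_mem hq)
    refine ⟨czOp p.1 p.2 * U, mul_mem_cliffordGroup
      (czOp_mem_cliffordGroup (hs p (Finset.mem_insert_self p s))) hU, fun ψ => ?_⟩
    rw [← Matrix.mulVec_mulVec, h, czOp_mulVec]
    funext x
    rw [Finset.prod_insert hp, mul_assoc]

theorem hadamard_mulVec_ket0 (b : Fin 2) : (hadamard *ᵥ ket0) b = ((√2 : ℝ) : ℂ)⁻¹ := by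
  fin_cases b <;> simp [hadamard, ket0]

theorem sqrt_two_pow (n : ℕ) : √((2 : ℝ) ^ n) = √2 ^ n := by
  rw [Real.sqrt_eq_iff_mul_self_eq (by positivity) (by positivity), ← mul_pow,
    Real.mul_self_sqrt (by norm_num)]

theorem isStabilizerState_graphState {n : ℕ} (G : SimpleGraph (Fin n)) :
    IsStabilizerState (graphState G) := by
  classical
  obtain ⟨U, hU, h⟩ := exists_clifford_cz
    (Finset.univ.filter fun p : Fin n × Fin n => p.1 < p.2 ∧ G.Adj p.1 p.2)
    fun p hp => ne_of_lt (Finset.mem_filter.1 hp).2.1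
  refine ⟨U * _, mul_mem_cliffordGroup hU (tensor_hadamard_mem n), ?_⟩
  rw [← Matrix.mulVec_mulVec, h, zeroKet, tensor_mulVec]
  funext x
  rw [graphState, mul_comm]
  congr 1
  simp [productKet, hadamard_mulVec_ket0, sqrt_two_pow]

/-! ### Stabilizer rank -/

theorem isStabilizerState_zeroKet (n : ℕ) : IsStabilizerState (zeroKet n) :=
  ⟨1, one_mem_cliffordGroup n, by simp⟩

theorem StabilizerRankLE.add {n : ℕ} {φ ψ : Ket n} {r s : ℕ} (hφ : StabilizerRankLE φ r)
    (hψ : StabilizerRankLE ψ s) : StabilizerRankLE (φ + ψ) (r + s) := by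
  obtain ⟨c, u, hu, rfl⟩ := hφ
  obtain ⟨d, v, hv, rfl⟩ := hψ
  refine ⟨Fin.append c d, Fin.append u v, fun t => ?_, ?_⟩
  · induction t using Fin.addCases with
    | left t => simpa using hu t
    | right t => simpa using hv t
  · simp [Fin.sum_univ_add]

theorem StabilizerRankLE.zero {n : ℕ} (r : ℕ) : StabilizerRankLE (0 : Ket n) r :=
  ⟨0, fun _ => zeroKet n, fun _ => isStabilizerState_zeroKet n, by simp⟩

theorem StabilizerRankLE.mono {n : ℕ} {ψ : Ket n} {r s : ℕ} (h : StabilizerRankLE ψ r)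
    (hrs : r ≤ s) : StabilizerRankLE ψ s := by
  obtain ⟨k, rfl⟩ := Nat.exists_eq_add_of_le hrs
  simpa using h.add (StabilizerRankLE.zero k)

theorem IsStabilizerState.stabilizerRankLE_smul {n : ℕ} {ψ : Ket n} (h : IsStabilizerState ψ)
    (c : ℂ) : StabilizerRankLE (c • ψ) 1 :=
  ⟨fun _ => c, fun _ => ψ, fun _ => h, by simp⟩

theorem StabilizerRankLE.smul {n : ℕ} {ψ : Ket n} {r : ℕ} (h : StabilizerRankLE ψ r) (a : ℂ) :
    StabilizerRankLE (a • ψ) r := by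
  obtain ⟨c, u, hu, rfl⟩ := h
  exact ⟨fun t => a * c t, u, hu, by simp [Finset.smul_sum, smul_smul]⟩

theorem StabilizerRankLE.sum {n : ℕ} {ι : Type*} (s : Finset ι) {c : ι → ℂ} {v : ι → Ket n}
    (h : ∀ i ∈ s, IsStabilizerState (v i)) : StabilizerRankLE (∑ i ∈ s, c i • v i) s.card := by
  classical
  induction s using Finset.induction_on with
  | empty => simpa using StabilizerRankLE.zero 0
  | insert i s hi ih =>
    rw [Finset.sum_insert hi, Finset.card_insert_of_notMem hi, add_comm s.card]
    exact ((h i (Finset.mem_insert_self i s)).stabilizerRankLE_smul _).add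
      (ih fun j hj => h j (Finset.mem_insert_of_mem hj))

theorem stabilizerRankLE_ketM {n : ℕ} (hn : 2 ≤ n) :
    StabilizerRankLE (ketM n) (2 * n * (n - 1)) := by
  set s : Finset (Bits n) := Finset.univ.filter fun x => (supp x).card ≤ 2 with hs
  have e : ketM n = ∑ x ∈ s, ketM n x • (Pi.single x 1 : Ket n) := by
    funext y
    simp only [Finset.sum_apply, Pi.smul_apply, Pi.single_apply, smul_eq_mul, mul_ite, mul_one,
      mul_zero, Finset.sum_ite_eq]
    split_ifs with h
    · rfl
    · rw [ketM_apply hn, relAmp_of_three_le (by simp [hs] at h; omega)]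
      simp
  have hcard : (s.card : ℝ) = 1 + n + n * (n - 1) / 2 := by
    rw [Finset.card_filter, Nat.cast_sum, sum_bits_card fun w => (((if w ≤ 2 then 1 else 0) : ℕ) : ℝ),
      sum_range_choose_of_le_two hn fun m hm => by rw [if_neg (by omega), Nat.cast_zero]]
    norm_num
  rw [e]
  refine (StabilizerRankLE.sum s fun x _ => isStabilizerState_single x).mono ?_
  have h2 : (2 : ℝ) ≤ n := by exact_mod_cast hn
  rw [← Nat.cast_le (α := ℝ), hcard]
  push_cast [Nat.cast_sub (show 1 ≤ n by omega)]
  nlinarith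

theorem stabilizerRankLE_psi {n : ℕ} (hn : 2 ≤ n) (a b : ℝ) (G : SimpleGraph (Fin n)) :
    StabilizerRankLE (psi a b G) (2 * n * (n - 1) + 1) :=
  ((stabilizerRankLE_ketM hn).smul _).add
    ((isStabilizerState_graphState G).stabilizerRankLE_smul _)

/-! ### Overlaps of graph states -/

open Classical in
/-- The sign of the amplitude of a graph state. -/
def graphSign {n : ℕ} (G : SimpleGraph (Fin n)) (x : Bits n) : ℝ :=
  ∏ p ∈ Finset.univ.filter (fun p : Fin n × Fin n => p.1 < p.2 ∧ G.Adj p.1 p.2),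
    (-1 : ℝ) ^ ((x p.1 : ℕ) * (x p.2 : ℕ))

theorem graphState_apply {n : ℕ} (G : SimpleGraph (Fin n)) (x : Bits n) :
    graphState G x = (1 / √(2 ^ n) * graphSign G x : ℝ) := by
  rw [graphState, graphSign]
  push_cast
  rfl

theorem abs_graphSign {n : ℕ} (G : SimpleGraph (Fin n)) (x : Bits n) : |graphSign G x| = 1 := by
  rw [graphSign, Finset.abs_prod]
  exact Finset.prod_eq_one fun p _ => by simp

theorem norm_graphState_apply {n : ℕ} (G : SimpleGraph (Fin n)) (x : Bits n) :
    ‖graphState G x‖ = 1 / √(2 ^ n) := by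
  rw [graphState_apply, Complex.norm_real, Real.norm_eq_abs, abs_mul, abs_graphSign, mul_one,
    abs_of_nonneg (by positivity)]

theorem card_bits (n : ℕ) : (Finset.univ : Finset (Bits n)).card = 2 ^ n := by simp

theorem isState_graphState {n : ℕ} (G : SimpleGraph (Fin n)) : IsState (graphState G) := by
  rw [IsState, normSq, Finset.sum_congr rfl fun x _ => by rw [norm_graphState_apply],
    Finset.sum_const, card_bits, nsmul_eq_mul, div_pow, Real.sq_sqrt (by positivity)]
  push_cast
  field_simp

theorem norm_ketM_graphState_le {n : ℕ} (hn : 2 ≤ n) (G : SimpleGraph (Fin n)) :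
    ‖star (ketM n) ⬝ᵥ graphState G‖ ≤ 4 / √(2 ^ n) := by
  refine (norm_sum_le _ _).trans ?_
  simp only [norm_mul, Pi.star_apply, norm_star, norm_graphState_apply]
  rw [← Finset.sum_mul, mul_one_div]
  gcongr
  exact sum_norm_ketM_le hn

theorem norm_star_dotProduct_comm {n : ℕ} (φ ψ : Ket n) : ‖star φ ⬝ᵥ ψ‖ = ‖star ψ ⬝ᵥ φ‖ := by
  rw [Matrix.star_dotProduct, norm_star]

theorem flip_flip {n : ℕ} (j : Fin n) (x : Bits n) : flipBit j (flipBit j x) = x := by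
  funext k
  by_cases h : k = j
  · subst h; simp only [flipBit, Function.update_self]; omega
  · simp [flipBit, h]

/-- Flipping a bit, as a permutation of the labels. -/
def flipEquiv {n : ℕ} (j : Fin n) : Equiv.Perm (Bits n) where
  toFun := flipBit j
  invFun := flipBit j
  left_inv := flip_flip j
  right_inv := flip_flip j

theorem flip_self {n : ℕ} (j : Fin n) (x : Bits n) : flipBit j x j = x j + 1 := by simp [flipBit]

theorem flip_of_ne {n : ℕ} {j k : Fin n} (h : k ≠ j) (x : Bits n) : flipBit j x k = x k := by
  simp [flipBit, h]

open Classical in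
theorem graphSign_four {n : ℕ} (G : SimpleGraph (Fin n)) {u v : Fin n} (huv : u < v) (x : Bits n) :
    graphSign G x * graphSign G (flipBit u x) * (graphSign G (flipBit v x) *
      graphSign G (flipBit u (flipBit v x))) = if G.Adj u v then -1 else 1 := by
  simp only [graphSign, ← Finset.prod_mul_distrib]
  have key : ∀ p : Fin n × Fin n, p.1 < p.2 →
      (-1 : ℝ) ^ ((x p.1 : ℕ) * (x p.2 : ℕ)) *
        (-1) ^ ((flipBit u x p.1 : ℕ) * (flipBit u x p.2 : ℕ)) *
        ((-1) ^ ((flipBit v x p.1 : ℕ) * (flipBit v x p.2 : ℕ)) *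
        (-1) ^ ((flipBit u (flipBit v x) p.1 : ℕ) * (flipBit u (flipBit v x) p.2 : ℕ))) =
      if p = (u, v) then -1 else 1 := by
    rintro ⟨a, b⟩ hab
    have hsq : ∀ r s : ℕ, ((-1 : ℝ) ^ r * (-1) ^ r) * ((-1) ^ s * (-1) ^ s) = 1 := by
      intro r s
      simp [← mul_pow]
    split_ifs with h
    · obtain ⟨rfl, rfl⟩ := Prod.mk.inj h
      simp only [flip_self, flip_of_ne huv.ne, flip_of_ne huv.ne']
      generalize x a = s
      generalize x b = t
      fin_cases s <;> fin_cases t <;> simp [show (1 + 1 : Fin 2) = 0 from rfl]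
    · by_cases hu : a ≠ u ∧ b ≠ u
      · simp only [flip_of_ne hu.1, flip_of_ne hu.2, hsq]
      · have hv : a ≠ v ∧ b ≠ v := by
          simp only [Prod.mk.injEq] at h
          simp only at hab
          constructor <;> rintro rfl <;> grind
        have e : ∀ k, k ≠ v → flipBit u (flipBit v x) k = flipBit u x k := by
          intro k hk
          by_cases hku : k = u
          · subst hku; rw [flip_self, flip_self, flip_of_ne hk]
          · rw [flip_of_ne hku, flip_of_ne hku, flip_of_ne hk]
        simp only [e a hv.1, e b hv.2, flip_of_ne hv.1, flip_of_ne hv.2]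
        rw [mul_mul_mul_comm, hsq]
  rw [Finset.prod_congr rfl fun p hp => key p (Finset.mem_filter.1 hp).2.1,
    Finset.prod_ite_eq' _ (u, v) fun _ => (-1 : ℝ)]
  simp [huv]

theorem abs_sum_four_le {a b c d : ℝ} (ha : |a| = 1) (hb : |b| = 1) (hc : |c| = 1) (hd : |d| = 1)
    (h : a * b * (c * d) = -1) : |a + b + (c + d)| ≤ 2 := by
  rcases eq_or_eq_neg_of_abs_eq ha with rfl | rfl <;>
    rcases eq_or_eq_neg_of_abs_eq hb with rfl | rfl <;>
    rcases eq_or_eq_neg_of_abs_eq hc with rfl | rfl <;>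
    rcases eq_or_eq_neg_of_abs_eq hd with rfl | rfl <;>
    (revert h; norm_num)

theorem norm_graphState_dotProduct_le {n : ℕ} {G H : SimpleGraph (Fin n)} (hGH : G ≠ H) :
    ‖star (graphState G) ⬝ᵥ graphState H‖ ≤ 1 / 2 := by
  have hex : ∃ u v : Fin n, u < v ∧ ¬ (G.Adj u v ↔ H.Adj u v) := by
    by_contra hcon
    push Not at hcon
    refine hGH ?_
    ext u v
    rcases lt_trichotomy u v with h | h | h
    · exact hcon u v h
    · simp [h]
    · rw [G.adj_comm, H.adj_comm]; exact hcon v u h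
  obtain ⟨u, v, huv, hne⟩ := hex
  set f : Bits n → ℝ := fun x => graphSign G x * graphSign H x with hf
  have hfabs : ∀ x, |f x| = 1 := fun x => by rw [hf]; simp [abs_mul, abs_graphSign]
  have hf4 : ∀ x, f x * f (flipBit u x) * (f (flipBit v x) * f (flipBit u (flipBit v x))) = -1 := by
    intro x
    have h1 := graphSign_four G huv x
    have h2 := graphSign_four H huv x
    have : f x * f (flipBit u x) * (f (flipBit v x) * f (flipBit u (flipBit v x))) =
      (graphSign G x * graphSign G (flipBit u x) * (graphSign G (flipBit v x) *
        graphSign G (flipBit u (flipBit v x)))) * (graphSign H x * graphSign H (flipBit u x) *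
        (graphSign H (flipBit v x) * graphSign H (flipBit u (flipBit v x)))) := by
      simp only [hf]; ring
    rw [this, h1, h2]
    by_cases hG : G.Adj u v <;> by_cases hH : H.Adj u v <;> simp_all
  have e1 : ∑ x, f (flipBit u x) = ∑ x, f x := Equiv.sum_comp (flipEquiv u) f
  have e2 : ∑ x, f (flipBit v x) = ∑ x, f x := Equiv.sum_comp (flipEquiv v) f
  have e3 : ∑ x, f (flipBit u (flipBit v x)) = ∑ x, f x :=
    (Equiv.sum_comp (flipEquiv v) fun x => f (flipBit u x)).trans e1
  have e4 : 4 * ∑ x, f x =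
      ∑ x, (f x + f (flipBit u x) + (f (flipBit v x) + f (flipBit u (flipBit v x)))) := by
    rw [Finset.sum_add_distrib, Finset.sum_add_distrib, Finset.sum_add_distrib, e1, e2, e3]
    ring
  have h5 : |4 * ∑ x, f x| ≤ 2 ^ n * 2 := by
    rw [e4]
    refine (Finset.abs_sum_le_sum_abs _ _).trans ((Finset.sum_le_sum fun x _ =>
      abs_sum_four_le (hfabs _) (hfabs _) (hfabs _) (hfabs _) (hf4 x)).trans ?_)
    rw [Finset.sum_const, card_bits, nsmul_eq_mul]
    push_cast
    exact le_rfl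
  have e6 : star (graphState G) ⬝ᵥ graphState H = ((1 / 2 ^ n * ∑ x, f x : ℝ) : ℂ) := by
    rw [dotProduct, Finset.mul_sum, Complex.ofReal_sum]
    refine Finset.sum_congr rfl fun x _ => ?_
    have h7 : (1 : ℝ) / √(2 ^ n) * (1 / √(2 ^ n)) = 1 / 2 ^ n := by
      rw [one_div_mul_one_div, Real.mul_self_sqrt (by positivity)]
    rw [Pi.star_apply, graphState_apply, graphState_apply, Complex.star_def, Complex.conj_ofReal,
      ← Complex.ofReal_mul, ← h7]
    congr 1
    simp only [hf]; ring
  rw [e6, Complex.norm_real, Real.norm_eq_abs, abs_mul, abs_of_pos (by positivity),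
    one_div_mul_eq_div, div_le_iff₀ (by positivity)]
  rw [abs_mul, abs_of_pos (by norm_num)] at h5
  linarith

theorem graphState_comp_perm {n : ℕ} {G H : SimpleGraph (Fin n)} (π : Equiv.Perm (Fin n))
    (h : ∀ a b, H.Adj (π a) (π b) ↔ G.Adj a b) (x : Bits n) :
    graphState G (x ∘ π) = graphState H x := by
  classical
  have key : ∀ (σ : Equiv.Perm (Fin n)) (G H : SimpleGraph (Fin n)),
      (∀ a b, H.Adj (σ a) (σ b) ↔ G.Adj a b) → ∀ p : Fin n × Fin n, p.1 < p.2 ∧ G.Adj p.1 p.2 →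
      ((if σ p.1 < σ p.2 then (σ p.1, σ p.2) else (σ p.2, σ p.1)).1 <
        (if σ p.1 < σ p.2 then (σ p.1, σ p.2) else (σ p.2, σ p.1)).2 ∧
      H.Adj (if σ p.1 < σ p.2 then (σ p.1, σ p.2) else (σ p.2, σ p.1)).1
        (if σ p.1 < σ p.2 then (σ p.1, σ p.2) else (σ p.2, σ p.1)).2) ∧
      (if σ.symm (if σ p.1 < σ p.2 then (σ p.1, σ p.2) else (σ p.2, σ p.1)).1 <
          σ.symm (if σ p.1 < σ p.2 then (σ p.1, σ p.2) else (σ p.2, σ p.1)).2 then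
        (σ.symm (if σ p.1 < σ p.2 then (σ p.1, σ p.2) else (σ p.2, σ p.1)).1,
          σ.symm (if σ p.1 < σ p.2 then (σ p.1, σ p.2) else (σ p.2, σ p.1)).2) else
        (σ.symm (if σ p.1 < σ p.2 then (σ p.1, σ p.2) else (σ p.2, σ p.1)).2,
          σ.symm (if σ p.1 < σ p.2 then (σ p.1, σ p.2) else (σ p.2, σ p.1)).1)) = p := by
    rintro σ G H h ⟨a, b⟩ ⟨hab, hG⟩
    have hne : σ a ≠ σ b := σ.injective.ne hab.ne
    simp only at hab hG ⊢
    by_cases hlt : σ a < σ b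
    · simp [hlt, h, hG, hab]
    · have hlt' : σ b < σ a := lt_of_le_of_ne (not_lt.1 hlt) hne.symm
      simp [hlt, hlt', h, hG.symm, not_lt.2 hab.le]
  rw [graphState_apply, graphState_apply, graphSign, graphSign]
  congr 2
  have h' : ∀ a b, G.Adj (π.symm a) (π.symm b) ↔ H.Adj a b := fun a b => by
    rw [← h, π.apply_symm_apply, π.apply_symm_apply]
  refine Finset.prod_bij'
    (fun p _ => if π p.1 < π p.2 then (π p.1, π p.2) else (π p.2, π p.1))
    (fun p _ => if π.symm p.1 < π.symm p.2 then (π.symm p.1, π.symm p.2)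
      else (π.symm p.2, π.symm p.1)) ?_ ?_ ?_ ?_ ?_
  · intro p hp
    simp only [Finset.mem_filter, Finset.mem_univ, true_and] at hp ⊢
    exact (key π G H h p hp).1
  · intro p hp
    simp only [Finset.mem_filter, Finset.mem_univ, true_and] at hp ⊢
    exact (key π.symm H G h' p hp).1
  · intro p hp
    exact (key π G H h p (by simpa using hp)).2
  · intro p hp
    exact (key π.symm H G h' p (by simpa using hp)).2
  · intro p _
    split_ifs
    · rfl
    · rw [mul_comm]; rfl

theorem qubitPerm_mulVec_graphState {n : ℕ} {G H : SimpleGraph (Fin n)} (π : Equiv.Perm (Fin n))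
    (h : ∀ a b, H.Adj (π a) (π b) ↔ G.Adj a b) :
    qubitPerm π *ᵥ graphState G = graphState H := by
  funext x
  rw [qubitPerm_mulVec_apply, graphState_comp_perm π h]

theorem qubitPerm_mulVec_ketM {n : ℕ} (hn : 2 ≤ n) (π : Equiv.Perm (Fin n)) :
    qubitPerm π *ᵥ ketM n = ketM n := by
  funext x
  rw [qubitPerm_mulVec_apply, ketM_comp_perm hn]

/-! ### Normalization of `a|M⟩ + b|G⟩` -/

theorem normSq_psi {n : ℕ} (hn : 2 ≤ n) (a b : ℝ) (G : SimpleGraph (Fin n)) :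
    normSq (psi a b G) =
      a ^ 2 + b ^ 2 + 2 * (a * b * (star (ketM n) ⬝ᵥ graphState G).re) := by
  have h : star ((a : ℂ) • ketM n) ⬝ᵥ ((b : ℂ) • graphState G) =
      ((a * b : ℝ) : ℂ) * (star (ketM n) ⬝ᵥ graphState G) := by
    simp [star_smul, mul_assoc, mul_left_comm]
  rw [psi, normSq_add, normSq_smul, normSq_smul, isState_ketM hn, isState_graphState, h,
    Complex.re_ofReal_mul, Complex.norm_real, Complex.norm_real, Real.norm_eq_abs,
    Real.norm_eq_abs, sq_abs, sq_abs, mul_one, mul_one]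

theorem eventually_div_pow_le {κ δ : ℝ} (hδ : 0 < δ) {k l : ℕ} (hkl : k < l) :
    ∃ n₀ : ℕ, ∀ n : ℕ, n₀ ≤ n → κ / (n : ℝ) ^ l ≤ δ / (n : ℝ) ^ k := by
  obtain ⟨m, hm⟩ := exists_nat_gt (|κ| / δ)
  refine ⟨m + 1, fun n hn => ?_⟩
  have hn1 : (1 : ℝ) ≤ n := by exact_mod_cast (show 1 ≤ n by omega)
  have hn' : |κ| / δ < n := hm.trans_le (by exact_mod_cast (show m ≤ n by omega))
  rw [div_lt_iff₀ hδ] at hn'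
  rw [div_le_div_iff₀ (by positivity) (by positivity)]
  calc κ * (n : ℝ) ^ k ≤ (n * δ) * n ^ k := by
        gcongr; exact (le_abs_self κ).trans hn'.le
    _ = δ * n ^ (k + 1) := by ring
    _ ≤ δ * n ^ l := by gcongr; exact hkl

theorem eventually_overlap_le {c : ℝ} (hc : 0 < c) (k : ℕ) :
    ∃ n₀ : ℕ, ∀ n : ℕ, n₀ ≤ n → 4 / √((2 : ℝ) ^ n) ≤ c / (n : ℝ) ^ k := by
  have h := tendsto_pow_const_div_const_pow_of_one_lt (2 * k) (one_lt_two (α := ℝ))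
  have h2 := h.eventually (gt_mem_nhds (show (0 : ℝ) < c ^ 2 / 16 by positivity))
  obtain ⟨m, hm⟩ := Filter.eventually_atTop.1 h2
  refine ⟨m + 1, fun n hn => ?_⟩
  have hn1 : (0 : ℝ) < n := by exact_mod_cast (show 0 < n by omega)
  have h3 := hm n (by omega)
  refine le_of_pow_le_pow_left₀ two_ne_zero (by positivity) ?_
  rw [div_pow, div_pow, Real.sq_sqrt (by positivity), ← pow_mul, mul_comm k 2,
    div_le_div_iff₀ (by positivity) (by positivity)]
  rw [div_lt_iff₀ (by positivity)] at h3
  linarith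

theorem eventually_isState_psi_bounds {k₁ k₂ : ℝ} (h1 : 0 < k₁) (h12 : k₁ ≤ k₂) :
    ∃ n₀ : ℕ, ∀ n : ℕ, n₀ ≤ n → ∀ a : ℝ,
      k₁ / (n : ℝ) ^ 22 ≤ 1 - a → 1 - a ≤ k₂ / (n : ℝ) ^ 22 → 100 ≤ n ∧ 1 / 2 ≤ a ∧ a < 1 ∧
      ∀ G : SimpleGraph (Fin n), ∀ b : ℝ, 0 < b → IsState (psi a b G) →
        k₁ / 2 / (n : ℝ) ^ 22 ≤ b ^ 2 ∧ b ^ 2 ≤ 5 * k₂ / (n : ℝ) ^ 22 := by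
  obtain ⟨n₁, hn₁⟩ := eventually_overlap_le (c := √k₁ / 4) (by positivity) 11
  obtain ⟨n₂, hn₂⟩ := eventually_div_pow_le (κ := k₂) (δ := 1 / 2) (by norm_num)
    (show 0 < 22 by norm_num)
  refine ⟨n₁ + n₂ + 100, fun n hn a ha1 ha2 => ?_⟩
  have hnp : (0 : ℝ) < n := by exact_mod_cast (show 0 < n by omega)
  have hη := hn₁ n (by omega)
  have ha3 := hn₂ n (by omega)
  rw [pow_zero, div_one] at ha3
  have ha0 : 1 / 2 ≤ a := by linarith
  have hk1 : 0 < k₁ / (n : ℝ) ^ 22 := by positivity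
  refine ⟨by omega, ha0, by linarith, fun G b hb hst => ?_⟩
  set η := 4 / √((2 : ℝ) ^ n)
  have hη0 : 0 ≤ η := by positivity
  set g := (star (ketM n) ⬝ᵥ graphState G).re
  have hg : |g| ≤ η := (Complex.abs_re_le_norm _).trans (norm_ketM_graphState_le (by omega) G)
  have hη2 : η ^ 2 ≤ k₁ / (n : ℝ) ^ 22 / 16 := by
    have := pow_le_pow_left₀ hη0 hη 2
    rw [div_pow _ ((n : ℝ) ^ 11), div_pow √k₁, Real.sq_sqrt h1.le, ← pow_mul] at this
    norm_num at this
    linarith [show k₁ / 16 / (n : ℝ) ^ 22 = k₁ / (n : ℝ) ^ 22 / 16 by ring]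
  have e : a ^ 2 + b ^ 2 + 2 * (a * b * g) = 1 := by rw [← normSq_psi (by omega)]; exact hst
  have habg : |a * b * g| ≤ b * η := by
    rw [abs_mul, abs_of_nonneg (by positivity)]
    have := mul_le_mul_of_nonneg_left hg hb.le
    nlinarith [abs_nonneg g, mul_nonneg hb.le (abs_nonneg g)]
  obtain ⟨hl, hu⟩ := abs_le.1 habg
  have hk2 : 5 * k₂ / (n : ℝ) ^ 22 = 5 * (k₂ / (n : ℝ) ^ 22) := by ring
  have hk3 : k₁ / 2 / (n : ℝ) ^ 22 = k₁ / (n : ℝ) ^ 22 / 2 := by ring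
  rw [hk2, hk3]
  constructor
  · nlinarith [sq_nonneg (b / 2 - 2 * η)]
  · have := div_le_div_of_nonneg_right h12 (show (0 : ℝ) ≤ (n : ℝ) ^ 22 by positivity)
    nlinarith [sq_nonneg (b - 2 * η)]

theorem psi_normalization {k₁ k₂ : ℝ} (h1 : 0 < k₁) (h12 : k₁ ≤ k₂) :
    ∃ l₁ l₂ : ℝ, 0 < l₁ ∧ 0 < l₂ ∧ ∃ n₀ : ℕ, ∀ n : ℕ, n₀ ≤ n → ∀ a : ℝ,
      k₁ / (n : ℝ) ^ 22 ≤ 1 - a → 1 - a ≤ k₂ / (n : ℝ) ^ 22 → ∀ G : SimpleGraph (Fin n),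
        (∃! b : ℝ, 0 < b ∧ IsState (psi a b G)) ∧
        ∀ b : ℝ, 0 < b → IsState (psi a b G) →
          l₁ / (n : ℝ) ^ 11 ≤ b ∧ b ≤ l₂ / (n : ℝ) ^ 11 := by
  obtain ⟨n₀, hn₀⟩ := eventually_isState_psi_bounds h1 h12
  have h2 : 0 < k₂ := h1.trans_le h12
  refine ⟨√(k₁ / 2), √(5 * k₂), by positivity, by positivity, n₀, fun n hn a ha1 ha2 G => ?_⟩
  obtain ⟨hn100, ha, ha', hb⟩ := hn₀ n hn a ha1 ha2
  have hnp : (0 : ℝ) < n := by exact_mod_cast (show 0 < n by omega)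
  refine ⟨?_, fun b hb0 hst => ?_⟩
  · have hiff : ∀ b, IsState (psi a b G) ↔
        a ^ 2 + b ^ 2 + 2 * (a * b * (star (ketM n) ⬝ᵥ graphState G).re) = 1 := fun b => by
      rw [IsState, normSq_psi (by omega)]
    simp only [hiff]
    set g := (star (ketM n) ⬝ᵥ graphState G).re
    have hpos : 0 < 1 - a ^ 2 := by nlinarith
    have hs := Real.sq_sqrt (show 0 ≤ (a * g) ^ 2 + (1 - a ^ 2) by positivity)
    have hlt : |a * g| < √((a * g) ^ 2 + (1 - a ^ 2)) := by
      rw [← Real.sqrt_sq_eq_abs]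
      exact Real.sqrt_lt_sqrt (by positivity) (by linarith)
    refine ⟨√((a * g) ^ 2 + (1 - a ^ 2)) - a * g, ⟨?_, ?_⟩, ?_⟩
    · linarith [le_abs_self (a * g)]
    · linear_combination hs
    · rintro b ⟨hb0, hb1⟩
      have h3 : b + 2 * (a * g) > 0 := by
        by_contra hcon
        push Not at hcon
        nlinarith
      have h4 : (b + a * g) ^ 2 = (a * g) ^ 2 + (1 - a ^ 2) := by linear_combination hb1
      have h5 : 0 ≤ b + a * g := by linarith
      rw [← h4, Real.sqrt_sq h5]
      ring
  · obtain ⟨h3, h4⟩ := hb G b hb0 hst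
    constructor
    · refine le_of_pow_le_pow_left₀ two_ne_zero hb0.le ?_
      rwa [div_pow, Real.sq_sqrt (by positivity), ← pow_mul]
    · refine le_of_pow_le_pow_left₀ two_ne_zero (by positivity) ?_
      rwa [div_pow, Real.sq_sqrt (by positivity), ← pow_mul]

/-! ### Clifford operators that almost map one state `a|M⟩ + b|G⟩` to another -/

theorem braket_psi {n : ℕ} (a₁ b₁ a₂ b₂ : ℝ) (G₁ G₂ : SimpleGraph (Fin n)) (C : Op n) :
    braket (psi a₁ b₁ G₁) C (psi a₂ b₂ G₂) =
      ((a₁ * a₂ : ℝ) : ℂ) * braket (ketM n) C (ketM n) +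
      ((a₁ * b₂ : ℝ) : ℂ) * braket (ketM n) C (graphState G₂) +
      ((b₁ * a₂ : ℝ) : ℂ) * braket (graphState G₁) C (ketM n) +
      ((b₁ * b₂ : ℝ) : ℂ) * braket (graphState G₁) C (graphState G₂) := by
  simp only [psi, braket_add_left, braket_add_right, braket_smul_left, braket_smul_right,
    Complex.star_def, Complex.conj_ofReal, Complex.ofReal_mul]
  ring

theorem eventually_isQubitPerm_of_braket_psi {k₁ k₂ : ℝ} (h1 : 0 < k₁) (h12 : k₁ ≤ k₂) (c : ℝ) :
    ∃ n₀ : ℕ, ∀ n : ℕ, n₀ ≤ n → ∀ a₁ a₂ b₁ b₂ : ℝ,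
      k₁ / (n : ℝ) ^ 22 ≤ 1 - a₁ → 1 - a₁ ≤ k₂ / (n : ℝ) ^ 22 →
      k₁ / (n : ℝ) ^ 22 ≤ 1 - a₂ → 1 - a₂ ≤ k₂ / (n : ℝ) ^ 22 → 0 < b₁ → 0 < b₂ →
      ∀ G₁ G₂ : SimpleGraph (Fin n), IsState (psi a₁ b₁ G₁) → IsState (psi a₂ b₂ G₂) →
      ∀ C ∈ cliffordGroup n,
        1 - c / (n : ℝ) ^ 22 ≤ (braket (psi a₁ b₁ G₁) C (psi a₂ b₂ G₂)).re → IsQubitPerm C := by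
  obtain ⟨n₀, hn₀⟩ := eventually_isState_psi_bounds h1 h12
  obtain ⟨n₁, hn₁⟩ := eventually_div_pow_le (κ := c) (δ := 1 / 4) (by norm_num)
    (show 5 < 22 by norm_num)
  obtain ⟨n₂, hn₂⟩ := eventually_div_pow_le (κ := 5 * k₂) (δ := 1 / 16) (by norm_num)
    (show 10 < 22 by norm_num)
  refine ⟨n₀ + n₁ + n₂, fun n hn a₁ a₂ b₁ b₂ ha1 ha1' ha2 ha2' hb1 hb2 G₁ G₂ hs1 hs2 C hC h => ?_⟩
  obtain ⟨hn100, h3, h4, h5⟩ := hn₀ n (by omega) a₁ ha1 ha1'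
  obtain ⟨-, h6, h7, h8⟩ := hn₀ n (by omega) a₂ ha2 ha2'
  have hn' : (100 : ℝ) ≤ n := by exact_mod_cast hn100
  have h9 := hn₁ n (by omega)
  have h10 := hn₂ n (by omega)
  have hsmall : ∀ b : ℝ, 0 < b → b ^ 2 ≤ 5 * k₂ / (n : ℝ) ^ 22 → b ≤ 1 / 4 / (n : ℝ) ^ 5 := by
    intro b _ hb
    refine le_of_pow_le_pow_left₀ two_ne_zero (by positivity) ?_
    rw [div_pow, ← pow_mul]
    norm_num at h10 ⊢
    exact hb.trans h10
  have hβ1 := hsmall b₁ hb1 (h5 G₁ b₁ hb1 hs1).2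
  have hβ2 := hsmall b₂ hb2 (h8 G₂ b₂ hb2 hs2).2
  refine isQubitPerm_of_braket_ketM hn100 hC ?_
  have hM := isState_ketM (show 2 ≤ n by omega)
  have hle : ∀ (r : ℝ) (z : ℂ), 0 ≤ r → ‖z‖ ≤ 1 → ((r : ℂ) * z).re ≤ r := by
    intro r z hr hz
    rw [Complex.re_ofReal_mul]
    have := (Complex.re_le_norm z).trans hz
    nlinarith
  rw [braket_psi, Complex.add_re, Complex.add_re, Complex.add_re, Complex.re_ofReal_mul] at h
  have t1 := hle (a₁ * b₂) _ (by positivity) (norm_braket_le_one hC.1 hM (isState_graphState G₂))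
  have t2 := hle (b₁ * a₂) _ (by positivity) (norm_braket_le_one hC.1 (isState_graphState G₁) hM)
  have t3 := hle (b₁ * b₂) _ (by positivity)
    (norm_braket_le_one hC.1 (isState_graphState G₁) (isState_graphState G₂))
  set X := (braket (ketM n) C (ketM n)).re
  have hinv : 1 / (n : ℝ) ^ 5 ≤ 1 / 100 ^ 5 := by gcongr
  have hq : 1 / 4 / (n : ℝ) ^ 5 = 1 / (n : ℝ) ^ 5 / 4 := by ring
  rw [hq] at hβ1 hβ2 h9
  have u1 : a₁ * b₂ ≤ b₂ := by nlinarith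
  have u2 : b₁ * a₂ ≤ b₁ := by nlinarith
  have u3 : b₁ * b₂ ≤ b₁ := by nlinarith
  have u4 : a₁ * a₂ ≤ 1 := by nlinarith
  have u5 : 0 < a₁ * a₂ := by positivity
  have h11 : 1 - 1 / (n : ℝ) ^ 5 ≤ a₁ * a₂ * X := by linarith
  have hX : 0 ≤ X := by
    by_contra hcon
    push Not at hcon
    nlinarith
  nlinarith

theorem add_overlaps_lt {a₁ a₂ b₁ b₂ η t : ℝ} (ht : 0 < t) (ha1' : a₁ ≤ 1)
    (ha2 : 0 ≤ a₂) (ha2' : a₂ ≤ 1) (hb1' : b₁ ≤ 1) (hb2 : 0 ≤ b₂) (hb2' : b₂ ≤ 1)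
    (hη : 0 ≤ η) (hηt : η ≤ t / 32) (h1 : a₁ ^ 2 + b₁ ^ 2 ≤ 1 + 2 * η)
    (h2 : a₂ ^ 2 + b₂ ^ 2 ≤ 1 + 2 * η) (h12 : t / 2 ≤ b₁ * b₂) :
    a₁ * a₂ * 1 + a₁ * b₂ * η + b₁ * a₂ * η + b₁ * b₂ * (1 / 2) < 1 - t / 16 := by
  have w1 : a₁ * b₂ * η ≤ 1 * η :=
    mul_le_mul_of_nonneg_right (mul_le_one₀ ha1' hb2 hb2') hη
  have w2 : b₁ * a₂ * η ≤ 1 * η :=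
    mul_le_mul_of_nonneg_right (mul_le_one₀ hb1' ha2 ha2') hη
  have w3 := two_mul_le_add_sq a₁ a₂
  have w4 := two_mul_le_add_sq b₁ b₂
  linarith

theorem eventually_iso_of_braket_psi {k₁ k₂ : ℝ} (h1 : 0 < k₁) (h12 : k₁ ≤ k₂) (c : ℝ) :
    ∃ n₀ : ℕ, ∀ n : ℕ, n₀ ≤ n → ∀ a₁ a₂ b₁ b₂ : ℝ,
      k₁ / (n : ℝ) ^ 22 ≤ 1 - a₁ → 1 - a₁ ≤ k₂ / (n : ℝ) ^ 22 →
      k₁ / (n : ℝ) ^ 22 ≤ 1 - a₂ → 1 - a₂ ≤ k₂ / (n : ℝ) ^ 22 → 0 < b₁ → 0 < b₂ →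
      ∀ G₁ G₂ : SimpleGraph (Fin n), IsState (psi a₁ b₁ G₁) → IsState (psi a₂ b₂ G₂) →
      ∀ C ∈ cliffordGroup n,
        1 - c / (n : ℝ) ^ 23 ≤ (braket (psi a₁ b₁ G₁) C (psi a₂ b₂ G₂)).re →
        IsQubitPerm C ∧ Nonempty (G₁ ≃g G₂) := by
  obtain ⟨n₀, hn₀⟩ := eventually_isState_psi_bounds h1 h12
  obtain ⟨n₁, hn₁⟩ := eventually_isQubitPerm_of_braket_psi h1 h12 1
  obtain ⟨n₂, hn₂⟩ := eventually_div_pow_le (κ := c) (δ := 1) (by norm_num)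
    (show 22 < 23 by norm_num)
  obtain ⟨n₃, hn₃⟩ := eventually_div_pow_le (κ := c) (δ := k₁ / 16) (by positivity)
    (show 22 < 23 by norm_num)
  obtain ⟨n₄, hn₄⟩ := eventually_overlap_le (c := k₁ / 32) (by positivity) 22
  obtain ⟨n₅, hn₅⟩ := eventually_div_pow_le (κ := 5 * k₂) (δ := 1) (by norm_num)
    (show 0 < 22 by norm_num)
  refine ⟨n₀ + n₁ + n₂ + n₃ + n₄ + n₅,
    fun n hn a₁ a₂ b₁ b₂ ha1 ha1' ha2 ha2' hb1 hb2 G₁ G₂ hs1 hs2 C hC h => ?_⟩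
  have hperm := hn₁ n (by omega) a₁ a₂ b₁ b₂ ha1 ha1' ha2 ha2' hb1 hb2 G₁ G₂ hs1 hs2 C hC
    (by have := hn₂ n (by omega); linarith)
  refine ⟨hperm, ?_⟩
  obtain ⟨hn100, h3, h4, h5⟩ := hn₀ n (by omega) a₁ ha1 ha1'
  obtain ⟨-, h6, h7, h8⟩ := hn₀ n (by omega) a₂ ha2 ha2'
  have hn2 : 2 ≤ n := by omega
  have hn' : (100 : ℝ) ≤ n := by exact_mod_cast hn100
  obtain ⟨π, ω, hω, rfl⟩ := hperm
  set H := G₂.map π.toEmbedding with hH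
  have hadj : ∀ a b, H.Adj (π a) (π b) ↔ G₂.Adj a b := fun a b =>
    SimpleGraph.map_adj_apply (f := π.toEmbedding)
  by_cases hG : G₁ = H
  · exact ⟨(hG ▸ (SimpleGraph.Iso.map π G₂) : G₂ ≃g G₁).symm⟩
  exfalso
  set η := 4 / √((2 : ℝ) ^ n) with hη
  have hM := isState_ketM hn2
  have e1 : ‖braket (ketM n) (ω • qubitPerm π) (graphState G₂)‖ ≤ η := by
    rw [braket_smul_op, norm_mul, hω, one_mul, braket, qubitPerm_mulVec_graphState π hadj]
    exact norm_ketM_graphState_le hn2 H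
  have e2 : ‖braket (graphState G₁) (ω • qubitPerm π) (ketM n)‖ ≤ η := by
    rw [braket_smul_op, norm_mul, hω, one_mul, braket, qubitPerm_mulVec_ketM hn2,
      norm_star_dotProduct_comm]
    exact norm_ketM_graphState_le hn2 G₁
  have e3 : ‖braket (graphState G₁) (ω • qubitPerm π) (graphState G₂)‖ ≤ 1 / 2 := by
    rw [braket_smul_op, norm_mul, hω, one_mul, braket, qubitPerm_mulVec_graphState π hadj]
    exact norm_graphState_dotProduct_le hG
  have e0 := norm_braket_le_one hC.1 hM hM
  have hle : ∀ (r t : ℝ) (z : ℂ), 0 ≤ r → ‖z‖ ≤ t → ((r : ℂ) * z).re ≤ r * t := by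
    intro r t z hr hz
    rw [Complex.re_ofReal_mul]
    exact mul_le_mul_of_nonneg_left ((Complex.re_le_norm z).trans hz) hr
  rw [braket_psi, Complex.add_re, Complex.add_re, Complex.add_re] at h
  have t0 := hle (a₁ * a₂) _ _ (by positivity) e0
  have t1 := hle (a₁ * b₂) _ _ (by positivity) e1
  have t2 := hle (b₁ * a₂) _ _ (by positivity) e2
  have t3 := hle (b₁ * b₂) _ _ (by positivity) e3
  have hη0 : 0 ≤ η := by positivity
  have hnorm : ∀ (a b : ℝ) (G : SimpleGraph (Fin n)), 1 / 2 ≤ a → a < 1 → 0 < b →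
      b ^ 2 ≤ 5 * k₂ / (n : ℝ) ^ 22 → IsState (psi a b G) → b ≤ 1 ∧ a ^ 2 + b ^ 2 ≤ 1 + 2 * η := by
    intro a b G ha ha' hb hb2 hst
    have hb1 : b ≤ 1 := by
      have := hn₅ n (by omega)
      rw [pow_zero, div_one] at this
      nlinarith
    refine ⟨hb1, ?_⟩
    rw [IsState, normSq_psi hn2] at hst
    have hg := (Complex.abs_re_le_norm _).trans (norm_ketM_graphState_le hn2 G)
    have hg' := (abs_le.1 hg).1
    have hab : a * b ≤ 1 := by nlinarith
    have hab0 : 0 ≤ a * b := by positivity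
    nlinarith
  obtain ⟨hb1', hq1⟩ := hnorm a₁ b₁ G₁ h3 h4 hb1 (h5 G₁ b₁ hb1 hs1).2 hs1
  obtain ⟨hb2', hq2⟩ := hnorm a₂ b₂ G₂ h6 h7 hb2 (h8 G₂ b₂ hb2 hs2).2 hs2
  have hlow : k₁ / 2 / (n : ℝ) ^ 22 ≤ b₁ * b₂ := by
    have q1 := (h5 G₁ b₁ hb1 hs1).1
    have q2 := (h8 G₂ b₂ hb2 hs2).1
    refine le_of_pow_le_pow_left₀ two_ne_zero (by positivity) ?_
    rw [mul_pow, sq (k₁ / 2 / (n : ℝ) ^ 22)]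
    exact mul_le_mul q1 q2 (by positivity) (by positivity)
  have w3 := hn₃ n (by omega)
  have w4 := hn₄ n (by omega)
  have hpos : 0 < k₁ / (n : ℝ) ^ 22 := by positivity
  rw [show k₁ / 16 / (n : ℝ) ^ 22 = k₁ / (n : ℝ) ^ 22 / 16 by ring] at w3
  rw [show k₁ / 32 / (n : ℝ) ^ 22 = k₁ / (n : ℝ) ^ 22 / 32 by ring] at w4
  rw [show k₁ / 2 / (n : ℝ) ^ 22 = k₁ / (n : ℝ) ^ 22 / 2 by ring] at hlow
  have := add_overlaps_lt hpos h4.le (by linarith) h7.le hb1' hb2.le hb2'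
    hη0 w4 hq1 hq2 hlow
  linarith

theorem psi_eq_qubitPerm_mulVec {n : ℕ} (hn : 2 ≤ n) (a b : ℝ) {G₁ G₂ : SimpleGraph (Fin n)}
    (e : G₁ ≃g G₂) : psi a b G₁ = qubitPerm e.toEquiv.symm *ᵥ psi a b G₂ := by
  rw [psi, psi, Matrix.mulVec_add, Matrix.mulVec_smul, Matrix.mulVec_smul,
    qubitPerm_mulVec_ketM hn, qubitPerm_mulVec_graphState (H := G₁)]
  intro u v
  exact e.symm.map_adj_iff

theorem star_dotProduct_graphState_congr {n : ℕ} (hn : 2 ≤ n) {G₁ G₂ : SimpleGraph (Fin n)}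
    (e : G₁ ≃g G₂) : star (ketM n) ⬝ᵥ graphState G₁ = star (ketM n) ⬝ᵥ graphState G₂ := by
  have h : ∀ x, graphState G₂ (x ∘ e.toEquiv.symm) = graphState G₁ x :=
    graphState_comp_perm e.toEquiv.symm fun u v => e.symm.map_adj_iff
  simp only [dotProduct, Pi.star_apply, ← h]
  symm
  refine Fintype.sum_equiv (Equiv.arrowCongr e.toEquiv.symm (Equiv.refl (Fin 2))) _ _ fun x => ?_
  have : (Equiv.arrowCongr e.toEquiv.symm (Equiv.refl (Fin 2))) x ∘ e.toEquiv.symm = x := by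
    funext k; exact congrArg x (e.apply_symm_apply k)
  have h2 : ketM n ((Equiv.arrowCongr e.toEquiv.symm (Equiv.refl (Fin 2))) x) = ketM n x :=
    ketM_comp_perm hn x e.toEquiv
  rw [this, h2]

/-! ### Programs with counters, an input tape and an output tape -/

/-- The counters of a program. -/
inductive Ctr : Type
  | a | b | x | i | d | t
  deriving DecidableEq

instance : Fintype Ctr := ⟨{.a, .b, .x, .i, .d, .t}, fun c => by cases c <;> decide⟩

/-- The memory of a program: six counters, the unread input, and the output, which is written from
its end to its beginning. -/
structure Mem : Type where
  a : ℕ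
  b : ℕ
  x : ℕ
  i : ℕ
  d : ℕ
  t : ℕ
  inp : List Bool
  out : List Sym

/-- The value of a counter. -/
def Mem.get (m : Mem) : Ctr → ℕ
  | .a => m.a
  | .b => m.b
  | .x => m.x
  | .i => m.i
  | .d => m.d
  | .t => m.t

/-- Setting a counter. -/
def Mem.set (m : Mem) (v : ℕ) : Ctr → Mem
  | .a => { m with a := v }
  | .b => { m with b := v }
  | .x => { m with x := v }
  | .i => { m with i := v }
  | .d => { m with d := v }
  | .t => { m with t := v }

/-- Elementary operations. -/
inductive Op' : Type
  | inc (c : Ctr)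
  | dec (c : Ctr)
  | emit (y : Sym)
  | read
  | nop

/-- The effect of an operation. The flag tells whether a decremented counter was positive, or
whether the bit read from the input is `true`. -/
def Op'.act : Op' → Mem → Bool × Mem
  | .inc c, m => (false, m.set (m.get c + 1) c)
  | .dec c, m => (decide (0 < m.get c), m.set (m.get c - 1) c)
  | .emit y, m => (false, { m with out := y :: m.out })
  | .read, m => (m.inp.head?.getD false, { m with inp := m.inp.tail })
  | .nop, m => (false, m)

/-- Structured programs. -/
inductive Prog : Type
  | op (o : Op')
  | seq (p q : Prog)
  | whl (o : Op') (p : Prog)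
  | ifr (o : Op') (p : Prog)

/-- `Runs p m m' t`: started with the memory `m`, the program `p` stops after `t` steps with the
memory `m'`. -/
inductive Runs : Prog → Mem → Mem → ℕ → Prop
  | op (o : Op') (m : Mem) : Runs (.op o) m (o.act m).2 1
  | seq {p q : Prog} {m₁ m₂ m₃ : Mem} {s t : ℕ} : Runs p m₁ m₂ s → Runs q m₂ m₃ t →
      Runs (.seq p q) m₁ m₃ (s + t)
  | whl_done {o : Op'} {p : Prog} {m : Mem} : (o.act m).1 = false →
      Runs (.whl o p) m (o.act m).2 1
  | whl_step {o : Op'} {p : Prog} {m₁ m₂ m₃ : Mem} {s t : ℕ} : (o.act m₁).1 = true →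
      Runs p (o.act m₁).2 m₂ s → Runs (.whl o p) m₂ m₃ t → Runs (.whl o p) m₁ m₃ (1 + s + t)
  | ifr_false {o : Op'} {p : Prog} {m : Mem} : (o.act m).1 = false →
      Runs (.ifr o p) m (o.act m).2 1
  | ifr_true {o : Op'} {p : Prog} {m₁ m₂ : Mem} {s : ℕ} : (o.act m₁).1 = true →
      Runs p (o.act m₁).2 m₂ s → Runs (.ifr o p) m₁ m₂ (1 + s)

/-! ### Compilation to stack machines -/

/-- The stacks of the machine: input, output, and one for each counter. -/
abbrev Stk : Type := Option (Option Ctr)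

/-- The alphabets of the stacks. -/
def StkSym : Stk → Type
  | none => Bool
  | some none => Sym
  | some (some _) => Unit

/-- The contents of the stacks. -/
def Mem.stk (m : Mem) : ∀ k, List (StkSym k)
  | none => m.inp
  | some none => m.out
  | some (some c) => List.replicate (m.get c) ()

/-- The labels of the machine for a program. -/
def Lbl : Prog → Type
  | .op _ => Unit
  | .seq p q => Lbl p ⊕ Lbl q
  | .whl _ p => Option (Lbl p)
  | .ifr _ p => Option (Lbl p)

instance Lbl.fintype : ∀ p, Fintype (Lbl p)
  | .op _ => inferInstanceAs (Fintype Unit)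
  | .seq p q => @instFintypeSum _ _ (Lbl.fintype p) (Lbl.fintype q)
  | .whl _ p => @instFintypeOption _ (Lbl.fintype p)
  | .ifr _ p => @instFintypeOption _ (Lbl.fintype p)

/-- The label at which a program starts. -/
def Lbl.start : ∀ p, Lbl p
  | .op _ => ()
  | .seq p _ => Sum.inl (Lbl.start p)
  | .whl _ _ => none
  | .ifr _ _ => none

open Turing.TM2 in
/-- An operation, followed by a statement. The flag is stored in the internal state. -/
def Op'.stmt {L : Type} : Op' → Stmt StkSym L Bool → Stmt StkSym L Bool
  | .inc c, q => .push (some (some c)) (fun _ => ()) (.load (fun _ => false) q)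
  | .dec c, q => .pop (some (some c)) (fun _ r => Option.isSome r) q
  | .emit y, q => .push (some none) (fun _ => y) (.load (fun _ => false) q)
  | .read, q => .pop none (fun _ r => Option.getD (α := Bool) r false) q
  | .nop, q => .load (fun _ => false) q

open Turing.TM2 in
/-- The statements of the machine for a program that is embedded in a larger one. -/
def Prog.code {L : Type} : ∀ p : Prog, (Lbl p → L) → L → Lbl p → Stmt StkSym L Bool
  | .op o, _, e, _ => o.stmt (.load (fun _ => false) (.goto fun _ => e))
  | .seq p q, f, e, l => Sum.elim
      (Prog.code p (fun l => f (Sum.inl l)) (f (Sum.inr (Lbl.start q))))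
      (Prog.code q (fun l => f (Sum.inr l)) e) l
  | .whl o p, f, e, l => Option.elim l
      (o.stmt (.branch id (.load (fun _ => false) (.goto fun _ => f (some (Lbl.start p))))
        (.goto fun _ => e)))
      (Prog.code p (fun l => f (some l)) (f none))
  | .ifr o p, f, e, l => Option.elim l
      (o.stmt (.branch id (.load (fun _ => false) (.goto fun _ => f (some (Lbl.start p))))
        (.goto fun _ => e)))
      (Prog.code p (fun l => f (some l)) e)

theorem stk_set (m : Mem) (v : ℕ) (c : Ctr) : (m.set v c).stk =
    Function.update m.stk (some (some c)) (List.replicate v ()) := by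
  funext k
  rcases k with _ | _ | k
  · cases c <;> rfl
  · cases c <;> rfl
  · by_cases h : k = c
    · subst h
      rw [Function.update_self]
      cases k <;> rfl
    · rw [Function.update_of_ne (by simpa using h)]
      cases c <;> cases k <;> first | rfl | exact absurd rfl h

theorem stepAux_stmt {L : Type} (o : Op') (q : Turing.TM2.Stmt StkSym L Bool) (v : Bool)
    (m : Mem) : Turing.TM2.stepAux (o.stmt q) v m.stk =
      Turing.TM2.stepAux q (o.act m).1 (o.act m).2.stk := by
  cases o with
  | inc c =>
    simp only [Op'.stmt, Turing.TM2.stepAux, Op'.act, stk_set]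
    rfl
  | dec c =>
    simp only [Op'.stmt, Turing.TM2.stepAux, Op'.act, stk_set]
    have h : m.stk (some (some c)) = List.replicate (m.get c) () := rfl
    rw [h]
    rcases m.get c with _ | n
    · rfl
    · rfl
  | emit y =>
    simp only [Op'.stmt, Turing.TM2.stepAux, Op'.act]
    congr 1
    funext k
    rcases k with _ | _ | k <;> rfl
  | read =>
    simp only [Op'.stmt, Turing.TM2.stepAux, Op'.act]
    congr 1
    funext k
    rcases k with _ | _ | k <;> rfl
  | nop => rfl

/-- Configurations that are reached after `t` steps. -/
def StepsTo {L : Type} (M : L → Turing.TM2.Stmt StkSym L Bool)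
    (c c' : Turing.TM2.Cfg StkSym L Bool) (t : ℕ) : Prop :=
  (flip bind (Turing.TM2.step M))^[t] (some c) = some c'

theorem StepsTo.trans {L : Type} {M : L → Turing.TM2.Stmt StkSym L Bool}
    {c₁ c₂ c₃ : Turing.TM2.Cfg StkSym L Bool} {s t : ℕ} (h : StepsTo M c₁ c₂ s)
    (h' : StepsTo M c₂ c₃ t) : StepsTo M c₁ c₃ (s + t) := by
  rw [StepsTo] at *
  rw [add_comm, Function.iterate_add_apply, h, h']

theorem StepsTo.single {L : Type} {M : L → Turing.TM2.Stmt StkSym L Bool} (l : L) (v : Bool)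
    (S : ∀ k, List (StkSym k)) :
    StepsTo M ⟨some l, v, S⟩ (Turing.TM2.stepAux (M l) v S) 1 := rfl

theorem stepsTo_test {L : Type} {M : L → Turing.TM2.Stmt StkSym L Bool} {o : Op'} {l l₁ l₂ : L}
    (m : Mem) (h : M l = o.stmt (.branch id (.load (fun _ => false) (.goto fun _ => l₁))
      (.goto fun _ => l₂))) :
    StepsTo M ⟨some l, false, m.stk⟩
      ⟨some (bif (o.act m).1 then l₁ else l₂), false, (o.act m).2.stk⟩ 1 := by
  have := StepsTo.single (M := M) l false m.stk
  rw [h, stepAux_stmt, Turing.TM2.stepAux] at this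
  cases ho : (o.act m).1 <;> rw [ho] at this <;> exact this

theorem Runs.stepsTo {p : Prog} {m m' : Mem} {t : ℕ} (h : Runs p m m' t) {L : Type}
    {M : L → Turing.TM2.Stmt StkSym L Bool} {f : Lbl p → L} {e : L}
    (hM : ∀ l, M (f l) = p.code f e l) :
    StepsTo M ⟨some (f (Lbl.start p)), false, m.stk⟩ ⟨some e, false, m'.stk⟩ t := by
  induction h generalizing e with
  | op o m =>
    have h0 : M (f (Lbl.start (.op o))) = o.stmt (.load (fun _ => false) (.goto fun _ => e)) :=
      hM _
    have := StepsTo.single (M := M) (f (Lbl.start (.op o))) false m.stk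
    rw [h0, stepAux_stmt] at this
    exact this
  | @seq p q m₁ m₂ m₃ s t _ _ ih₁ ih₂ =>
    exact (ih₁ (f := fun l => f (Sum.inl l)) (e := f (Sum.inr (Lbl.start q)))
      fun l => hM (Sum.inl l)).trans
      (ih₂ (f := fun l => f (Sum.inr l)) fun l => hM (Sum.inr l))
  | @whl_done o p m ho =>
    have := stepsTo_test (M := M) m (hM (Lbl.start (.whl o p)))
    rw [ho] at this
    exact this
  | @whl_step o p m₁ m₂ m₃ s t ho _ _ ih₁ ih₂ =>
    have := stepsTo_test (M := M) m₁ (hM (Lbl.start (.whl o p)))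
    rw [ho] at this
    refine (this.trans ?_).trans (ih₂ hM)
    exact ih₁ (f := fun l => f (some l)) (e := f (Lbl.start (.whl o p))) fun l => hM (some l)
  | @ifr_false o p m ho =>
    have := stepsTo_test (M := M) m (hM (Lbl.start (.ifr o p)))
    rw [ho] at this
    exact this
  | @ifr_true o p m₁ m₂ s ho _ ih =>
    have := stepsTo_test (M := M) m₁ (hM (Lbl.start (.ifr o p)))
    rw [ho] at this
    exact this.trans (ih (f := fun l => f (some l)) fun l => hM (some l))

/-- The machine that runs a program. -/
def Prog.machine (p : Prog) : Turing.FinTM2 where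
  K := Stk
  k₀ := none
  k₁ := some none
  Γ := StkSym
  Λ := Option (Lbl p)
  main := some (Lbl.start p)
  σ := Bool
  initialState := false
  Γk₀Fin := inferInstanceAs (Fintype Bool)
  m l := Option.elim l .halt (p.code some none)

/-- The memory at the beginning. -/
def Mem.init (w : List Bool) : Mem := ⟨0, 0, 0, 0, 0, 0, w, []⟩

/-- The memory at the end. -/
def Mem.final (w : List Sym) : Mem := ⟨0, 0, 0, 0, 0, 0, [], w⟩

theorem initList_machine (p : Prog) (w : List Bool) : Turing.initList p.machine w =
    ⟨some (some (Lbl.start p)), false, (Mem.init w).stk⟩ := by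
  unfold Turing.initList
  congr 1
  funext k
  rcases k with _ | _ | k
  · rfl
  · rfl
  · cases k <;> rfl

theorem haltList_machine (p : Prog) (w : List Sym) : Turing.haltList p.machine w =
    ⟨none, false, (Mem.final w).stk⟩ := by
  unfold Turing.haltList
  congr 1
  funext k
  rcases k with _ | _ | k
  · rfl
  · rfl
  · cases k <;> rfl

theorem Runs.outputsInTime {p : Prog} {v : List Bool} {w : List Sym} {t : ℕ}
    (h : Runs p (Mem.init v) (Mem.final w) t) {T : ℕ} (hT : t + 1 ≤ T) :
    Nonempty (Turing.TM2OutputsInTime p.machine v (some w) T) := by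
  have h1 := h.stepsTo (M := p.machine.m) (f := some) (e := none) fun l => rfl
  have h2 := h1.trans (StepsTo.single none false _)
  refine ⟨⟨⟨t + 1, ?_⟩, hT⟩⟩
  have h3 : (flip bind p.machine.step)^[t + 1]
      (some (⟨some (some (Lbl.start p)), false, (Mem.init v).stk⟩ : p.machine.Cfg)) =
      some (⟨none, false, (Mem.final w).stk⟩ : p.machine.Cfg) := h2
  exact (congrArg (fun c => (flip bind p.machine.step)^[t + 1] (some c))
    (initList_machine p v)).trans (h3.trans (congrArg some (haltList_machine p w).symm))

theorem polyTimeReduces_of_runs {A B : Type} {encA : A → List Bool} {encB : B → List Sym}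
    {P : PromiseProblem A} {Q : PromiseProblem B} (p : Prog) (f : A → B) (T : Polynomial ℕ)
    (hrun : ∀ x, ∃ t ≤ T.eval (encA x).length,
      Runs p (Mem.init (encA x)) (Mem.final (encB (f x))) t)
    (hyes : ∀ x, P.yes x → Q.yes (f x)) (hno : ∀ x, P.no x → Q.no (f x)) :
    PolyTimeReduces encA encB P Q := by
  refine ⟨f, ⟨⟨⟨p.machine, Equiv.refl Bool, Equiv.refl Sym⟩, T + 1, fun x => ?_⟩⟩, hyes, hno⟩
  refine Classical.choice ?_
  obtain ⟨t, ht, h⟩ := hrun x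
  have := h.outputsInTime (T := (T + 1).eval (encA x).length) (by simpa using ht)
  have key : ∀ v w, v = encA x → w = encB (f x) → Nonempty
      (Turing.TM2OutputsInTime p.machine v (some w) ((T + 1).eval (encA x).length)) := by
    rintro _ _ rfl rfl
    exact this
  exact key _ _ (List.map_id _) (List.map_id _)

/-! ### Running times -/

/-- The program stops after at most `T` steps. -/
def RunsLE (p : Prog) (m m' : Mem) (T : ℕ) : Prop := ∃ t ≤ T, Runs p m m' t

theorem RunsLE.mono {p : Prog} {m m' : Mem} {T T' : ℕ} (h : RunsLE p m m' T) (hT : T ≤ T') :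
    RunsLE p m m' T' :=
  let ⟨t, ht, hr⟩ := h
  ⟨t, ht.trans hT, hr⟩

theorem RunsLE.op (o : Op') (m : Mem) : RunsLE (.op o) m (o.act m).2 1 := ⟨1, le_rfl, .op o m⟩

theorem RunsLE.seq {p q : Prog} {m₁ m₂ m₃ : Mem} {S T : ℕ} (h : RunsLE p m₁ m₂ S)
    (h' : RunsLE q m₂ m₃ T) : RunsLE (.seq p q) m₁ m₃ (S + T) :=
  let ⟨_, hs, hr⟩ := h
  let ⟨_, ht, hr'⟩ := h'
  ⟨_, add_le_add hs ht, .seq hr hr'⟩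

theorem RunsLE.ifr_false {o : Op'} {p : Prog} {m m' : Mem} (h : o.act m = (false, m')) :
    RunsLE (.ifr o p) m m' 1 := by
  have h2 : (o.act m).2 = m' := by rw [h]
  exact ⟨1, le_rfl, h2 ▸ .ifr_false (by rw [h])⟩

theorem RunsLE.ifr_true {o : Op'} {p : Prog} {m m' m'' : Mem} {T : ℕ} (h : o.act m = (true, m'))
    (hp : RunsLE p m' m'' T) : RunsLE (.ifr o p) m m'' (T + 1) := by
  obtain ⟨t, ht, hr⟩ := hp
  have h2 : (o.act m).2 = m' := by rw [h]
  exact ⟨1 + t, by omega, .ifr_true (by rw [h]) (h2 ▸ hr)⟩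

theorem RunsLE.whl_done {o : Op'} {p : Prog} {m m' : Mem} (h : o.act m = (false, m')) :
    RunsLE (.whl o p) m m' 1 := by
  have h2 : (o.act m).2 = m' := by rw [h]
  exact ⟨1, le_rfl, h2 ▸ .whl_done (by rw [h])⟩

theorem RunsLE.whl_step {o : Op'} {p : Prog} {m₁ m' m₂ m₃ : Mem} {S T : ℕ}
    (h : o.act m₁ = (true, m')) (hp : RunsLE p m' m₂ S) (hw : RunsLE (.whl o p) m₂ m₃ T) :
    RunsLE (.whl o p) m₁ m₃ (S + 1 + T) := by
  obtain ⟨s, hs, hr⟩ := hp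
  obtain ⟨t, ht, hr'⟩ := hw
  have h2 : (o.act m₁).2 = m' := by rw [h]
  exact ⟨1 + s + t, by omega, .whl_step (by rw [h]) (h2 ▸ hr) hr'⟩

/-- A loop with `n` iterations; `f k` is the memory after `k` of them. -/
theorem RunsLE.loop {o : Op'} {p : Prog} (f : ℕ → Mem) {n T : ℕ} {e : Mem}
    (h : ∀ k < n, ∃ m', o.act (f k) = (true, m') ∧ RunsLE p m' (f (k + 1)) T)
    (h0 : o.act (f n) = (false, e)) : RunsLE (.whl o p) (f 0) e (n * (T + 1) + 1) := by
  induction n generalizing f with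
  | zero => simpa using RunsLE.whl_done h0
  | succ n ih =>
    obtain ⟨m', h1, h2⟩ := h 0 (Nat.succ_pos n)
    have h3 := ih (fun k => f (k + 1)) (fun k hk => h (k + 1) (by omega)) h0
    exact (RunsLE.whl_step h1 h2 h3).mono (by ring_nf; omega)

/-! ### Programs that write encodings -/

infixr:60 " ;; " => Prog.seq

theorem Mem.set_get (m : Mem) (c : Ctr) : m.set (m.get c) c = m := by cases c <;> rfl

theorem RunsLE.loop_dec (c : Ctr) {p : Prog} (f : ℕ → Mem) {n T : ℕ} {e : Mem}
    (hpos : ∀ k < n, 0 < (f k).get c)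
    (h : ∀ k < n, RunsLE p ((f k).set ((f k).get c - 1) c) (f (k + 1)) T)
    (he : f n = e) (h0 : e.get c = 0) : RunsLE (.whl (.dec c) p) (f 0) e (n * (T + 1) + 1) := by
  refine RunsLE.loop f (fun k hk => ⟨_, ?_, h k hk⟩) ?_
  · simp [Op'.act, hpos k hk]
  · have : e.set 0 c = e := by rw [← h0]; exact e.set_get c
    simp [Op'.act, he, h0, this]

/-- With the given counters and input, the program writes `w` in front of the output, and changes
nothing else. -/
def Emits (p : Prog) (a b x i d : ℕ) (inp : List Bool) (w : List Sym) (T : ℕ) : Prop :=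
  ∀ out, RunsLE p ⟨a, b, x, i, d, 0, inp, out⟩ ⟨a, b, x, i, d, 0, inp, w ++ out⟩ T

theorem Emits.seq {p q : Prog} {a b x i d : ℕ} {inp : List Bool} {v w : List Sym} {S T : ℕ}
    (h : Emits p a b x i d inp v S) (h' : Emits q a b x i d inp w T) :
    Emits (p ;; q) a b x i d inp (w ++ v) (S + T) := fun out => by
  rw [List.append_assoc]
  exact (h out).seq (h' (v ++ out))

theorem Emits.mono {p : Prog} {a b x i d : ℕ} {inp : List Bool} {w : List Sym} {T T' : ℕ}
    (h : Emits p a b x i d inp w T) (hT : T ≤ T') : Emits p a b x i d inp w T' :=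
  fun out => (h out).mono hT

theorem emits_emit (y : Sym) (a b x i d : ℕ) (inp : List Bool) :
    Emits (.op (.emit y)) a b x i d inp [y] 1 := fun _ => RunsLE.op _ _

/-- Writing a fixed word. -/
def emitWord : List Sym → Prog
  | [] => .op .nop
  | y :: w => emitWord w ;; .op (.emit y)

theorem emits_emitWord (w : List Sym) (a b x i d : ℕ) (inp : List Bool) :
    Emits (emitWord w) a b x i d inp w (w.length + 1) := by
  induction w with
  | nil => exact fun _ => RunsLE.op _ _
  | cons y w ih => exact ih.seq (emits_emit y a b x i d inp)

/-- Writing the value of the counter `i` in ticks. -/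
def ticksI : Prog :=
  .whl (.dec .i) (.op (.emit .tick) ;; .op (.inc .t)) ;; .whl (.dec .t) (.op (.inc .i))

/-- Writing the value of the counter `d` in ticks. -/
def ticksD : Prog :=
  .whl (.dec .d) (.op (.emit .tick) ;; .op (.inc .t)) ;; .whl (.dec .t) (.op (.inc .d))

theorem emits_ticksI (a b x i d : ℕ) (inp : List Bool) :
    Emits ticksI a b x i d inp (List.replicate i .tick) (5 * i + 2) := by
  intro out
  have h1 := RunsLE.loop_dec .i (p := .op (.emit .tick) ;; .op (.inc .t)) (n := i)
    (fun k => ⟨a, b, x, i - k, d, k, inp, List.replicate k .tick ++ out⟩)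
    (fun k hk => Nat.sub_pos_of_lt hk) (fun k _ => (RunsLE.op _ _).seq (RunsLE.op _ _))
    (by rw [Nat.sub_self]) rfl
  have h2 := RunsLE.loop_dec .t (p := .op (.inc .i)) (n := i)
    (fun k => ⟨a, b, x, k, d, i - k, inp, List.replicate i .tick ++ out⟩)
    (fun k hk => Nat.sub_pos_of_lt hk) (fun k _ => RunsLE.op _ _) (by rw [Nat.sub_self]) rfl
  exact (h1.seq h2).mono (by omega)

theorem emits_ticksD (a b x i d : ℕ) (inp : List Bool) :
    Emits ticksD a b x i d inp (List.replicate d .tick) (5 * d + 2) := by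
  intro out
  have h1 := RunsLE.loop_dec .d (p := .op (.emit .tick) ;; .op (.inc .t)) (n := d)
    (fun k => ⟨a, b, x, i, d - k, k, inp, List.replicate k .tick ++ out⟩)
    (fun k hk => Nat.sub_pos_of_lt hk) (fun k _ => (RunsLE.op _ _).seq (RunsLE.op _ _))
    (by rw [Nat.sub_self]) rfl
  have h2 := RunsLE.loop_dec .t (p := .op (.inc .d)) (n := d)
    (fun k => ⟨a, b, x, i, k, d - k, inp, List.replicate d .tick ++ out⟩)
    (fun k hk => Nat.sub_pos_of_lt hk) (fun k _ => RunsLE.op _ _) (by rw [Nat.sub_self]) rfl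
  exact (h1.seq h2).mono (by omega)

/-- Writing the unary encoding of the counter `i`. -/
def unaryI : Prog := .op (.emit .sep) ;; ticksI

/-- Writing the unary encoding of `i + 1 + d`. -/
def unaryJ : Prog := .op (.emit .sep) ;; ticksI ;; .op (.emit .tick) ;; ticksD

theorem emits_unaryI (a b x i d : ℕ) (inp : List Bool) :
    Emits unaryI a b x i d inp (encodeUnary i) (5 * i + 3) :=
  ((emits_emit .sep a b x i d inp).seq (emits_ticksI a b x i d inp)).mono (by omega)

theorem emits_unaryJ (a b x i d : ℕ) (inp : List Bool) :
    Emits unaryJ a b x i d inp (encodeUnary (i + 1 + d)) (5 * (i + 1 + d) + 6) := by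
  have h := (emits_emit .sep a b x i d inp).seq ((emits_ticksI a b x i d inp).seq
    ((emits_emit .tick a b x i d inp).seq (emits_ticksD a b x i d inp)))
  have e : List.replicate d Sym.tick ++ [Sym.tick] ++ List.replicate i Sym.tick ++ [Sym.sep] =
      encodeUnary (i + 1 + d) := by
    rw [encodeUnary, ← List.replicate_one, ← List.replicate_add, ← List.replicate_add]
    congr 2; omega
  rw [← e]
  exact h.mono (by omega)

/-- Writing the head of a list of gates: a gate with the given symbol. -/
def gateHead (u : Prog) (y : Sym) : Prog := u ;; .op (.emit y) ;; .op (.emit .tick)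

theorem Emits.gateHead {u : Prog} {a b x i d : ℕ} {inp : List Bool} {w : List Sym} {T : ℕ}
    (h : Emits u a b x i d inp w T) (y : Sym) :
    Emits (gateHead u y) a b x i d inp (.tick :: y :: w) (T + 2) :=
  h.seq ((emits_emit y a b x i d inp).seq (emits_emit .tick a b x i d inp))

/-- Writing the gates that flip a qubit. -/
def flipHead (u : Prog) : Prog :=
  gateHead u .h ;; gateHead u .s ;; gateHead u .s ;; gateHead u .h

/-- The encoding of the gates that flip a qubit. -/
def flipWord (w : List Sym) : List Sym :=
  .tick :: .h :: w ++ (.tick :: .s :: w ++ (.tick :: .s :: w ++ (.tick :: .h :: w)))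

theorem Emits.flipHead {u : Prog} {a b x i d : ℕ} {inp : List Bool} {w : List Sym} {T : ℕ}
    (h : Emits u a b x i d inp w T) :
    Emits (flipHead u) a b x i d inp (flipWord w) (4 * T + 8) := by
  have := (h.gateHead .h).seq ((h.gateHead .s).seq ((h.gateHead .s).seq (h.gateHead .h)))
  have e : flipWord w = (Sym.tick :: .h :: w) ++ (.tick :: .s :: w) ++ (.tick :: .s :: w) ++
      (.tick :: .h :: w) := by simp [flipWord]
  rw [e]
  exact this.mono (by omega)

/-! ### Loops -/

/-- Copying the counter `a` to `x`. -/
def copyA : Prog :=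
  .whl (.dec .a) (.op (.inc .t) ;; .op (.inc .x)) ;; .whl (.dec .t) (.op (.inc .a))

/-- Copying the counter `b` to `x`. -/
def copyB : Prog :=
  .whl (.dec .b) (.op (.inc .t) ;; .op (.inc .x)) ;; .whl (.dec .t) (.op (.inc .b))

theorem copyA_runs (a b i d : ℕ) (inp : List Bool) (out : List Sym) :
    RunsLE copyA ⟨a, b, 0, i, d, 0, inp, out⟩ ⟨a, b, a, i, d, 0, inp, out⟩ (5 * a + 2) := by
  have h1 := RunsLE.loop_dec .a (p := .op (.inc .t) ;; .op (.inc .x)) (n := a)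
    (fun k => ⟨a - k, b, k, i, d, k, inp, out⟩)
    (fun k hk => Nat.sub_pos_of_lt hk) (fun k _ => (RunsLE.op _ _).seq (RunsLE.op _ _))
    (by rw [Nat.sub_self]) rfl
  have h2 := RunsLE.loop_dec .t (p := .op (.inc .a)) (n := a)
    (fun k => ⟨k, b, a, i, d, a - k, inp, out⟩)
    (fun k hk => Nat.sub_pos_of_lt hk) (fun k _ => RunsLE.op _ _) (by rw [Nat.sub_self]) rfl
  exact (h1.seq h2).mono (by omega)

theorem copyB_runs (a b i d : ℕ) (inp : List Bool) (out : List Sym) :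
    RunsLE copyB ⟨a, b, 0, i, d, 0, inp, out⟩ ⟨a, b, b, i, d, 0, inp, out⟩ (5 * b + 2) := by
  have h1 := RunsLE.loop_dec .b (p := .op (.inc .t) ;; .op (.inc .x)) (n := b)
    (fun k => ⟨a, b - k, k, i, d, k, inp, out⟩)
    (fun k hk => Nat.sub_pos_of_lt hk) (fun k _ => (RunsLE.op _ _).seq (RunsLE.op _ _))
    (by rw [Nat.sub_self]) rfl
  have h2 := RunsLE.loop_dec .t (p := .op (.inc .b)) (n := b)
    (fun k => ⟨a, k, b, i, d, b - k, inp, out⟩)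
    (fun k hk => Nat.sub_pos_of_lt hk) (fun k _ => RunsLE.op _ _) (by rw [Nat.sub_self]) rfl
  exact (h1.seq h2).mono (by omega)

/-- The loop over all `i < j` below `x`, where `j = i + 1 + d`. -/
def pairsLoop (row body : Prog) : Prog :=
  .whl (.dec .x) (row ;; .whl (.dec .x) (body ;; .op (.inc .d)) ;;
    .whl (.dec .d) (.op (.inc .x)) ;; .op (.inc .i)) ;; .whl (.dec .i) (.op .nop)

theorem pairsLoop_runs {row body : Prog} {a b n : ℕ} {S T : ℕ} (inp₀ : ℕ → List Bool)
    (out₀ : ℕ → List Sym) (inp : ℕ → ℕ → List Bool) (out : ℕ → ℕ → List Sym)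
    (hrow : ∀ i < n, RunsLE row ⟨a, b, n - i - 1, i, 0, 0, inp₀ i, out₀ i⟩
      ⟨a, b, n - i - 1, i, 0, 0, inp i 0, out i 0⟩ S)
    (hbody : ∀ i < n, ∀ d < n - i - 1,
      RunsLE body ⟨a, b, n - i - 1 - d - 1, i, d, 0, inp i d, out i d⟩
        ⟨a, b, n - i - 1 - d - 1, i, d, 0, inp i (d + 1), out i (d + 1)⟩ T)
    (hinp : ∀ i < n, inp i (n - i - 1) = inp₀ (i + 1))
    (hout : ∀ i < n, out i (n - i - 1) = out₀ (i + 1)) :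
    RunsLE (pairsLoop row body) ⟨a, b, n, 0, 0, 0, inp₀ 0, out₀ 0⟩
      ⟨a, b, 0, 0, 0, 0, inp₀ n, out₀ n⟩ ((n + 1) ^ 2 * (S + T + 10)) := by
  have h1 := RunsLE.loop_dec .x (n := n) (T := S + (n * (T + 2) + 1 + (n * 2 + 1 + 1)))
    (p := row ;; .whl (.dec .x) (body ;; .op (.inc .d)) ;;
      .whl (.dec .d) (.op (.inc .x)) ;; .op (.inc .i))
    (fun i => ⟨a, b, n - i, i, 0, 0, inp₀ i, out₀ i⟩)
    (fun k hk => Nat.sub_pos_of_lt hk) (fun i hi => ?_) (by rw [Nat.sub_self]) rfl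
  · have h2 := RunsLE.loop_dec .i (p := .op .nop) (n := n)
      (fun k => ⟨a, b, 0, n - k, 0, 0, inp₀ n, out₀ n⟩)
      (fun k hk => Nat.sub_pos_of_lt hk) (fun k _ => RunsLE.op _ _) (by rw [Nat.sub_self]) rfl
    refine (h1.seq h2).mono ?_
    have : (n + 1) ^ 2 * (S + T + 10) =
        n * (S + (n * (T + 2) + 1 + (n * 2 + 1 + 1)) + 1) + 1 + (n * (1 + 1) + 1) +
        (n ^ 2 * (S + 6) + n * (S + 2 * T + 14) + (S + T + 8)) := by ring
    omega
  · have h3 := RunsLE.loop_dec .x (n := n - i - 1) (T := T + 1) (p := body ;; .op (.inc .d))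
      (fun d => ⟨a, b, n - i - 1 - d, i, d, 0, inp i d, out i d⟩)
      (fun k hk => Nat.sub_pos_of_lt hk)
      (fun d hd => (hbody i hi d hd).seq (RunsLE.op _ _)) (by rw [Nat.sub_self]) rfl
    have h4 := RunsLE.loop_dec .d (p := .op (.inc .x)) (n := n - i - 1)
      (fun k => ⟨a, b, k, i, n - i - 1 - k, 0, inp i (n - i - 1), out i (n - i - 1)⟩)
      (fun k hk => Nat.sub_pos_of_lt hk) (fun k _ => RunsLE.op _ _) (by rw [Nat.sub_self]) rfl
    rw [hinp i hi, hout i hi] at h3 h4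
    have h5 : n - i - 1 ≤ n := by omega
    exact ((hrow i hi).seq ((h3.mono (by gcongr)).seq ((h4.mono (by gcongr)).seq
      (RunsLE.op _ _)))).mono le_rfl

/-- The loop over all `i` below `x`. -/
def countLoop (body : Prog) : Prog :=
  .whl (.dec .x) (body ;; .op (.inc .i)) ;; .whl (.dec .i) (.op .nop)

theorem countLoop_runs {body : Prog} {a b n : ℕ} {inp : List Bool} {T : ℕ} (out : ℕ → List Sym)
    (hbody : ∀ i < n, RunsLE body ⟨a, b, n - i - 1, i, 0, 0, inp, out i⟩
      ⟨a, b, n - i - 1, i, 0, 0, inp, out (i + 1)⟩ T) :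
    RunsLE (countLoop body) ⟨a, b, n, 0, 0, 0, inp, out 0⟩ ⟨a, b, 0, 0, 0, 0, inp, out n⟩
      ((n + 1) * (T + 4)) := by
  have h1 := RunsLE.loop_dec .x (n := n) (T := T + 1) (p := body ;; .op (.inc .i))
    (fun i => ⟨a, b, n - i, i, 0, 0, inp, out i⟩)
    (fun k hk => Nat.sub_pos_of_lt hk) (fun i hi => (hbody i hi).seq (RunsLE.op _ _))
    (by rw [Nat.sub_self]) rfl
  have h2 := RunsLE.loop_dec .i (p := .op .nop) (n := n)
    (fun k => ⟨a, b, 0, n - k, 0, 0, inp, out n⟩)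
    (fun k hk => Nat.sub_pos_of_lt hk) (fun k _ => RunsLE.op _ _) (by rw [Nat.sub_self]) rfl
  refine (h1.seq h2).mono ?_
  have : (n + 1) * (T + 4) = n * (T + 1 + 1) + 1 + (n * (1 + 1) + 1) + (T + 2) := by ring
  omega

/-! ### Powers of two -/

/-- Writing nine zeros for each halving of `x`. -/
def halvings : Prog :=
  .whl (.dec .x) (emitWord (List.replicate 9 (.bit false)) ;;
    .whl (.dec .x) (.op (.inc .t) ;; .op (.dec .x)) ;; .whl (.dec .t) (.op (.inc .x)))

theorem halvings_runs (a b i d : ℕ) (inp : List Bool) {c : ℕ} (x : ℕ) (hx : x ≤ c)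
    (out : List Sym) : RunsLE halvings ⟨a, b, x, i, d, 0, inp, out⟩
      ⟨a, b, 0, i, d, 0, inp, List.replicate (9 * x.size) (.bit false) ++ out⟩
      (x * (5 * c + 13) + 1) := by
  induction x using Nat.strong_induction_on generalizing out with
  | _ x ih =>
    rcases Nat.eq_zero_or_pos x with rfl | hpos
    · rw [Nat.size_zero]
      exact (RunsLE.whl_done rfl).mono (by omega)
    · have hsize : x.size = (x / 2).size + 1 := by
        conv_lhs => rw [← Nat.bit_bodd_div2 x]
        rw [Nat.size_bit (by rw [Nat.bit_bodd_div2]; omega), Nat.div2_val]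
      have h0 := emits_emitWord (List.replicate 9 (.bit false)) a b (x - 1) i d inp out
      have h1 := RunsLE.loop_dec .x (p := .op (.inc .t) ;; .op (.dec .x)) (n := x / 2)
        (fun k => ⟨a, b, x - 1 - 2 * k, i, d, k, inp, List.replicate 9 (.bit false) ++ out⟩)
        (e := ⟨a, b, 0, i, d, x / 2, inp, List.replicate 9 (.bit false) ++ out⟩)
        (fun k hk => by simp only [Mem.get]; omega)
        (fun k _ => (RunsLE.op _ _).seq (RunsLE.op _ _))
        (by congr 1; omega) rfl
      have h2 := RunsLE.loop_dec .t (p := .op (.inc .x)) (n := x / 2)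
        (fun k => ⟨a, b, k, i, d, x / 2 - k, inp, List.replicate 9 (.bit false) ++ out⟩)
        (fun k hk => Nat.sub_pos_of_lt hk) (fun k _ => RunsLE.op _ _) (by rw [Nat.sub_self]) rfl
      have h3 := ih (x / 2) (by omega) (by omega) (List.replicate 9 (.bit false) ++ out)
      rw [← List.append_assoc, ← List.replicate_add] at h3
      have h4 := RunsLE.whl_step (o := .dec .x) (m₁ := ⟨a, b, x, i, d, 0, inp, out⟩)
        (m' := ⟨a, b, x - 1, i, d, 0, inp, out⟩) (by simp [Op'.act, Mem.get, Mem.set, hpos])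
        (h0.seq (h1.seq h2)) h3
      rw [hsize, show 9 * ((x / 2).size + 1) = 9 * (x / 2).size + 9 by ring]
      refine h4.mono ?_
      have h5 : (x / 2 + 1) * (5 * c + 13) ≤ x * (5 * c + 13) :=
        Nat.mul_le_mul_right _ (by omega)
      simp only [List.length_replicate]
      have : x / 2 ≤ c := by omega
      nlinarith

/-! ### Lists of summands -/

/-- The qubit with a given number. -/
def wire (N : ℕ) [NeZero N] (i : ℕ) : Fin N := Fin.ofNat N i

theorem wire_val {N : ℕ} [NeZero N] {i : ℕ} (h : i < N) : (wire N i : ℕ) = i := Nat.mod_eq_of_lt h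

/-- Gates that flip a qubit. -/
def flipGates (N : ℕ) [NeZero N] (i : ℕ) : List (Gate N) :=
  [.h (wire N i), .s (wire N i), .s (wire N i), .h (wire N i)]

open Classical in
/-- A controlled `Z`, if the two qubits are different. -/
def czGates (N : ℕ) [NeZero N] (i j : ℕ) : List (Gate N) :=
  if h : wire N i ≠ wire N j then [.cz _ _ h] else []

/-- Four summands for a pair of qubits. -/
def pairTerms (N : ℕ) [NeZero N] (i j : ℕ) : List (Term N) :=
  [⟨1, 1, 0, 1, []⟩, ⟨1, 1, 1, 16, flipGates N i⟩, ⟨1, 1, 1, 16, flipGates N j⟩,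
    ⟨1, 1, 1, 8, flipGates N i ++ flipGates N j⟩]

/-- Prepending lists, the last one in front. -/
def colFold {α : Type} (F : ℕ → List α) (l : List α) : ℕ → List α
  | 0 => l
  | d + 1 => F d ++ colFold F l d

/-- Prepending lists for all `i < j < n`. -/
def rowFold {α : Type} (F : ℕ → ℕ → List α) (n : ℕ) (l : List α) : ℕ → List α
  | 0 => l
  | i + 1 => colFold (fun d => F i (i + 1 + d)) (rowFold F n l i) (n - i - 1)

/-- The controlled `Z` gates for a graph on the first `n` qubits. -/
def edgeGates (N n : ℕ) [NeZero N] (adj : ℕ → ℕ → Bool) : List (Gate N) :=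
  rowFold (fun i j => if adj i j then czGates N i j else []) n [] n

/-- A circuit for a graph state. -/
def graphGates (N n : ℕ) [NeZero N] (adj : ℕ → ℕ → Bool) : List (Gate N) :=
  colFold (fun i => [.h (wire N i)]) (edgeGates N n adj) N

/-- The summand for a graph state. -/
def graphTerm (N n : ℕ) [NeZero N] (adj : ℕ → ℕ → Bool) : Term N :=
  ⟨1, ⟨2 ^ (9 * N.size), by positivity⟩, 0, 1, graphGates N n adj⟩

/-- The list of all summands. -/
def graphTerms (N n : ℕ) [NeZero N] (adj : ℕ → ℕ → Bool) : List (Term N) :=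
  rowFold (pairTerms N) N [graphTerm N n adj] N

/-! ### Writing lists of summands -/

/-- The encoding of the first members of a list. -/
def encodeHead {A : Type} (f : A → List Sym) (l : List A) : List Sym :=
  l.flatMap fun y => .tick :: f y

theorem encodeList_append {A : Type} (f : A → List Sym) (k l : List A) :
    encodeList f (k ++ l) = encodeHead f k ++ encodeList f l := by
  induction k with
  | nil => rfl
  | cons y k ih => simp [encodeList, encodeHead, ih]

theorem encodeList_eq {A : Type} (f : A → List Sym) (l : List A) :
    encodeList f l = encodeHead f l ++ [.sep] := by
  conv_lhs => rw [← List.append_nil l, encodeList_append, encodeList]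

theorem encodeHead_append {A : Type} (f : A → List Sym) (k l : List A) :
    encodeHead f (k ++ l) = encodeHead f k ++ encodeHead f l := by
  simp [encodeHead]

theorem encodeHead_flipGates {N : ℕ} [NeZero N] {i : ℕ} (h : i < N) :
    encodeHead encodeGate (flipGates N i) = flipWord (encodeUnary i) := by
  simp [encodeHead, flipGates, encodeGate, flipWord, wire_val h]

theorem encodeHead_czGates {N : ℕ} [NeZero N] {i j : ℕ} (hi : i < j) (hj : j < N) :
    encodeHead encodeGate (czGates N i j) =
      .tick :: .cz :: (encodeUnary i ++ encodeUnary j) := by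
  have h : wire N i ≠ wire N j := fun h => by
    have := congrArg Fin.val h
    rw [wire_val (hi.trans hj), wire_val hj] at this
    omega
  rw [czGates, dif_pos h]
  simp [encodeHead, encodeGate, wire_val (hi.trans hj), wire_val hj]

/-- The encoding of the coefficient of a summand of modulus `1`. -/
def coeffWord (p q : ℕ) : List Sym :=
  encodeBinary 1 ++ (encodeBinary 1 ++ (encodeBinary p ++ encodeBinary q))

theorem encodeTerm_unit {N : ℕ} (p : ℕ) (q : ℕ+) (g : List (Gate N)) :
    encodeTerm ⟨1, 1, p, q, g⟩ = coeffWord p q ++ encodeList encodeGate g := by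
  simp [encodeTerm, coeffWord]

/-- Writing the head of a list of summands: a summand of modulus `1`, whose gates are written by
the given program. -/
def termHead (g : Prog) (p q : ℕ) : Prog :=
  .op (.emit .sep) ;; g ;; emitWord (.tick :: coeffWord p q)

theorem Emits.termHead {g : Prog} {a b x i d N : ℕ} {inp : List Bool} {T : ℕ} {l : List (Gate N)}
    (h : Emits g a b x i d inp (encodeHead encodeGate l) T) (p : ℕ) (q : ℕ+) :
    Emits (termHead g p q) a b x i d inp (.tick :: encodeTerm ⟨1, 1, p, q, l⟩)
      (T + (coeffWord p q).length + 3) := by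
  have := (emits_emit .sep a b x i d inp).seq
    (h.seq (emits_emitWord (.tick :: coeffWord p q) a b x i d inp))
  rw [encodeTerm_unit, encodeList_eq]
  simp only [List.cons_append, List.append_assoc, List.length_cons] at this ⊢
  exact this.mono (by omega)

/-- Writing the four summands for a pair of qubits. -/
def pairBody : Prog :=
  termHead (flipHead unaryJ ;; flipHead unaryI) 1 8 ;; termHead (flipHead unaryJ) 1 16 ;;
    termHead (flipHead unaryI) 1 16 ;; termHead (.op .nop) 0 1

/-- A bound for the time to write four summands. -/
def pairCost : ℕ := (coeffWord 1 (8 : ℕ+)).length +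
  2 * (coeffWord 1 (16 : ℕ+)).length + (coeffWord 0 (1 : ℕ+)).length + 1000

theorem emits_pairBody {N : ℕ} [NeZero N] {i d : ℕ} (h : i + 1 + d < N) (a b x : ℕ)
    (inp : List Bool) : Emits pairBody a b x i d inp
      (encodeHead encodeTerm (pairTerms N i (i + 1 + d))) (pairCost * (N + 1)) := by
  have hI := (emits_unaryI a b x i d inp).flipHead
  have hJ := (emits_unaryJ a b x i d inp).flipHead
  have hJI := hJ.seq hI
  have h0 : Emits (.op .nop) a b x i d inp [] 1 := fun _ => RunsLE.op _ _
  rw [← encodeHead_flipGates (N := N) (i := i) (by omega),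
    ← encodeHead_flipGates (N := N) h, ← encodeHead_append] at hJI
  rw [← encodeHead_flipGates (N := N) (i := i) (by omega)] at hI
  rw [← encodeHead_flipGates (N := N) h] at hJ
  have h1 := (hJI.termHead 1 8).seq ((hJ.termHead 1 16).seq ((hI.termHead 1 16).seq
    (Emits.termHead (N := N) (l := []) h0 0 1)))
  have e : encodeHead encodeTerm (pairTerms N i (i + 1 + d)) =
      .tick :: encodeTerm (⟨1, 1, 0, 1, []⟩ : Term N) ++
      .tick :: encodeTerm (⟨1, 1, 1, 16, flipGates N i⟩ : Term N) ++
      .tick :: encodeTerm (⟨1, 1, 1, 16, flipGates N (i + 1 + d)⟩ : Term N) ++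
      .tick :: encodeTerm
        (⟨1, 1, 1, 8, flipGates N i ++ flipGates N (i + 1 + d)⟩ : Term N) := by
    simp [encodeHead, pairTerms]
  rw [e]
  refine h1.mono ?_
  have h2 : ∀ u v w : ℕ, 4 * (5 * (i + 1 + d) + 6) + 8 + (4 * (5 * i + 3) + 8) + u + 3 +
      (4 * (5 * (i + 1 + d) + 6) + 8 + v + 3 + (4 * (5 * i + 3) + 8 + v + 3 + (1 + w + 3))) ≤
      (u + 2 * v + w + 1000) * (N + 1) := fun u v w => by nlinarith
  exact h2 _ _ _

/-- One row of an adjacency matrix. -/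
def matrixRow (n : ℕ) (adj : ℕ → ℕ → Bool) (i : ℕ) : List Bool := (List.range n).map (adj i)

/-- The rows of an adjacency matrix from the given one on. -/
def matrixRows (n : ℕ) (adj : ℕ → ℕ → Bool) (i : ℕ) : List Bool :=
  (List.range' i (n - i)).flatMap (matrixRow n adj)

theorem matrixRows_of_lt {n : ℕ} {adj : ℕ → ℕ → Bool} {i : ℕ} (h : i < n) :
    matrixRows n adj i = matrixRow n adj i ++ matrixRows n adj (i + 1) := by
  rw [matrixRows, matrixRows, show n - i = n - (i + 1) + 1 by omega, List.range'_succ,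
    List.flatMap_cons]

/-- Skipping the entries of a row up to the diagonal. -/
def skipRow : Prog :=
  .op .read ;; .whl (.dec .i) (.op (.inc .t) ;; .op .read) ;; .whl (.dec .t) (.op (.inc .i))

theorem skipRow_runs (a b x i d : ℕ) (inp : List Bool) (out : List Sym) :
    RunsLE skipRow ⟨a, b, x, i, d, 0, inp, out⟩
      ⟨a, b, x, i, d, 0, inp.drop (i + 1), out⟩ (5 * i + 3) := by
  have h0 := RunsLE.op .read ⟨a, b, x, i, d, 0, inp, out⟩
  have h1 := RunsLE.loop_dec .i (p := .op (.inc .t) ;; .op .read) (n := i) (T := 2)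
    (fun k => ⟨a, b, x, i - k, d, k, inp.tail.drop k, out⟩)
    (fun k hk => Nat.sub_pos_of_lt hk) (fun k _ => by
      rw [← List.tail_drop]
      exact (RunsLE.op _ _).seq (RunsLE.op _ _))
    (by rw [Nat.sub_self]) rfl
  have h2 := RunsLE.loop_dec .t (p := .op (.inc .i)) (n := i)
    (fun k => ⟨a, b, x, k, d, i - k, inp.tail.drop i, out⟩)
    (fun k hk => Nat.sub_pos_of_lt hk) (fun k _ => RunsLE.op _ _) (by rw [Nat.sub_self]) rfl
  have h3 := h0.seq (h1.seq h2)
  rw [List.drop_tail] at h3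
  exact h3.mono (by omega)

/-- Writing the gate for an entry of the adjacency matrix. -/
def edgeBody : Prog := .ifr .read (unaryJ ;; unaryI ;; .op (.emit .cz) ;; .op (.emit .tick))

theorem edgeBody_runs {N : ℕ} [NeZero N] {i d : ℕ} (h : i + 1 + d < N) (a b x : ℕ) (r : Bool)
    (inp : List Bool) (out : List Sym) :
    RunsLE edgeBody ⟨a, b, x, i, d, 0, r :: inp, out⟩ ⟨a, b, x, i, d, 0, inp,
      encodeHead encodeGate (if r then czGates N i (i + 1 + d) else []) ++ out⟩ (20 * (N + 1)) := by
  cases r with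
  | false => exact (RunsLE.ifr_false rfl).mono (by omega)
  | true =>
    rw [if_pos rfl, encodeHead_czGates (by omega) h]
    have h1 := (emits_unaryJ a b x i d inp).seq ((emits_unaryI a b x i d inp).seq
      ((emits_emit .cz a b x i d inp).seq (emits_emit .tick a b x i d inp))) out
    refine (RunsLE.ifr_true (m' := ⟨a, b, x, i, d, 0, inp, out⟩) rfl ?_).mono
      (T := 20 * N + 19) (by omega)
    refine RunsLE.mono ?_ (T := 5 * (i + 1 + d) + 6 + (5 * i + 3 + (1 + 1))) (by omega)
    simpa using h1

theorem edges_runs {N n : ℕ} [NeZero N] (hn : n ≤ N) (adj : ℕ → ℕ → Bool) (rest : List Bool)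
    (out : List Sym) :
    RunsLE (pairsLoop skipRow edgeBody)
      ⟨n, N, n, 0, 0, 0, matrixRows n adj 0 ++ rest, encodeList encodeGate ([] : List (Gate N)) ++ out⟩
      ⟨n, N, 0, 0, 0, 0, rest, encodeList encodeGate (edgeGates N n adj) ++ out⟩
      (50 * (N + 1) ^ 3) := by
  have h := pairsLoop_runs (row := skipRow) (body := edgeBody) (a := n) (b := N) (n := n)
    (S := 5 * N + 3) (T := 20 * (N + 1))
    (fun i => matrixRows n adj i ++ rest)
    (fun i => encodeList encodeGate
      (rowFold (fun i j => if adj i j then czGates N i j else []) n [] i) ++ out)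
    (fun i d => (matrixRow n adj i).drop (i + 1 + d) ++ (matrixRows n adj (i + 1) ++ rest))
    (fun i d => encodeList encodeGate
      (colFold (fun d => if adj i (i + 1 + d) then czGates N i (i + 1 + d) else [])
        (rowFold (fun i j => if adj i j then czGates N i j else []) n [] i) d) ++ out)
    (fun i hi => ?_) (fun i hi d hd => ?_) (fun i hi => ?_) (fun i hi => rfl)
  · have e : matrixRows n adj n = [] := by simp [matrixRows]
    simp only [e, List.nil_append] at h
    refine h.mono ?_
    have : (n + 1) ^ 2 ≤ (N + 1) ^ 2 := by gcongr
    calc (n + 1) ^ 2 * (5 * N + 3 + 20 * (N + 1) + 10) ≤ (N + 1) ^ 2 * (50 * (N + 1)) := by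
          gcongr; omega
      _ = 50 * (N + 1) ^ 3 := by ring
  · have := skipRow_runs n N (n - i - 1) i 0 (matrixRows n adj i ++ rest)
      (encodeList encodeGate
        (rowFold (fun i j => if adj i j then czGates N i j else []) n [] i) ++ out)
    rw [matrixRows_of_lt hi, List.append_assoc,
      List.drop_append_of_le_length (by simp [matrixRow]; omega)] at this
    simp only [matrixRows_of_lt hi, List.append_assoc]
    exact this.mono (by omega)
  · have hlen : i + 1 + d < (matrixRow n adj i).length := by simp [matrixRow]; omega
    have e : (matrixRow n adj i).drop (i + 1 + d) =
        adj i (i + 1 + d) :: (matrixRow n adj i).drop (i + 1 + (d + 1)) := by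
      rw [List.drop_eq_getElem_cons hlen]
      simp [matrixRow, add_assoc]
    simp only [e, colFold, encodeList_append, List.append_assoc, List.cons_append]
    exact edgeBody_runs (by omega) n N _ _ _ _
  · have : (matrixRow n adj i).drop (i + 1 + (n - i - 1)) = [] := by
      rw [List.drop_eq_nil_iff]; simp [matrixRow]; omega
    simp [this]

theorem hadamards_runs {N : ℕ} [NeZero N] (n : ℕ) (inp : List Bool) (l : List (Gate N))
    (out : List Sym) :
    RunsLE (countLoop (gateHead unaryI .h))
      ⟨n, N, N, 0, 0, 0, inp, encodeList encodeGate l ++ out⟩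
      ⟨n, N, 0, 0, 0, 0, inp,
        encodeList encodeGate (colFold (fun i => [.h (wire N i)]) l N) ++ out⟩
      (10 * (N + 1) ^ 2) := by
  have h := countLoop_runs (body := gateHead unaryI .h) (a := n) (b := N) (n := N) (inp := inp)
    (T := 5 * N + 5)
    (fun i => encodeList encodeGate (colFold (fun i => [.h (wire N i)]) l i) ++ out)
    (fun i hi => ?_)
  · exact h.mono (by nlinarith)
  · have := ((emits_unaryI n N (N - i - 1) i 0 inp).gateHead .h).mono
      (T' := 5 * N + 5) (by omega)
      (encodeList encodeGate (colFold (fun i => [.h (wire N i)]) l i) ++ out)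
    have e : encodeList encodeGate (colFold (fun i => [.h (wire N i)]) l (i + 1)) =
        .tick :: .h :: encodeUnary i ++
          encodeList encodeGate (colFold (fun i => [.h (wire N i)]) l i) := by
      simp [colFold, encodeList, encodeGate, wire_val hi]
    rw [e, List.append_assoc]
    exact this

theorem encodeBinary_two_pow (k : ℕ) :
    encodeBinary (2 ^ k) = List.replicate k (.bit false) ++ [.bit true, .sep] := by
  have h : Computability.encodeNat (2 ^ k) = List.replicate k false ++ [true] := by
    have key : ∀ k : ℕ, ∃ p : PosNum, ((2 ^ k : ℕ) : Num) = Num.pos p ∧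
        Computability.encodePosNum p = List.replicate k false ++ [true] := by
      intro k
      induction k with
      | zero => exact ⟨1, rfl, rfl⟩
      | succ k ih =>
        obtain ⟨p, hp, he⟩ := ih
        refine ⟨p.bit0, ?_, ?_⟩
        · rw [pow_succ, mul_two, Nat.cast_add, hp]
          exact congrArg Num.pos (PosNum.bit0_of_bit0 p)
        · rw [Computability.encodePosNum, he, List.replicate_succ]
          rfl
    obtain ⟨p, hp, he⟩ := key k
    rw [Computability.encodeNat, hp, Computability.encodeNum, he]
  simp [encodeBinary, h]

/-- Writing the summand for a graph state whose adjacency matrix is read from the input. -/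
def graphTermProg : Prog :=
  .op (.emit .sep) ;; copyA ;; pairsLoop skipRow edgeBody ;; copyB ;;
    countLoop (gateHead unaryI .h) ;; emitWord (encodeBinary 0 ++ encodeBinary 1) ;;
    .op (.emit .sep) ;; .op (.emit (.bit true)) ;; copyB ;; halvings ;;
    emitWord (.tick :: encodeBinary 1)

/-- A bound for the time of `graphTermProg`. -/
def graphTermCost : ℕ :=
  200 + (encodeBinary 0 ++ encodeBinary 1).length + (.tick :: encodeBinary 1).length

theorem graphTermProg_runs {N n : ℕ} [NeZero N] (hn : n ≤ N) (adj : ℕ → ℕ → Bool)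
    (rest : List Bool) (out : List Sym) :
    RunsLE graphTermProg ⟨n, N, 0, 0, 0, 0, matrixRows n adj 0 ++ rest, out⟩
      ⟨n, N, 0, 0, 0, 0, rest, .tick :: encodeTerm (graphTerm N n adj) ++ out⟩
      (graphTermCost * (N + 1) ^ 3) := by
  have h := (RunsLE.op (.emit .sep) ⟨n, N, 0, 0, 0, 0, matrixRows n adj 0 ++ rest, out⟩).seq
    ((copyA_runs n N 0 0 (matrixRows n adj 0 ++ rest) (.sep :: out)).seq
    ((edges_runs hn adj rest out).seq ((copyB_runs n N 0 0 rest _).seq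
    ((hadamards_runs n rest (edgeGates N n adj) out).seq
    ((emits_emitWord (encodeBinary 0 ++ encodeBinary 1) n N 0 0 0 rest _).seq
    ((emits_emit .sep n N 0 0 0 rest _).seq ((emits_emit (.bit true) n N 0 0 0 rest _).seq
    ((copyB_runs n N 0 0 rest _).seq ((halvings_runs n N 0 0 rest N le_rfl _).seq
    (emits_emitWord (.tick :: encodeBinary 1) n N 0 0 0 rest _))))))))))
  have e : ∀ w, Sym.tick :: encodeBinary 1 ++ (List.replicate (9 * N.size) (.bit false) ++
      ([.bit true] ++ ([.sep] ++ (encodeBinary 0 ++ encodeBinary 1 ++ (encodeList encodeGate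
        (colFold (fun i => [.h (wire N i)]) (edgeGates N n adj) N) ++ w))))) =
      .tick :: encodeTerm (graphTerm N n adj) ++ w := by
    intro w
    simp [encodeTerm, graphTerm, graphGates, encodeBinary_two_pow]
  rw [e] at h
  refine h.mono ?_
  have h1 : 1 ≤ N + 1 := by omega
  have h2 : N + 1 ≤ (N + 1) ^ 3 := Nat.le_self_pow (by norm_num) _
  have h3 : (N + 1) ^ 2 ≤ (N + 1) ^ 3 := Nat.pow_le_pow_right h1 (by norm_num)
  have h4 : N * (5 * N + 13) + 1 ≤ 13 * (N + 1) ^ 2 := by nlinarith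
  have h5 : graphTermCost * (N + 1) ^ 3 = 200 * (N + 1) ^ 3 +
      ((encodeBinary 0 ++ encodeBinary 1).length + (.tick :: encodeBinary 1).length) *
        (N + 1) ^ 3 := by rw [graphTermCost]; ring
  have h6 := Nat.le_mul_of_pos_right
    ((encodeBinary 0 ++ encodeBinary 1).length + (Sym.tick :: encodeBinary 1).length)
    (show 0 < (N + 1) ^ 3 by positivity)
  omega

/-- Writing the list of all summands for a graph. -/
def listProg : Prog :=
  .op (.emit .sep) ;; graphTermProg ;; copyB ;; pairsLoop (.op .nop) pairBody

theorem listProg_runs {N n : ℕ} [NeZero N] (hn : n ≤ N) (adj : ℕ → ℕ → Bool)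
    (rest : List Bool) (out : List Sym) :
    RunsLE listProg ⟨n, N, 0, 0, 0, 0, matrixRows n adj 0 ++ rest, out⟩
      ⟨n, N, 0, 0, 0, 0, rest, encodeList encodeTerm (graphTerms N n adj) ++ out⟩
      ((graphTermCost + pairCost + 20) * (N + 1) ^ 3) := by
  have h := pairsLoop_runs (row := .op .nop) (body := pairBody) (a := n) (b := N) (n := N)
    (S := 1) (T := pairCost * (N + 1)) (fun _ => rest)
    (fun i => encodeList encodeTerm (rowFold (pairTerms N) N [graphTerm N n adj] i) ++ out)
    (fun _ _ => rest)
    (fun i d => encodeList encodeTerm (colFold (fun d => pairTerms N i (i + 1 + d))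
        (rowFold (pairTerms N) N [graphTerm N n adj] i) d) ++ out)
    (fun i _ => RunsLE.op _ _) (fun i hi d hd => ?_) (fun i hi => rfl) (fun i hi => rfl)
  · have h1 := graphTermProg_runs hn adj rest (.sep :: out)
    have e : ∀ w, Sym.tick :: encodeTerm (graphTerm N n adj) ++ (.sep :: w) =
        encodeList encodeTerm [graphTerm N n adj] ++ w := by
      intro w; simp [encodeList]
    rw [e] at h1
    refine ((RunsLE.op (.emit .sep) _).seq (h1.seq ((copyB_runs n N 0 0 rest _).seq h))).mono ?_
    have h2 : N + 1 ≤ (N + 1) ^ 3 := Nat.le_self_pow (by norm_num) _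
    have h3 : (N + 1) ^ 2 ≤ (N + 1) ^ 3 := Nat.pow_le_pow_right (by omega) (by norm_num)
    have h4 : (N + 1) ^ 2 * (1 + pairCost * (N + 1) + 10) =
      pairCost * (N + 1) ^ 3 + 11 * (N + 1) ^ 2 := by ring
    have h5 : (graphTermCost + pairCost + 20) * (N + 1) ^ 3 = graphTermCost * (N + 1) ^ 3 +
      pairCost * (N + 1) ^ 3 + 20 * (N + 1) ^ 3 := by ring
    omega
  · simp only [colFold, encodeList_append, List.append_assoc]
    exact emits_pairBody (by omega) n N _ rest _

/-! ### The program for the reduction -/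

/-- Adding a constant to the counter `b`. -/
def addB : ℕ → Prog
  | 0 => .op .nop
  | k + 1 => addB k ;; .op (.inc .b)

theorem addB_runs (k a b : ℕ) (inp : List Bool) (out : List Sym) :
    RunsLE (addB k) ⟨a, b, 0, 0, 0, 0, inp, out⟩ ⟨a, b + k, 0, 0, 0, 0, inp, out⟩ (k + 1) := by
  induction k with
  | zero => exact RunsLE.op _ _
  | succ k ih => exact ih.seq (RunsLE.op _ _)

/-- The program for the reduction, with `k` additional isolated vertices. -/
def mainProg (k : ℕ) : Prog :=
  .whl .read (.op (.inc .a) ;; .op (.inc .b)) ;; addB k ;; listProg ;; listProg ;;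
    .op (.emit .sep) ;; copyB ;; .whl (.dec .x) (.op (.emit .tick)) ;;
    .whl (.dec .a) (.op .nop) ;; .whl (.dec .b) (.op .nop)

theorem readUnary_runs (n a b : ℕ) (inp : List Bool) :
    RunsLE (.whl .read (.op (.inc .a) ;; .op (.inc .b)))
      ⟨a, b, 0, 0, 0, 0, List.replicate n true ++ false :: inp, []⟩
      ⟨a + n, b + n, 0, 0, 0, 0, inp, []⟩ (3 * n + 1) := by
  induction n generalizing a b with
  | zero => exact RunsLE.whl_done rfl
  | succ n ih =>
    have h := RunsLE.whl_step (o := .read) (p := .op (.inc .a) ;; .op (.inc .b))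
      (m₁ := ⟨a, b, 0, 0, 0, 0, List.replicate (n + 1) true ++ false :: inp, []⟩) rfl
      ((RunsLE.op _ _).seq (RunsLE.op _ _)) (ih (a + 1) (b + 1))
    rw [show a + (n + 1) = a + 1 + n by ring, show b + (n + 1) = b + 1 + n by ring]
    exact h.mono (by omega)

theorem mainProg_runs (n k : ℕ) [NeZero (n + k)] (adj₁ adj₂ : ℕ → ℕ → Bool) :
    RunsLE (mainProg k)
      (Mem.init (List.replicate n true ++
        false :: (matrixRows n adj₁ 0 ++ matrixRows n adj₂ 0)))
      (Mem.final (encodeUnary (n + k) ++ (encodeList encodeTerm (graphTerms (n + k) n adj₂) ++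
        encodeList encodeTerm (graphTerms (n + k) n adj₁))))
      ((2 * (graphTermCost + pairCost + 20) + 20) * (n + k + 1) ^ 3) := by
  set N := n + k with hN
  have h1 := readUnary_runs n 0 0 (matrixRows n adj₁ 0 ++ matrixRows n adj₂ 0)
  rw [zero_add] at h1
  have h2 := addB_runs k n n (matrixRows n adj₁ 0 ++ matrixRows n adj₂ 0) []
  rw [← hN] at h2
  have h3 := listProg_runs (N := N) (n := n) (by omega) adj₁ (matrixRows n adj₂ 0) []
  have h4 := listProg_runs (N := N) (n := n) (by omega) adj₂ []
    (encodeList encodeTerm (graphTerms N n adj₁) ++ [])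
  simp only [List.append_nil] at h3 h4
  set w := encodeList encodeTerm (graphTerms N n adj₂) ++
    encodeList encodeTerm (graphTerms N n adj₁) with hw
  have h5 := RunsLE.loop_dec .x (p := .op (.emit .tick)) (n := N)
    (fun k => ⟨n, N, N - k, 0, 0, 0, [], List.replicate k .tick ++ (.sep :: w)⟩)
    (fun k hk => Nat.sub_pos_of_lt hk) (fun k _ => RunsLE.op _ _) (by rw [Nat.sub_self]) rfl
  have h6 := RunsLE.loop_dec .a (p := .op .nop) (n := n)
    (fun k => ⟨n - k, N, 0, 0, 0, 0, [], List.replicate N .tick ++ (.sep :: w)⟩)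
    (fun k hk => Nat.sub_pos_of_lt hk) (fun k _ => RunsLE.op _ _) (by rw [Nat.sub_self]) rfl
  have h7 := RunsLE.loop_dec .b (p := .op .nop) (n := N)
    (fun k => ⟨0, N - k, 0, 0, 0, 0, [], List.replicate N .tick ++ (.sep :: w)⟩)
    (fun k hk => Nat.sub_pos_of_lt hk) (fun k _ => RunsLE.op _ _) (by rw [Nat.sub_self]) rfl
  have e : List.replicate N Sym.tick ++ (.sep :: w) = encodeUnary N ++ w := by
    simp [encodeUnary]
  have h := h1.seq (h2.seq (h3.seq (h4.seq ((RunsLE.op (.emit .sep) _).seq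
    ((copyB_runs n N 0 0 [] _).seq (h5.seq (h6.seq h7)))))))
  simp only [e] at h
  refine h.mono ?_
  have h8 : N + 1 ≤ (N + 1) ^ 3 := Nat.le_self_pow (by norm_num) _
  have h9 : (2 * (graphTermCost + pairCost + 20) + 20) * (N + 1) ^ 3 =
    2 * ((graphTermCost + pairCost + 20) * (N + 1) ^ 3) + 20 * (N + 1) ^ 3 := by ring
  rw [← hN]
  omega

/-! ### Sums and products over the lists -/

@[to_additive]
theorem prod_range_range_eq_prod_pairs {M : Type*} [CommMonoid M] (n : ℕ) (f : ℕ → ℕ → M) :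
    ∏ i ∈ Finset.range n, ∏ d ∈ Finset.range (n - i - 1), f i (i + 1 + d) =
      ∏ p ∈ Finset.univ.filter (fun p : Fin n × Fin n => p.1 < p.2), f p.1 p.2 := by
  rw [Finset.prod_filter, Fintype.prod_prod_type, ← Fin.prod_univ_eq_prod_range]
  refine Finset.prod_congr rfl fun i _ => ?_
  have h : ∏ j : Fin n, (if i < j then f i j else 1) =
      ∏ j ∈ Finset.range n, if (i : ℕ) < j then f i j else 1 :=
    Fin.prod_univ_eq_prod_range (fun j => if (i : ℕ) < j then f i j else 1) n
  rw [h, ← Finset.prod_filter, show (Finset.range n).filter (fun j => (i : ℕ) < j) =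
    Finset.Ico ((i : ℕ) + 1) n by ext j; simp; omega, Finset.prod_Ico_eq_prod_range, Nat.sub_sub]

@[to_additive]
theorem prod_colFold_rel {α : Type} {M : Type*} [CommMonoid M] {R : List α → M → Prop}
    (happ : ∀ k l f g, R k f → R l g → R (k ++ l) (f * g)) {F : ℕ → List α} {f : ℕ → M}
    {l : List α} {g : M} (hl : R l g) (r : ℕ) (hF : ∀ d < r, R (F d) (f d)) :
    R (colFold F l r) ((∏ d ∈ Finset.range r, f d) * g) := by
  induction r with
  | zero => simpa [colFold] using hl
  | succ r ih =>
    rw [Finset.prod_range_succ_comm, mul_assoc]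
    exact happ _ _ _ _ (hF r (by omega)) (ih fun d hd => hF d (by omega))

@[to_additive]
theorem prod_rowFold_rel {α : Type} {M : Type*} [CommMonoid M] {R : List α → M → Prop}
    (happ : ∀ k l f g, R k f → R l g → R (k ++ l) (f * g)) {F : ℕ → ℕ → List α} {f : ℕ → ℕ → M}
    {l : List α} {g : M} (hl : R l g) {n : ℕ} (hF : ∀ i j, i < j → j < n → R (F i j) (f i j)) :
    R (rowFold F n l n)
      ((∏ p ∈ Finset.univ.filter (fun p : Fin n × Fin n => p.1 < p.2), f p.1 p.2) * g) := by
  rw [← prod_range_range_eq_prod_pairs]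
  have : ∀ r ≤ n, R (rowFold F n l r)
      ((∏ i ∈ Finset.range r, ∏ d ∈ Finset.range (n - i - 1), f i (i + 1 + d)) * g) := by
    intro r hr
    induction r with
    | zero => simpa [rowFold] using hl
    | succ r ih =>
      rw [Finset.prod_range_succ_comm, mul_assoc]
      exact prod_colFold_rel happ (ih (by omega)) _ fun d hd => hF _ _ (by omega) (by omega)
  exact this n le_rfl

/-! ### The states prepared by the circuits -/

/-- The action of a circuit, first gate first. -/
def applyGates {n : ℕ} (l : List (Gate n)) (ψ : Ket n) : Ket n :=
  l.foldl (fun ψ g => g.apply ψ) ψ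

theorem applyGates_append {n : ℕ} (k l : List (Gate n)) (ψ : Ket n) :
    applyGates (k ++ l) ψ = applyGates l (applyGates k ψ) := List.foldl_append

/-- The single-qubit state `|1⟩`. -/
def ket1 : Fin 2 → ℂ := ![0, 1]

theorem productKet_apply_eq {n : ℕ} (v : Fin n → Fin 2 → ℂ) (i : Fin n) (x : Bits n) :
    productKet v x = v i (x i) * ∏ k ∈ Finset.univ.erase i, v k (x k) :=
  (Finset.mul_prod_erase _ _ (Finset.mem_univ i)).symm

theorem productKet_update_apply {n : ℕ} (v : Fin n → Fin 2 → ℂ) (i : Fin n) (u : Fin 2 → ℂ)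
    (x : Bits n) : productKet (Function.update v i u) x =
      u (x i) * ∏ k ∈ Finset.univ.erase i, v k (x k) := by
  rw [productKet_apply_eq _ i, Function.update_self]
  congr 1
  exact Finset.prod_congr rfl fun k hk => by
    rw [Function.update_of_ne (Finset.ne_of_mem_erase hk)]

theorem productKet_apply_update {n : ℕ} (v : Fin n → Fin 2 → ℂ) (i : Fin n) (b : Fin 2)
    (x : Bits n) : productKet v (Function.update x i b) =
      v i b * ∏ k ∈ Finset.univ.erase i, v k (x k) := by
  rw [productKet_apply_eq _ i, Function.update_self]
  congr 1
  exact Finset.prod_congr rfl fun k hk => by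
    rw [Function.update_of_ne (Finset.ne_of_mem_erase hk)]

theorem apply_h_productKet {n : ℕ} (v : Fin n → Fin 2 → ℂ) (i : Fin n) :
    (Gate.h i).apply (productKet v) = productKet (Function.update v i fun b =>
      (v i 0 + (-1) ^ (b : ℕ) * v i 1) / (√2 : ℝ)) := by
  funext x
  simp only [Gate.apply]
  rw [productKet_apply_update, productKet_apply_update, productKet_update_apply]
  ring

theorem apply_s_productKet {n : ℕ} (v : Fin n → Fin 2 → ℂ) (i : Fin n) :
    (Gate.s i).apply (productKet v) = productKet (Function.update v i fun b =>
      Complex.I ^ (b : ℕ) * v i b) := by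
  funext x
  simp only [Gate.apply]
  rw [productKet_update_apply, productKet_apply_eq _ i]
  ring

theorem applyGates_flipGates {N : ℕ} [NeZero N] (i : ℕ) {v : Fin N → Fin 2 → ℂ}
    (h : v (wire N i) = ket0) :
    applyGates (flipGates N i) (productKet v) =
      productKet (Function.update v (wire N i) ket1) := by
  rw [applyGates, flipGates, List.foldl_cons, List.foldl_cons, List.foldl_cons, List.foldl_cons,
    List.foldl_nil, apply_h_productKet, apply_s_productKet, apply_s_productKet,
    apply_h_productKet, Function.update_idem, Function.update_idem, Function.update_idem]
  have hs : ((√2 : ℝ) : ℂ) ≠ 0 := by simp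
  have hs2 := sqrt_two_sq
  congr 2
  funext b
  simp only [Function.update_self, h]
  fin_cases b <;> simp [ket0, ket1] <;> field_simp <;> simp [hs2]; norm_num

theorem prod_pairs_ket0 {n : ℕ} {i j : Fin n} (hij : i ≠ j) {v : Fin n → Fin 2 → ℂ}
    (hv : ∀ k, k ≠ i → k ≠ j → v k = ket0) (x : Bits n) :
    productKet v x = v i (x i) * v j (x j) *
      ∏ k ∈ (Finset.univ.erase i).erase j, ket0 (x k) := by
  rw [productKet_apply_eq _ i, ← Finset.mul_prod_erase _ _
    (Finset.mem_erase.2 ⟨hij.symm, Finset.mem_univ j⟩), mul_assoc]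
  congr 2
  refine Finset.prod_congr rfl fun k hk => ?_
  rw [hv k (Finset.ne_of_mem_erase (Finset.mem_of_mem_erase hk)) (Finset.ne_of_mem_erase hk)]

theorem circuitState_eq {n : ℕ} (l : List (Gate n)) :
    circuitState l = applyGates l (productKet fun _ => ket0) := rfl

theorem combination_append {n : ℕ} (k l : List (Term n)) :
    combination (k ++ l) = combination k + combination l := by
  simp [combination]

theorem coeff_zero {n : ℕ} (q : ℕ+) (l : List (Gate n)) :
    (⟨1, q, 0, 1, l⟩ : Term n).coeff = 1 / ((q : ℕ) : ℂ) := by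
  simp [Term.coeff]

theorem coeff_sixteenth {n : ℕ} (l : List (Gate n)) :
    (⟨1, 1, 1, 16, l⟩ : Term n).coeff = omega := by
  have h : (((16 : ℕ+) : ℕ) : ℂ) = 16 := rfl
  rw [Term.coeff, omega, h]
  simp only [PNat.one_coe, Nat.cast_one, div_one, one_mul]
  congr 1
  ring

theorem coeff_eighth {n : ℕ} (l : List (Gate n)) :
    (⟨1, 1, 1, 8, l⟩ : Term n).coeff = omega ^ 2 := by
  have h : (((8 : ℕ+) : ℕ) : ℂ) = 8 := rfl
  rw [Term.coeff, omega, h, ← Complex.exp_nat_mul]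
  simp only [PNat.one_coe, Nat.cast_one, div_one, one_mul]
  congr 1
  push_cast
  ring

theorem combination_pairTerms {N : ℕ} [NeZero N] {i j : ℕ} (h : wire N i ≠ wire N j) :
    combination (pairTerms N i j) = (2 : ℂ) • pairKet (wire N i) (wire N j) := by
  simp only [combination, pairTerms, List.map_cons, List.map_nil, List.sum_cons, List.sum_nil,
    coeff_zero, coeff_sixteenth, coeff_eighth, circuitState_eq]
  rw [applyGates_append, applyGates_flipGates i rfl, applyGates_flipGates j rfl,
    applyGates_flipGates j (by rw [Function.update_of_ne h.symm])]
  have hnil : applyGates [] (productKet fun _ : Fin N => ket0) = productKet fun _ => ket0 := rfl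
  rw [hnil]
  funext x
  simp only [Pi.add_apply, Pi.smul_apply, smul_eq_mul, Pi.zero_apply, pairKet]
  generalize wire N i = i at h ⊢
  generalize wire N j = j at h ⊢
  have hs : ((√2 : ℝ) : ℂ) ≠ 0 := by simp
  rw [prod_pairs_ket0 h (fun _ _ _ => rfl),
    prod_pairs_ket0 h (fun k hi _ => Function.update_of_ne hi _ _),
    prod_pairs_ket0 h (fun k _ hj => Function.update_of_ne hj _ _),
    prod_pairs_ket0 h (fun k hi hj => by
      rw [Function.update_of_ne hj, Function.update_of_ne hi]),
    prod_pairs_ket0 h (fun k hi hj => if_neg (by tauto))]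
  simp only [Function.update_self, Function.update_of_ne h, Function.update_of_ne h.symm,
    true_or, or_true, if_true, PNat.one_coe, Nat.cast_one, div_one, ketR_apply]
  generalize x i = b
  generalize x j = c
  generalize ∏ k ∈ (Finset.univ.erase i).erase j, ket0 (x k) = p
  have hs2 : ((√2 : ℝ) : ℂ)⁻¹ ^ 2 = 1 / 2 := by rw [inv_pow, sqrt_two_sq]; norm_num
  fin_cases b <;> fin_cases c <;> simp [ket0, ket1] <;> ring_nf <;> rw [hs2] <;> ring

theorem wire_eq {N : ℕ} [NeZero N] (i : Fin N) : wire N i = i := Fin.ext (wire_val i.2)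

theorem wire_ne {N : ℕ} [NeZero N] {i j : ℕ} (hij : i < j) (hj : j < N) :
    wire N i ≠ wire N j := fun h => by
  have := congrArg Fin.val h
  rw [wire_val (hij.trans hj), wire_val hj] at this
  omega

theorem combination_rowFold_pairTerms {N : ℕ} [NeZero N] (l : List (Term N)) :
    combination (rowFold (pairTerms N) N l N) = (2 : ℂ) • pairSum N + combination l := by
  have h := sum_rowFold_rel (R := fun (l : List (Term N)) ψ => combination l = ψ)
    (fun k l f g hk hl => by rw [combination_append, hk, hl])
    (F := pairTerms N) (f := fun i j => (2 : ℂ) • pairKet (wire N i) (wire N j))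
    (l := l) rfl (n := N) (fun i j hij hj => combination_pairTerms (wire_ne hij hj))
  simp only [wire_eq] at h
  rw [h, pairSum, Finset.smul_sum]

theorem applyGates_colFold_h {N : ℕ} [NeZero N] (l : List (Gate N)) (r : ℕ) (hr : r ≤ N) :
    applyGates (colFold (fun i => [.h (wire N i)]) l r)
      (productKet fun k => if (k : ℕ) < r then ket0 else fun _ => ((√2 : ℝ) : ℂ)⁻¹) =
    applyGates l (productKet fun _ _ => ((√2 : ℝ) : ℂ)⁻¹) := by
  induction r with
  | zero => simp [colFold]
  | succ r ih =>
    rw [colFold, applyGates_append, ← ih (by omega)]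
    congr 1
    change (Gate.h (wire N r)).apply _ = _
    rw [apply_h_productKet]
    congr 1
    funext k b
    by_cases hk : k = wire N r
    · subst hk
      simp [Function.update_self, wire_val (show r < N by omega), ket0]
    · have : (k : ℕ) ≠ r := fun h => hk (Fin.ext (by rw [h, wire_val (show r < N by omega)]))
      rw [Function.update_of_ne hk, if_congr (show (k : ℕ) < r + 1 ↔ (k : ℕ) < r by omega) rfl rfl]

theorem applyGates_czGates {N : ℕ} [NeZero N] {i j : ℕ} (h : wire N i ≠ wire N j) (ψ : Ket N) :
    applyGates (czGates N i j) ψ =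
      (fun x => (-1) ^ ((x (wire N i) : ℕ) * (x (wire N j) : ℕ))) * ψ := by
  rw [czGates, dif_pos h]
  rfl

theorem applyGates_edgeGates {N n : ℕ} [NeZero N] (hn : n ≤ N) (adj : ℕ → ℕ → Bool) (ψ : Ket N) :
    applyGates (edgeGates N n adj) ψ =
      (∏ p ∈ Finset.univ.filter (fun p : Fin n × Fin n => p.1 < p.2), if adj p.1 p.2 then
        (fun x : Bits N => (-1 : ℂ) ^ ((x (wire N p.1) : ℕ) * (x (wire N p.2) : ℕ))) else 1) * ψ := by
  have h := prod_rowFold_rel (R := fun (l : List (Gate N)) (f : Ket N) => ∀ ψ, applyGates l ψ = f * ψ)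
    (fun k l f g hk hl ψ => by rw [applyGates_append, hk, hl, mul_left_comm, mul_assoc])
    (F := fun i j => if adj i j then czGates N i j else [])
    (f := fun i j => if adj i j then
      (fun x : Bits N => (-1 : ℂ) ^ ((x (wire N i) : ℕ) * (x (wire N j) : ℕ))) else 1)
    (l := []) (g := 1) (fun ψ => (one_mul ψ).symm) (n := n) (fun i j hij hj ψ => by
      split_ifs
      · exact applyGates_czGates (wire_ne hij (hj.trans_le hn)) ψ
      · exact (one_mul ψ).symm) ψ
  rwa [mul_one] at h

open Classical in
/-- The adjacency matrix of a graph. -/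
def adjMatrix {n : ℕ} (G : SimpleGraph (Fin n)) (i j : ℕ) : Bool :=
  decide (∃ (hi : i < n) (hj : j < n), G.Adj ⟨i, hi⟩ ⟨j, hj⟩)

theorem adjMatrix_iff {n : ℕ} (G : SimpleGraph (Fin n)) (i j : Fin n) :
    adjMatrix G i j = true ↔ G.Adj i j := by
  simp [adjMatrix]

/-- The graph with additional isolated vertices. -/
def padGraph {n : ℕ} (k : ℕ) (G : SimpleGraph (Fin n)) : SimpleGraph (Fin (n + k)) :=
  G.map (Fin.castAddEmb k)

theorem circuitState_graphGates {n k : ℕ} [NeZero (n + k)] (G : SimpleGraph (Fin n)) :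
    circuitState (graphGates (n + k) n (adjMatrix G)) = graphState (padGraph k G) := by
  classical
  have h := applyGates_colFold_h (edgeGates (n + k) n (adjMatrix G)) (n + k) le_rfl
  simp only [Fin.is_lt, if_true] at h
  rw [circuitState_eq, graphGates, h, applyGates_edgeGates (by omega)]
  funext x
  rw [graphState, Pi.mul_apply, mul_comm, Finset.prod_apply]
  congr 1
  · simp [productKet, sqrt_two_pow]
  · have e : ∀ p : Fin n × Fin n, (if adjMatrix G p.1 p.2 then
        (fun x : Bits (n + k) => (-1 : ℂ) ^ ((x (wire (n + k) p.1) : ℕ) *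
          (x (wire (n + k) p.2) : ℕ))) else 1) x =
        if G.Adj p.1 p.2 then (-1 : ℂ) ^ ((x (Fin.castAdd k p.1) : ℕ) *
          (x (Fin.castAdd k p.2) : ℕ)) else 1 := fun p => by
      have hw : ∀ i : Fin n, wire (n + k) i = Fin.castAdd k i := fun i =>
        wire_eq (Fin.castAdd k i)
      rw [hw, hw, if_congr (adjMatrix_iff G p.1 p.2) rfl rfl]
      split_ifs <;> rfl
    rw [Finset.prod_congr rfl fun p _ => e p, ← Finset.prod_filter, Finset.filter_filter]
    refine Finset.prod_bij (fun p _ => (Fin.castAdd k p.1, Fin.castAdd k p.2)) ?_ ?_ ?_ ?_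
    · rintro ⟨i, j⟩ hp
      simp only [Finset.mem_filter, Finset.mem_univ, true_and] at hp ⊢
      exact ⟨hp.1, (SimpleGraph.map_adj_apply (f := Fin.castAddEmb k)).2 hp.2⟩
    · rintro ⟨i, j⟩ _ ⟨i', j'⟩ _ h
      simpa using h
    · rintro ⟨i, j⟩ hp
      simp only [Finset.mem_filter, Finset.mem_univ, true_and, padGraph,
        SimpleGraph.map_adj] at hp
      obtain ⟨hlt, u, v, huv, rfl, rfl⟩ := hp
      exact ⟨(u, v), by simpa using ⟨hlt, huv⟩, rfl⟩
    · intro p _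
      rfl

theorem combination_graphTerms {n k : ℕ} [NeZero (n + k)] (G : SimpleGraph (Fin n)) :
    combination (graphTerms (n + k) n (adjMatrix G)) = (2 : ℂ) • pairSum (n + k) +
      ((1 / 2 ^ (9 * (n + k).size) : ℝ) : ℂ) • graphState (padGraph k G) := by
  rw [graphTerms, combination_rowFold_pairTerms, ← circuitState_graphGates]
  congr 1
  have h : (graphTerm (n + k) n (adjMatrix G)).coeff = ((1 / 2 ^ (9 * (n + k).size) : ℝ) : ℂ) :=
    (coeff_zero _ _).trans (by simp)
  rw [combination, List.map_singleton, List.sum_singleton, h]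
  rfl

theorem length_graphTerms (N n : ℕ) [NeZero N] (adj : ℕ → ℕ → Bool) :
    (graphTerms N n adj).length ≤ 2 * N * (N - 1) + 1 := by
  have h := sum_rowFold_rel (R := fun (l : List (Term N)) m => l.length = m)
    (fun k l f g hk hl => by rw [List.length_append, hk, hl])
    (F := pairTerms N) (f := fun _ _ => 4) (l := [graphTerm N n adj]) rfl (n := N)
    (fun i j _ _ => rfl)
  rw [graphTerms, h, ← sum_range_range_eq_sum_pairs N fun _ _ => 4]
  simp only [Finset.sum_const, smul_eq_mul, Finset.card_range, List.length_singleton]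
  have h2 := Finset.sum_range_reflect (fun i => i) N
  have h3 := Finset.sum_range_id_mul_two N
  rw [← Finset.sum_mul, Finset.sum_congr rfl fun i _ => show N - i - 1 = N - 1 - i by omega, h2]
  nlinarith

/-! ### Adding isolated vertices -/

theorem padGraph_adj_iff {n k : ℕ} (G : SimpleGraph (Fin n)) (a b : Fin (n + k)) :
    (padGraph k G).Adj a b ↔
      ∃ u v, G.Adj u v ∧ Fin.castAdd k u = a ∧ Fin.castAdd k v = b := by
  rw [padGraph, SimpleGraph.map_adj]
  rfl

theorem padGraph_adj_castAdd {n k : ℕ} (G : SimpleGraph (Fin n)) (u v : Fin n) :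
    (padGraph k G).Adj (Fin.castAdd k u) (Fin.castAdd k v) ↔ G.Adj u v :=
  SimpleGraph.map_adj_apply (f := Fin.castAddEmb k)

theorem nonempty_iso_padGraph {n : ℕ} (k : ℕ) {G₁ G₂ : SimpleGraph (Fin n)}
    (h : Nonempty (G₁ ≃g G₂)) : Nonempty (padGraph k G₁ ≃g padGraph k G₂) := by
  obtain ⟨e⟩ := h
  let π : Fin (n + k) ≃ Fin (n + k) :=
    (finSumFinEquiv.symm.trans (Equiv.sumCongr e.toEquiv (Equiv.refl _))).trans finSumFinEquiv
  have hπ : ∀ u, π (Fin.castAdd k u) = Fin.castAdd k (e u) := fun u => by simp [π]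
  have hinj : ∀ {u v : Fin n}, Fin.castAdd k u = Fin.castAdd k v ↔ u = v :=
    (Fin.castAdd_injective n k).eq_iff
  refine ⟨⟨π, fun {a b} => ?_⟩⟩
  rw [padGraph_adj_iff, padGraph_adj_iff]
  constructor
  · rintro ⟨u, v, huv, hu, hv⟩
    refine ⟨e.symm u, e.symm v, e.symm.map_adj_iff.2 huv, π.injective ?_, π.injective ?_⟩
    · rw [hπ, e.apply_symm_apply, hu]
    · rw [hπ, e.apply_symm_apply, hv]
  · rintro ⟨u, v, huv, rfl, rfl⟩
    exact ⟨e u, e v, e.map_adj_iff.2 huv, (hπ u).symm, (hπ v).symm⟩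

theorem exists_castAdd_of_adj {n k : ℕ} {G : SimpleGraph (Fin n)} {a : Fin (n + k)}
    (h : ∃ b, (padGraph k G).Adj a b) : ∃ u, Fin.castAdd k u = a ∧ ∃ v, G.Adj u v := by
  obtain ⟨b, h⟩ := h
  obtain ⟨u, v, huv, rfl, rfl⟩ := (padGraph_adj_iff _ _ _).1 h
  exact ⟨u, rfl, v, huv⟩

/-- The vertices that are not isolated, before and after adding isolated vertices. -/
def supportEquiv {n : ℕ} (k : ℕ) (G : SimpleGraph (Fin n)) :
    {u : Fin n // ∃ v, G.Adj u v} ≃ {a : Fin (n + k) // ∃ b, (padGraph k G).Adj a b} :=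
  Equiv.ofBijective
    (fun u => ⟨Fin.castAdd k u, u.2.imp' (Fin.castAdd k)
      fun v => (padGraph_adj_castAdd G u v).2⟩) (by
    constructor
    · intro u v h
      exact Subtype.ext (Fin.castAdd_injective n k (congrArg Subtype.val h))
    · rintro ⟨a, ha⟩
      obtain ⟨u, hu, hv⟩ := exists_castAdd_of_adj ha
      exact ⟨⟨u, hv⟩, Subtype.ext hu⟩)

theorem nonempty_iso_of_padGraph {n k : ℕ} {G₁ G₂ : SimpleGraph (Fin n)}
    (h : Nonempty (padGraph k G₁ ≃g padGraph k G₂)) : Nonempty (G₁ ≃g G₂) := by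
  classical
  obtain ⟨e⟩ := h
  let e' : {u : Fin n // ∃ v, G₁.Adj u v} ≃ {u : Fin n // ∃ v, G₂.Adj u v} :=
    ((supportEquiv k G₁).trans (e.toEquiv.subtypeEquiv fun a =>
      ⟨fun ⟨b, h⟩ => ⟨e b, e.map_adj_iff.2 h⟩, fun ⟨b, h⟩ => ⟨e.symm b, by
        rw [← e.map_adj_iff, e.apply_symm_apply]; exact h⟩⟩)).trans (supportEquiv k G₂).symm
  have he' : ∀ u, Fin.castAdd k (e' u : Fin n) = e (Fin.castAdd k u) := fun u =>
    congrArg Subtype.val ((supportEquiv k G₂).apply_symm_apply _)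
  refine ⟨⟨e'.extendSubtype, fun {u v} => ?_⟩⟩
  by_cases hu : ∃ w, G₁.Adj u w
  · by_cases hv : ∃ w, G₁.Adj v w
    · rw [e'.extendSubtype_apply_of_mem u hu, e'.extendSubtype_apply_of_mem v hv,
        ← padGraph_adj_castAdd (k := k), he', he', e.map_adj_iff, padGraph_adj_castAdd]
    · exact iff_of_false (fun h => e'.extendSubtype_not_mem v hv ⟨_, h.symm⟩)
        fun h => hv ⟨_, h.symm⟩
  · exact iff_of_false (fun h => e'.extendSubtype_not_mem u hu ⟨_, h⟩) fun h => hu ⟨_, h⟩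

/-! ### Normalization -/

theorem normalize_psi {n : ℕ} (a b : ℝ) (G : SimpleGraph (Fin n)) :
    normalize (psi a b G) = psi (a / √(normSq (psi a b G))) (b / √(normSq (psi a b G))) G := by
  rw [normalize]
  generalize √(normSq (psi a b G)) = ν
  rw [psi, psi, smul_add, smul_smul, smul_smul]
  push_cast
  ring_nf

theorem isState_normalize {n : ℕ} {ψ : Ket n} (h : 0 < normSq ψ) : IsState (normalize ψ) := by
  rw [IsState, normalize, normSq_smul, Complex.norm_real, Real.norm_eq_abs, sq_abs, div_pow,
    Real.sq_sqrt h.le]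
  field_simp

theorem ne_zero_of_normSq_pos {n : ℕ} {ψ : Ket n} (h : 0 < normSq ψ) : ψ ≠ 0 := by
  rintro rfl
  simp [normSq] at h

theorem normalize_psi_congr {n : ℕ} (hn : 2 ≤ n) (a b : ℝ) {G₁ G₂ : SimpleGraph (Fin n)}
    (e : G₁ ≃g G₂) : normalize (psi a b G₁) =
      qubitPerm e.toEquiv.symm *ᵥ normalize (psi a b G₂) := by
  have h : normSq (psi a b G₁) = normSq (psi a b G₂) := by
    rw [normSq_psi hn, normSq_psi hn, star_dotProduct_graphState_congr hn e]
  rw [normalize, normalize, h, Matrix.mulVec_smul, ← psi_eq_qubitPerm_mulVec hn]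

theorem one_sub_inv_sqrt_bounds {q : ℝ} (h0 : 0 ≤ q) (h1 : q ≤ 1) :
    q / 5 ≤ 1 - 1 / √(1 + q) ∧ 1 - 1 / √(1 + q) ≤ q / 2 := by
  have h2 : 1 + q / 4 ≤ √(1 + q) := Real.le_sqrt_of_sq_le (by nlinarith)
  have h3 : √(1 + q) ≤ 1 + q / 2 := Real.sqrt_le_iff.2 ⟨by positivity, by nlinarith⟩
  have h4 : 0 < √(1 + q) := by positivity
  constructor
  · have : 1 / √(1 + q) ≤ 1 - q / 5 := by
      rw [div_le_iff₀ h4]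
      nlinarith
    linarith
  · have : 1 - q / 2 ≤ 1 / √(1 + q) := by
      rw [le_div_iff₀ h4]
      nlinarith
    linarith

/-- The norm of twice the unnormalized vector. -/
def pairCoeff (n : ℕ) : ℝ := 2 * √(normSq (pairSum n))

/-- The coefficient of the graph state. -/
def graphCoeff (n : ℕ) : ℝ := 1 / 2 ^ (9 * n.size)

theorem pairCoeff_bounds {n : ℕ} (hn : 2 ≤ n) :
    (n : ℝ) ^ 2 / 4 ≤ pairCoeff n ∧ pairCoeff n ≤ (n : ℝ) ^ 2 := by
  have hn' : (2 : ℝ) ≤ n := by exact_mod_cast hn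
  have h1 : 1 ≤ √(relNormSq n) := Real.one_le_sqrt.2 (one_le_relNormSq hn)
  have h2 : √(relNormSq n) ≤ 2 := by
    refine Real.sqrt_le_iff.2 ⟨by norm_num, ?_⟩
    have h3 : (4 : ℝ) / n ≤ 2 := by rw [div_le_iff₀ (by linarith)]; linarith
    have h4 : (2 : ℝ) / (n * (n - 1)) ≤ 1 := by
      rw [div_le_one (by nlinarith)]; nlinarith
    rw [relNormSq]
    linarith
  rw [pairCoeff, sqrt_normSq_pairSum hn]
  have h5 : (n : ℝ) ^ 2 / 4 ≤ n * (n - 1) / 2 := by nlinarith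
  have h6 : (0 : ℝ) ≤ n * (n - 1) / 2 := le_trans (by positivity) h5
  constructor <;> nlinarith

theorem graphCoeff_bounds {n : ℕ} (hn : 1 ≤ n) :
    1 / (512 * (n : ℝ) ^ 9) ≤ graphCoeff n ∧ graphCoeff n ≤ 1 / (n : ℝ) ^ 9 := by
  have h1 : (n : ℝ) ≤ 2 ^ n.size := by exact_mod_cast (Nat.lt_size_self n).le
  have h2 : (2 : ℝ) ^ n.size ≤ 2 * n := by
    have h3 : 0 < n.size := Nat.size_pos.2 hn
    have h4 : 2 ^ (n.size - 1) ≤ n := Nat.lt_size.1 (by omega)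
    have h5 : (2 : ℝ) ^ (n.size - 1) ≤ n := by exact_mod_cast h4
    calc (2 : ℝ) ^ n.size = 2 * 2 ^ (n.size - 1) := by
          rw [← pow_succ']; congr 1; omega
      _ ≤ 2 * n := by linarith
  have hn' : (0 : ℝ) < n := by exact_mod_cast hn
  rw [graphCoeff, mul_comm 9, pow_mul]
  constructor
  · refine one_div_le_one_div_of_le (by positivity) ?_
    calc ((2 : ℝ) ^ n.size) ^ 9 ≤ (2 * n) ^ 9 := by gcongr
      _ = 512 * (n : ℝ) ^ 9 := by ring
  · exact one_div_le_one_div_of_le (by positivity) (by gcongr)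

theorem graphCoeff_pos (n : ℕ) : 0 < graphCoeff n := by rw [graphCoeff]; positivity

theorem combination_graphTerms_eq_psi {n k : ℕ} [NeZero (n + k)] (hn : 2 ≤ n + k)
    (G : SimpleGraph (Fin n)) : combination (graphTerms (n + k) n (adjMatrix G)) =
      psi (pairCoeff (n + k)) (graphCoeff (n + k)) (padGraph k G) := by
  have h : √(normSq (pairSum (n + k))) ≠ 0 := by
    have := (pairCoeff_bounds hn).1
    have h2 : (2 : ℝ) ≤ (n + k : ℕ) := by exact_mod_cast hn
    rw [pairCoeff] at this
    nlinarith
  rw [combination_graphTerms, psi, ketM_eq, smul_smul, pairCoeff, graphCoeff, ← Complex.ofReal_mul,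
    mul_one_div, mul_div_cancel_right₀ _ h]
  norm_num

theorem eventually_normalize_psi_bounds : ∃ n₀ : ℕ, 2 ≤ n₀ ∧ ∀ n : ℕ, n₀ ≤ n →
    ∀ G : SimpleGraph (Fin n), 0 < normSq (psi (pairCoeff n) (graphCoeff n) G) ∧
      ∃ a b : ℝ, normalize (psi (pairCoeff n) (graphCoeff n) G) = psi a b G ∧ 0 < b ∧
        1 / 2000000 / (n : ℝ) ^ 22 ≤ 1 - a ∧ 1 - a ≤ 10 / (n : ℝ) ^ 22 := by
  obtain ⟨n₀, hn₀⟩ := eventually_overlap_le (c := 1 / 4096) (by norm_num) 11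
  refine ⟨n₀ + 2, by omega, fun n hn G => ?_⟩
  have hn' : (2 : ℝ) ≤ n := by exact_mod_cast (show 2 ≤ n by omega)
  obtain ⟨hc1, hc2⟩ := pairCoeff_bounds (show 2 ≤ n by omega)
  obtain ⟨hd1, hd2⟩ := graphCoeff_bounds (show 1 ≤ n by omega)
  have hd0 := graphCoeff_pos n
  have hg := (Complex.abs_re_le_norm _).trans
    ((norm_ketM_graphState_le (show 2 ≤ n by omega) G).trans (hn₀ n (by omega)))
  rw [normalize_psi, normSq_psi (show 2 ≤ n by omega)]
  generalize (star (ketM n) ⬝ᵥ graphState G).re = g at hg ⊢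
  generalize pairCoeff n = c at *
  generalize graphCoeff n = d at *
  have hc0 : 0 < c := lt_of_lt_of_le (by positivity) hc1
  obtain ⟨s, rfl⟩ : ∃ s, d = s * c := ⟨d / c, by field_simp⟩
  have hs0 : 0 < s := pos_of_mul_pos_left hd0 hc0.le
  have hs1 : 1 / (512 * (n : ℝ) ^ 11) ≤ s := by
    have : 1 / (512 * (n : ℝ) ^ 9) ≤ s * (n : ℝ) ^ 2 := hd1.trans (by gcongr)
    rw [div_le_iff₀ (by positivity)] at this ⊢
    linarith
  have hs2 : s ≤ 4 / (n : ℝ) ^ 11 := by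
    have : s * ((n : ℝ) ^ 2 / 4) ≤ 1 / (n : ℝ) ^ 9 := le_trans (by gcongr) hd2
    rw [le_div_iff₀ (by positivity)] at this ⊢
    linarith
  have hn11 : (2 : ℝ) ^ 11 ≤ (n : ℝ) ^ 11 := by gcongr
  have hs3 : s ≤ 1 / 2 := hs2.trans (by rw [div_le_iff₀ (by positivity)]; linarith)
  have hg2 : |g| ≤ s / 8 := hg.trans (le_trans (le_of_eq (by field_simp; norm_num))
    (div_le_div_of_nonneg_right hs1 (by norm_num)))
  obtain ⟨hg3, hg4⟩ := abs_le.1 hg2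
  have e : c ^ 2 + (s * c) ^ 2 + 2 * (c * (s * c) * g) = c ^ 2 * (1 + (s ^ 2 + 2 * s * g)) := by
    ring
  have hq1 : 3 / 4 * s ^ 2 ≤ s ^ 2 + 2 * s * g := by nlinarith
  have hq2 : s ^ 2 + 2 * s * g ≤ 5 / 4 * s ^ 2 := by nlinarith
  rw [e, Real.sqrt_mul (by positivity), Real.sqrt_sq hc0.le]
  generalize s ^ 2 + 2 * s * g = q at hq1 hq2 ⊢
  have hq0 : 0 ≤ q := le_trans (by positivity) hq1
  obtain ⟨h1, h2⟩ := one_sub_inv_sqrt_bounds hq0 (by nlinarith)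
  refine ⟨by positivity, _, _, rfl, by positivity, ?_, ?_⟩
  · rw [div_mul_eq_div_div, div_self hc0.ne']
    have h3 : (1 / (512 * (n : ℝ) ^ 11)) ^ 2 ≤ s ^ 2 := by gcongr
    have h4 : 1 / 2000000 / (n : ℝ) ^ 22 ≤ 3 / 20 * (1 / (512 * (n : ℝ) ^ 11)) ^ 2 := by
      rw [div_pow, mul_pow, ← pow_mul, one_pow, div_le_iff₀ (by positivity)]
      field_simp
      norm_num
      gcongr
      norm_num
    linarith
  · rw [div_mul_eq_div_div, div_self hc0.ne']
    have h3 : s ^ 2 ≤ (4 / (n : ℝ) ^ 11) ^ 2 := by gcongr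
    have h4 : 5 / 8 * (4 / (n : ℝ) ^ 11) ^ 2 = 10 / (n : ℝ) ^ 22 := by
      field_simp
      norm_num
    linarith

/-! ### The reduction from Graph Isomorphism -/

theorem encodeGraph_eq {n : ℕ} (G : SimpleGraph (Fin n)) :
    encodeGraph G = matrixRows n (adjMatrix G) 0 := by
  have h : List.range n = (List.finRange n).map Fin.val := (List.map_coe_finRange_eq_range).symm
  rw [encodeGraph, matrixRows, Nat.sub_zero, ← List.range_eq_range', h, List.flatMap_map]
  refine List.flatMap_congr fun i _ => ?_
  rw [matrixRow, h, List.map_map]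
  refine List.map_congr_left fun j _ => ?_
  rw [Function.comp_apply, Bool.eq_iff_iff, adjMatrix_iff]
  exact @decide_eq_true_iff _ (Classical.propDecidable _)

/-- The reduction, with a given number of additional isolated vertices. -/
def reduction (k : ℕ) [NeZero k] (P : GraphPair) : Input :=
  haveI : NeZero (P.n + k) := ⟨by have := NeZero.ne k; omega⟩
  ⟨P.n + k, graphTerms (P.n + k) P.n (adjMatrix P.G₂), graphTerms (P.n + k) P.n (adjMatrix P.G₁)⟩

theorem polyTimeReduces_of_reduction (k : ℕ) [NeZero k] {Q : PromiseProblem Input}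
    (hyes : ∀ P, graphIsomorphism.yes P → Q.yes (reduction k P))
    (hno : ∀ P, graphIsomorphism.no P → Q.no (reduction k P)) :
    PolyTimeReduces encodeGraphPair encodeInput graphIsomorphism Q := by
  refine polyTimeReduces_of_runs (mainProg k) (reduction k)
    (Polynomial.C (2 * (graphTermCost + pairCost + 20) + 20) *
      (Polynomial.X + Polynomial.C (k + 1)) ^ 3) (fun P => ?_) hyes hno
  have : NeZero (P.n + k) := ⟨by have := NeZero.ne k; omega⟩
  obtain ⟨t, ht, h⟩ := mainProg_runs P.n k (adjMatrix P.G₁) (adjMatrix P.G₂)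
  rw [← encodeGraph_eq, ← encodeGraph_eq] at h
  refine ⟨t, ht.trans ?_, h⟩
  simp only [Polynomial.eval_mul, Polynomial.eval_C, Polynomial.eval_pow, Polynomial.eval_add,
    Polynomial.eval_X]
  have : P.n ≤ (encodeGraphPair P).length := by simp [encodeGraphPair]
  exact Nat.mul_le_mul_left _ (Nat.pow_le_pow_left (by omega) 3)

theorem polyTimeReduces_graphIsomorphism (c : ℝ) :
    PolyTimeReduces encodeGraphPair encodeInput graphIsomorphism
      (cliffordIsomorphism (fun n => 2 * n * (n - 1) + 1)
        (fun n => 1 - c / (n : ℝ) ^ 23) (fun _ => 1)) := by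
  obtain ⟨n₀, hn2, hn₀⟩ := eventually_normalize_psi_bounds
  obtain ⟨n₁, hn₁⟩ := eventually_iso_of_braket_psi (k₁ := 1 / 2000000) (k₂ := 10)
    (by norm_num) (by norm_num) c
  set k := n₀ + n₁ with hk
  have : NeZero k := ⟨by omega⟩
  have hvalid : ∀ P, (reduction k P).IsValid fun n => 2 * n * (n - 1) + 1 := fun P => by
    have : NeZero (P.n + k) := ⟨by omega⟩
    have h0 : ∀ G : SimpleGraph (Fin P.n),
        combination (graphTerms (P.n + k) P.n (adjMatrix G)) ≠ 0 := fun G => by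
      rw [combination_graphTerms_eq_psi (by omega)]
      exact ne_zero_of_normSq_pos (hn₀ _ (by omega) _).1
    exact ⟨show 1 ≤ P.n + k by omega, length_graphTerms _ _ _, length_graphTerms _ _ _,
      h0 _, h0 _⟩
  have h1 : ∀ P, (reduction k P).ψ₁ =
      normalize (psi (pairCoeff (P.n + k)) (graphCoeff (P.n + k)) (padGraph k P.G₂)) := fun P => by
    have : NeZero (P.n + k) := ⟨by omega⟩
    exact congrArg normalize (combination_graphTerms_eq_psi (by omega) _)
  have h2 : ∀ P, (reduction k P).ψ₂ =
      normalize (psi (pairCoeff (P.n + k)) (graphCoeff (P.n + k)) (padGraph k P.G₁)) := fun P => by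
    have : NeZero (P.n + k) := ⟨by omega⟩
    exact congrArg normalize (combination_graphTerms_eq_psi (by omega) _)
  refine polyTimeReduces_of_reduction k (fun P hP => ⟨hvalid P, ?_⟩)
    fun P hP => ⟨hvalid P, ?_⟩
  · obtain ⟨e⟩ := nonempty_iso_padGraph k (hP.map SimpleGraph.Iso.symm)
    refine ⟨_, qubitPerm_mem_cliffordGroup (e.toEquiv.symm : Equiv.Perm (Fin (P.n + k))), ?_⟩
    rw [h1, h2]
    change (1 : ℝ) ≤ (braket (n := P.n + k) _ _ _).re
    rw [braket, ← normalize_psi_congr (by omega) _ _ e, star_dotProduct_self,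
      isState_normalize (hn₀ _ (by omega) _).1]
    simp
  · rw [h1, h2]
    change ∀ C ∈ cliffordGroup (P.n + k),
      ‖braket (n := P.n + k) _ C _‖ ≤ 1 - c / ((P.n + k : ℕ) : ℝ) ^ 23
    intro C hC
    by_contra! hlt
    obtain ⟨hpos₁, a₁, b₁, e₁, hb₁, ha₁, ha₁'⟩ := hn₀ (P.n + k) (by omega) (padGraph k P.G₂)
    obtain ⟨hpos₂, a₂, b₂, e₂, hb₂, ha₂, ha₂'⟩ := hn₀ (P.n + k) (by omega) (padGraph k P.G₁)
    have hs₁ := isState_normalize hpos₁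
    have hs₂ := isState_normalize hpos₂
    rw [e₁] at hs₁ hlt
    rw [e₂] at hs₂ hlt
    obtain ⟨ω, hω, h⟩ := RCLike.exists_norm_eq_mul_self (braket (psi a₁ b₁ (padGraph k P.G₂)) C
      (psi a₂ b₂ (padGraph k P.G₁)))
    obtain ⟨-, hiso⟩ := hn₁ (P.n + k) (by omega) a₁ a₂ b₁ b₂ ha₁ ha₁' ha₂ ha₂' hb₁ hb₂ _ _ hs₁ hs₂
      (ω • C) (smul_mem_cliffordGroup hC hω) (by
        rw [braket_smul_op, ← h]
        exact hlt.le)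
    exact hP ((nonempty_iso_of_padGraph hiso).map SimpleGraph.Iso.symm)

end CliffordIso

end

open CliffordIso in
theorem mainTheorem7 :
    -- `|M⟩` is a state of stabilizer rank at most `2n(n-1)`
    (∀ n : ℕ, 2 ≤ n →
      IsState (ketM n) ∧ StabilizerRankLE (ketM n) (2 * n * (n - 1)) ∧
      ∀ (a b : ℝ) (G : SimpleGraph (Fin n)),
        StabilizerRankLE (psi a b G) (2 * n * (n - 1) + 1)) ∧
    -- a Clifford that almost fixes `|M⟩` is a qubit permutation
    (∀ κ : ℝ, 0 < κ → ∃ n₀ : ℕ, ∀ n : ℕ, n₀ ≤ n → ∀ C ∈ cliffordGroup n,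
      1 - κ / (n : ℝ) ^ 11 ≤ (braket (ketM n) C (ketM n)).re → IsQubitPerm C) ∧
    -- for `a = 1 - 1/Θ(n²²)` there is a unique `b > 0` that normalizes, and `b = 1/Θ(n¹¹)`
    (∀ k₁ k₂ : ℝ, 0 < k₁ → k₁ ≤ k₂ → ∃ l₁ l₂ : ℝ, 0 < l₁ ∧ 0 < l₂ ∧
      ∃ n₀ : ℕ, ∀ n : ℕ, n₀ ≤ n → ∀ a : ℝ,
        k₁ / (n : ℝ) ^ 22 ≤ 1 - a → 1 - a ≤ k₂ / (n : ℝ) ^ 22 →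
        ∀ G : SimpleGraph (Fin n),
          (∃! b : ℝ, 0 < b ∧ IsState (psi a b G)) ∧
          ∀ b : ℝ, 0 < b → IsState (psi a b G) →
            l₁ / (n : ℝ) ^ 11 ≤ b ∧ b ≤ l₂ / (n : ℝ) ^ 11) ∧
    -- correctness of the reduction on the states `a|M⟩ + b₁|G₁⟩` and `a|M⟩ + b₂|G₂⟩`
    (∀ k₁ k₂ c : ℝ, 0 < k₁ → k₁ ≤ k₂ → 0 < c → ∃ n₀ : ℕ, ∀ n : ℕ, n₀ ≤ n →
      ∀ a b₁ b₂ : ℝ, k₁ / (n : ℝ) ^ 22 ≤ 1 - a → 1 - a ≤ k₂ / (n : ℝ) ^ 22 →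
      0 < b₁ → 0 < b₂ →
      ∀ G₁ G₂ : SimpleGraph (Fin n), IsState (psi a b₁ G₁) → IsState (psi a b₂ G₂) →
        (∀ C ∈ cliffordGroup n,
          1 - c / (n : ℝ) ^ 22 ≤ (braket (psi a b₁ G₁) C (psi a b₂ G₂)).re →
            IsQubitPerm C) ∧
        (∀ C ∈ cliffordGroup n,
          1 - c / (n : ℝ) ^ 23 ≤ (braket (psi a b₁ G₁) C (psi a b₂ G₂)).re →
            IsQubitPerm C ∧ Nonempty (G₁ ≃g G₂)) ∧
        (Nonempty (G₁ ≃g G₂) →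
          ∃ π : Equiv.Perm (Fin n), qubitPerm π ∈ cliffordGroup n ∧
            psi a b₁ G₁ = qubitPerm π *ᵥ psi a b₂ G₂)) ∧
    -- hardness for Graph Isomorphism
    (∀ c : ℝ, 0 < c →
      PolyTimeReduces encodeGraphPair encodeInput graphIsomorphism
        (cliffordIsomorphism (fun n => 2 * n * (n - 1) + 1)
          (fun n => 1 - c / (n : ℝ) ^ 23) (fun _ => 1))) := by
  refine ⟨fun n hn => ⟨isState_ketM hn, stabilizerRankLE_ketM hn, stabilizerRankLE_psi hn⟩,
    fun κ _ => ?_, fun k₁ k₂ h1 h12 => psi_normalization h1 h12, fun k₁ k₂ c h1 h12 _ => ?_,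
    fun c _ => polyTimeReduces_graphIsomorphism c⟩
  · obtain ⟨n₀, hn₀⟩ := eventually_div_pow_le (κ := κ) one_pos (show 5 < 11 by norm_num)
    exact ⟨n₀ + 100, fun n hn C hC h => isQubitPerm_of_braket_ketM (by omega) hC
      ((sub_le_sub_left (hn₀ n (by omega)) 1).trans h)⟩
  · obtain ⟨n₁, hn₁⟩ := eventually_isQubitPerm_of_braket_psi h1 h12 c
    obtain ⟨n₂, hn₂⟩ := eventually_iso_of_braket_psi h1 h12 c
    obtain ⟨_, _, _, _, n₃, hn₃⟩ := psi_normalization h1 h12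
    refine ⟨n₁ + n₂ + n₃ + 2, fun n hn a b₁ b₂ ha ha' hb₁ hb₂ G₁ G₂ hs₁ hs₂ =>
      ⟨hn₁ n (by omega) a a b₁ b₂ ha ha' ha ha' hb₁ hb₂ G₁ G₂ hs₁ hs₂,
        hn₂ n (by omega) a a b₁ b₂ ha ha' ha ha' hb₁ hb₂ G₁ G₂ hs₁ hs₂, ?_⟩⟩
    rintro ⟨e⟩
    have hs : IsState (psi a b₂ G₁) := by
      rw [IsState, normSq_psi (by omega), star_dotProduct_graphState_congr (by omega) e,
        ← normSq_psi (by omega)]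
      exact hs₂
    obtain rfl : b₁ = b₂ := (hn₃ n (by omega) a ha ha' G₁).1.unique ⟨hb₁, hs₁⟩ ⟨hb₂, hs⟩
    exact ⟨_, qubitPerm_mem_cliffordGroup _, psi_eq_qubitPerm_mulVec (by omega) a b₁ e⟩
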